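/- Let $0\le\delta<1$ and let $\lambda:[0,\infty)\to(0,\infty)$ be non-decreasing and smooth, with all derivatives (of every order, including zero) growing at most polynomially, $\lambda(0)=\lambda_*>0$ and $\ln\lambda$ $\kappa$-Lipschitz. Consider the TCP process $(X_t)_{t\ge0}$ on $[0,\infty)$ with generator $$Lf(x)=f'(x)+\lambda(x)\bigl(f(\delta x)-f(x)\bigr),$$ that is, the process which moves at unit speed, jumps at rate $\lambda(X_t)$, and is multiplied by $\delta$ at each jump. Let $P_tf(x)=\mathbb E(f(X_t)\mid X_0=x)$ be its semigroup and $\mu$ its invariant probability law. Let $\mathcal A$ be the set of smooth functions on $[0,\infty)$ all of whose derivatives (of every order, including zero) grow at most polynomially, and for $f\in\mathcal A$, $t\ge0$ put $$W_t=\int \bigl((P_tf)'\bigr)^2\,d\mu,\qquad V_t=\int\Bigl(P_tf-\int f\,d\mu\Bigr)^2d\mu .$$ Say that $\mu$ satisfies the Poincaré inequality with constant $c$ if $\int f^2\,d\mu-(\int f\,d\mu)^2\le c\int (f')^2\,d\mu$ for all $f\in\mathcal A$. Then: 1. $\mu$ satisfies the Poincaré inequality with the explicit constant $$c_0=\frac{4}{\lambda_*^2}+\frac{32\,\delta^2}{\lambda_*^3(1-\delta^2)\,h\!\left(\frac{2\delta}{\lambda_*(1-\delta)}\right)},\qquad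 h(x)=\int_0^\infty e^{-\int_0^s\lambda(x+u)\,du}\,ds .$$ 2. If $\mu$ satisfies the Poincaré inequality with a constant $c$ (in particular for $c=c_0$), then for all $f\in\mathcal A$ and all $t\ge0$, $P_tf$ is differentiable on $[0,\infty)$, $P_tf$ and $(P_tf)'$ belong to $L^2(\mu)$, and $$W_t+\beta V_t\le (W_0+\beta V_0)\,e^{-\frac{\eta t}{1+\beta c}},\qquad \eta=\frac{\lambda_*(1-\delta^2)}2,\quad \beta=\frac{2\kappa^2}{1-\delta^2}.$$ -/

import Mathlib

open MeasureTheory ProbabilityTheory Set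
open scoped NNReal ENNReal ContDiff

noncomputable section

namespace TCP

/-- The class `𝒜` of test functions on the state space `[0, ∞)`: smooth functions (one-sidedly at
the origin) all of whose derivatives, of every order including zero, grow at most polynomially.
Functions on `[0, ∞)` are represented by functions on `ℝ` of which only the values on `[0, ∞)`
matter. -/
def TestFun (f : ℝ → ℝ) : Prop :=
  ContDiffOn ℝ ∞ f (Ici 0) ∧
    ∀ n : ℕ, ∃ (C : ℝ) (k : ℕ), ∀ x ∈ Ici (0 : ℝ),
      |iteratedDerivWithin n f (Ici 0) x| ≤ C * (1 + x) ^ k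

/-- The derivative of a function on `[0, ∞)`, one-sided at the origin. -/
def D (f : ℝ → ℝ) (x : ℝ) : ℝ := derivWithin f (Ici 0) x

/-- `Λ_x(s) = ∫₀ˢ λ(x + u) du`, the jump rate accumulated along the flow `u ↦ x + u`. -/
def cumRate (lam : ℝ → ℝ) (x s : ℝ) : ℝ := ∫ u in (0 : ℝ)..s, lam (x + u)

/-- The waiting time before the next jump from the position `x`: the first time at which the
accumulated rate reaches the level `r`. With `r` standard exponential its law satisfies
`ℙ (T > s) = exp (- Λ_x(s))`. -/
def waitingTime (lam : ℝ → ℝ) (x r : ℝ) : ℝ := sInf {s | 0 ≤ s ∧ r ≤ cumRate lam x s}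

/-- The time of the `n`-th jump and the position just after it, for the process started at `x`
and driven by the levels `e 0, e 1, …`: between jumps the process moves at unit speed, and a jump
multiplies the position by `δ`. -/
def skeleton (lam : ℝ → ℝ) (δ x : ℝ) (e : ℕ → ℝ) : ℕ → ℝ × ℝ
  | 0 => (0, x)
  | n + 1 =>
    let p := skeleton lam δ x e n
    let τ := waitingTime lam p.2 (e n)
    (p.1 + τ, δ * (p.2 + τ))

/-- The number of jumps up to time `t`. -/
def numJumps (lam : ℝ → ℝ) (δ x : ℝ) (e : ℕ → ℝ) (t : ℝ) : ℕ :=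
  sSup {n : ℕ | (skeleton lam δ x e n).1 ≤ t}

/-- The position at time `t` of the process started at `x` and driven by the levels `e`. -/
def process (lam : ℝ → ℝ) (δ x : ℝ) (e : ℕ → ℝ) (t : ℝ) : ℝ :=
  let p := skeleton lam δ x e (numJumps lam δ x e t)
  p.2 + (t - p.1)

/-- The law of a sequence of independent standard exponential variables. -/
def expSeq : Measure (ℕ → ℝ) := Measure.infinitePi fun _ : ℕ => expMeasure 1

/-- The semigroup `P_t f (x) = 𝔼 (f (X_t) | X_0 = x)`. -/
def semigroup (lam : ℝ → ℝ) (δ t : ℝ) (f : ℝ → ℝ) (x : ℝ) : ℝ :=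
  ∫ e, f (process lam δ x e t) ∂expSeq

/-- `μ` is an invariant law of the process: a probability measure on `[0, ∞)` such that if `X_0`
has law `μ` then so has `X_t`, for every `t ≥ 0`. -/
def IsInvariantLaw (lam : ℝ → ℝ) (δ : ℝ) (μ : Measure ℝ) : Prop :=
  IsProbabilityMeasure μ ∧ μ (Iio 0) = 0 ∧
    ∀ t : ℝ, 0 ≤ t → ∀ B : Set ℝ, MeasurableSet B →
      ∫⁻ x, expSeq {e | process lam δ x e t ∈ B} ∂μ = μ B

/-- The Poincaré inequality with constant `c`: `μ(f²) - (μ f)² ≤ c μ(f'²)` for all test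
functions. -/
def Poincare (μ : Measure ℝ) (c : ℝ) : Prop :=
  ∀ f : ℝ → ℝ, TestFun f → ∫ x, f x ^ 2 ∂μ - (∫ x, f x ∂μ) ^ 2 ≤ c * ∫ x, D f x ^ 2 ∂μ

/-- `W_t = μ(((P_t f)')²)`. -/
def W (lam : ℝ → ℝ) (δ : ℝ) (μ : Measure ℝ) (f : ℝ → ℝ) (t : ℝ) : ℝ :=
  ∫ x, D (semigroup lam δ t f) x ^ 2 ∂μ

/-- `V_t = μ((P_t f - μ f)²)`. -/
def V (lam : ℝ → ℝ) (δ : ℝ) (μ : Measure ℝ) (f : ℝ → ℝ) (t : ℝ) : ℝ :=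
  ∫ x, (semigroup lam δ t f x - ∫ y, f y ∂μ) ^ 2 ∂μ

/-- `h(x) = ∫₀^∞ exp(-Λ_x(s)) ds`, the mean waiting time before the next jump from `x`. -/
def meanWait (lam : ℝ → ℝ) (x : ℝ) : ℝ :=
  ∫ s in Ioi (0 : ℝ), Real.exp (-cumRate lam x s)

/-- The explicit Poincaré constant
`4 / λ_*² + 32 δ² / (λ_*³ (1 - δ²) h(2δ / (λ_* (1 - δ))))`, where `λ_* = λ(0)`. -/
def poincareConst (lam : ℝ → ℝ) (δ : ℝ) : ℝ :=
  4 / lam 0 ^ 2 +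
    32 * δ ^ 2 / (lam 0 ^ 3 * (1 - δ ^ 2) * meanWait lam (2 * δ / (lam 0 * (1 - δ))))

end TCP

end

noncomputable section

open Filter Topology

namespace TCP

/-! Three ingredients: calculus for the semigroup, a Poincaré inequality by way of the chain of
positions just after the jumps, and a dissipation inequality.

Calculus. The process is built by hand from exponential levels, so the semigroup is only an integral
over paths. Conditioning on the first jump gives a renewal equation (`semigroup_renewal`). On each
region `x + t ≤ R` its kernel has mass at most `1 - exp (-λ(R) R) < 1`, so Picard iteration yields
joint continuity, and locally bounded solutions are unique. Uniqueness gives Dynkin's formula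
(`dynkin`). Differentiability in space comes from trading a shift of the starting point for a shift
of time up to a jump term: `(P_t f)' = P_t (L f) - λ (P_t f(δ ·) - P_t f)`. Iterating this identity
shows that the semigroup preserves the test functions (`cls_semigroup`). The drift of `x ^ (p + 1)`
gives all moments of `μ`, whence `∫ L f dμ = 0` (`IsInvariantLaw.integral_gen`).

Poincaré. Write `R f (x) = ∫₀^∞ exp (-Λ_x(s)) f (x + s) ds`. Stationarity applied to `R f` gives `μ
f = (∫ λ dμ) ν (R f)`, where `ν` is the law after a jump, invariant for the chain `Q φ = R (λ φ(δ
·))`. Hardy-type inequalities for the weights `λ exp (-Λ_x)` and `exp (-Λ_x)` follow by integrating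
by parts and absorbing half of the left side. As `λ` is non-decreasing, `((Q φ)')² ≤ δ² Q (φ'²)`;
iterating the variance decomposition along `Q` sums a geometric series and gives a Poincaré
inequality for `ν`. To return to `μ`, the variance of `f` splits into a part within each inter-jump
stretch and the fluctuation of the local means `k = R f / h`. The weight `h` may vanish at infinity,
so `k` is compared with the non-decreasing primitive `Φ` of `|k'| √h`, centred at a point `x₀ ≤ 2δ /
(λ_* (1 - δ))` where `Φ` is close to its `ν`-mean; there `h(x₀)` is bounded below. See
`Stationary.variance_le`.

Decay. Differentiating `W + β V` along the semigroup and subtracting the null integrals of `L (g'²)`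
and `L ((g - m)²)`, with `g = P_t f`, leaves two non-positive jump terms. The commutator term `λ'
(g(δ x) - g(x)) g'` is absorbed by them because `|λ'| ≤ κ λ`, so `(W + β V)' ≤ -η W`. The Poincaré
inequality applied to `P_t f` gives `V ≤ c W`, hence `-η W ≤ -η (W + β V) / (1 + β c)`, and
Grönwall's argument concludes (`Stationary.decay`). -/

/-- A jump rate on the whole line: continuous, non-decreasing and bounded below by its value
`lam 0 > 0` at the origin. -/
structure GoodRate (lam : ℝ → ℝ) : Prop where
  cont : Continuous lam
  mono : Monotone lam
  pos : 0 < lam 0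
  low : ∀ x, lam 0 ≤ lam x

/-- The primitive of the jump rate vanishing at the origin. -/
def prim (lam : ℝ → ℝ) (x : ℝ) : ℝ := ∫ u in (0 : ℝ)..x, lam u

/-- The inverse of the primitive of the jump rate. -/
def primInv (lam : ℝ → ℝ) : ℝ → ℝ := Function.invFun (prim lam)

/-! ### Pathwise construction: waiting times, jumps, non-explosion, measurability. -/

section Deterministic

variable {lam : ℝ → ℝ} {δ : ℝ}

namespace GoodRate

lemma pos' (h : GoodRate lam) (x : ℝ) : 0 < lam x := h.pos.trans_le (h.low x)

lemma hasDerivAt_prim (h : GoodRate lam) (x : ℝ) : HasDerivAt (prim lam) (lam x) x :=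
  (h.cont.integral_hasStrictDerivAt 0 x).hasDerivAt

lemma continuous_prim (h : GoodRate lam) : Continuous (prim lam) :=
  continuous_iff_continuousAt.2 fun x => (h.hasDerivAt_prim x).continuousAt

lemma prim_sub (h : GoodRate lam) (x y : ℝ) : prim lam y - prim lam x = ∫ u in x..y, lam u :=
  intervalIntegral.integral_interval_sub_left (h.cont.intervalIntegrable _ _)
    (h.cont.intervalIntegrable _ _)

lemma le_prim_sub (h : GoodRate lam) {x y : ℝ} (hxy : x ≤ y) :
    lam 0 * (y - x) ≤ prim lam y - prim lam x := by
  rw [h.prim_sub]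
  have := intervalIntegral.integral_mono_on hxy (intervalIntegrable_const (μ := volume) (c := lam 0))
    (h.cont.intervalIntegrable x y) (fun u _ => h.low u)
  rw [intervalIntegral.integral_const, smul_eq_mul] at this
  linarith

lemma prim_sub_le (h : GoodRate lam) {x y : ℝ} (hxy : x ≤ y) :
    prim lam y - prim lam x ≤ lam y * (y - x) := by
  rw [h.prim_sub]
  have := intervalIntegral.integral_mono_on hxy (h.cont.intervalIntegrable x y)
    (intervalIntegrable_const (μ := volume) (c := lam y)) (fun u hu => h.mono hu.2)
  rw [intervalIntegral.integral_const, smul_eq_mul] at this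
  linarith

lemma strictMono_prim (h : GoodRate lam) : StrictMono (prim lam) := by
  intro x y hxy
  have := h.le_prim_sub hxy.le
  have := mul_pos h.pos (sub_pos.2 hxy)
  linarith

lemma surjective_prim (h : GoodRate lam) : Function.Surjective (prim lam) := by
  have h0 : prim lam 0 = 0 := intervalIntegral.integral_same
  refine h.continuous_prim.surjective ?_ ?_
  · refine tendsto_atTop_mono' _ ?_ (tendsto_id.const_mul_atTop h.pos)
    filter_upwards [eventually_ge_atTop 0] with x hx
    have := h.le_prim_sub hx
    simp only [id]; linarith
  · refine tendsto_atBot_mono' _ ?_ (tendsto_id.const_mul_atBot h.pos)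
    filter_upwards [eventually_le_atBot 0] with x hx
    have := h.le_prim_sub hx
    simp only [id]; linarith

lemma primInv_prim (h : GoodRate lam) (x : ℝ) : primInv lam (prim lam x) = x :=
  Function.leftInverse_invFun h.strictMono_prim.injective x

lemma prim_primInv (h : GoodRate lam) (x : ℝ) : prim lam (primInv lam x) = x :=
  Function.rightInverse_invFun h.surjective_prim x

lemma continuous_primInv (h : GoodRate lam) : Continuous (primInv lam) := by
  have : primInv lam = (h.strictMono_prim.orderIsoOfSurjective _ h.surjective_prim).symm := by
    ext y
    apply h.strictMono_prim.injective
    rw [h.prim_primInv]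
    exact ((h.strictMono_prim.orderIsoOfSurjective _ h.surjective_prim).apply_symm_apply y).symm
  rw [this]
  exact OrderIso.continuous _

lemma cumRate_eq (h : GoodRate lam) (x s : ℝ) :
    cumRate lam x s = prim lam (x + s) - prim lam x := by
  rw [cumRate, h.prim_sub, intervalIntegral.integral_comp_add_left (fun u => lam u) x, add_zero]

/-- The accumulated rate is an increment of `prim lam`, so reaching a level means inverting that
bijection. The `max` reflects the constraint `0 ≤ s` in the infimum: a negative level is reached at
once. -/
lemma waitingTime_eq (h : GoodRate lam) (x r : ℝ) :
    waitingTime lam x r = primInv lam (prim lam x + max r 0) - x := by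
  have key : {s | 0 ≤ s ∧ r ≤ cumRate lam x s} = Ici (primInv lam (prim lam x + max r 0) - x) := by
    ext s
    have e1 : primInv lam (prim lam x + max r 0) - x ≤ s ↔ max r 0 ≤ cumRate lam x s := by
      rw [sub_le_iff_le_add', ← h.strictMono_prim.le_iff_le, h.prim_primInv, h.cumRate_eq]
      constructor <;> intro <;> linarith
    have e2 : 0 ≤ s ↔ 0 ≤ cumRate lam x s := by
      rw [h.cumRate_eq, sub_nonneg, h.strictMono_prim.le_iff_le]
      constructor <;> intro <;> linarith
    simp only [mem_ofPred_eq, mem_Ici]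
    rw [e1, e2, max_le_iff, and_comm]
  rw [waitingTime, key, csInf_Ici]

lemma waitingTime_nonneg (h : GoodRate lam) (x r : ℝ) : 0 ≤ waitingTime lam x r := by
  rw [h.waitingTime_eq, sub_nonneg, ← h.strictMono_prim.le_iff_le, h.prim_primInv]
  linarith [le_max_right r 0]

lemma prim_add_waitingTime (h : GoodRate lam) (x r : ℝ) :
    prim lam (x + waitingTime lam x r) = prim lam x + max r 0 := by
  rw [h.waitingTime_eq, add_sub_cancel, h.prim_primInv]

lemma waitingTime_cumRate (h : GoodRate lam) {x s : ℝ} (hs : 0 ≤ s) :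
    waitingTime lam x (cumRate lam x s) = s := by
  have : 0 ≤ cumRate lam x s := by
    rw [h.cumRate_eq, sub_nonneg, h.strictMono_prim.le_iff_le]; linarith
  rw [h.waitingTime_eq, max_eq_left this, h.cumRate_eq, add_sub_cancel, h.primInv_prim]
  ring

lemma continuous_waitingTime (h : GoodRate lam) :
    Continuous fun p : ℝ × ℝ => waitingTime lam p.1 p.2 := by
  simp only [h.waitingTime_eq]
  have := h.continuous_prim
  have := h.continuous_primInv
  fun_prop

end GoodRate

/-- The definition recurses on the last jump. Conditioning on the first jump needs the opposite
decomposition, with the remaining levels shifted by one. -/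
lemma skeleton_succ' (lam : ℝ → ℝ) (δ x : ℝ) (e : ℕ → ℝ) (n : ℕ) :
    skeleton lam δ x e (n + 1) =
      (waitingTime lam x (e 0) + (skeleton lam δ (δ * (x + waitingTime lam x (e 0)))
          (fun i => e (i + 1)) n).1,
        (skeleton lam δ (δ * (x + waitingTime lam x (e 0))) (fun i => e (i + 1)) n).2) := by
  induction n with
  | zero => simp [skeleton]
  | succ n ih =>
    rw [skeleton, ih]
    simp only [skeleton, add_assoc]

lemma skeleton_fst_mono (h : GoodRate lam) (x : ℝ) (e : ℕ → ℝ) :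
    Monotone fun n => (skeleton lam δ x e n).1 :=
  monotone_nat_of_le_succ fun n => by
    simp only [skeleton]
    linarith [h.waitingTime_nonneg (skeleton lam δ x e n).2 (e n)]

lemma skeleton_fst_nonneg (h : GoodRate lam) (x : ℝ) (e : ℕ → ℝ) (n : ℕ) :
    0 ≤ (skeleton lam δ x e n).1 := by
  simpa [skeleton] using skeleton_fst_mono (δ := δ) h x e (Nat.zero_le n)

lemma skeleton_snd_mem (h : GoodRate lam) (hδ0 : 0 ≤ δ) (hδ1 : δ ≤ 1) {x : ℝ} (hx : 0 ≤ x)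
    (e : ℕ → ℝ) (n : ℕ) :
    0 ≤ (skeleton lam δ x e n).2 ∧ (skeleton lam δ x e n).2 ≤ x + (skeleton lam δ x e n).1 := by
  induction n with
  | zero => simp [skeleton, hx]
  | succ n ih =>
    simp only [skeleton]
    have := h.waitingTime_nonneg (skeleton lam δ x e n).2 (e n)
    have h1 : 0 ≤ (skeleton lam δ x e n).2 + waitingTime lam (skeleton lam δ x e n).2 (e n) := by
      linarith [ih.1]
    refine ⟨mul_nonneg hδ0 h1, ?_⟩
    have := mul_le_of_le_one_left h1 hδ1
    linarith [ih.2]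

lemma zero_mem_jumpSet {t : ℝ} (ht : 0 ≤ t) (x : ℝ) (e : ℕ → ℝ) :
    0 ∈ {n : ℕ | (skeleton lam δ x e n).1 ≤ t} := by simpa [skeleton] using ht

lemma skeleton_numJumps_le {t : ℝ} (ht : 0 ≤ t) (x : ℝ) (e : ℕ → ℝ) :
    (skeleton lam δ x e (numJumps lam δ x e t)).1 ≤ t := by
  by_cases hb : BddAbove {n : ℕ | (skeleton lam δ x e n).1 ≤ t}
  · exact Nat.sSup_mem ⟨0, zero_mem_jumpSet ht x e⟩ hb
  · rw [numJumps, Nat.sSup_of_not_bddAbove hb]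
    exact zero_mem_jumpSet ht x e

lemma process_mem (h : GoodRate lam) (hδ0 : 0 ≤ δ) (hδ1 : δ ≤ 1) {x t : ℝ} (hx : 0 ≤ x)
    (ht : 0 ≤ t) (e : ℕ → ℝ) : process lam δ x e t ∈ Icc 0 (x + t) := by
  have h1 := skeleton_numJumps_le (lam := lam) (δ := δ) ht x e
  have h2 := skeleton_snd_mem h hδ0 hδ1 hx e (numJumps lam δ x e t)
  simp only [process, mem_Icc]
  constructor <;> linarith [h2.1, h2.2]

lemma process_of_lt (h : GoodRate lam) {x t : ℝ} {e : ℕ → ℝ} (ht : t < waitingTime lam x (e 0)) :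
    process lam δ x e t = x + t := by
  have hN : numJumps lam δ x e t = 0 := by
    refine Nat.eq_zero_of_le_zero (csSup_le' fun n hn => ?_)
    by_contra hn0
    obtain ⟨m, rfl⟩ := Nat.exists_eq_succ_of_ne_zero (by simpa using hn0 : n ≠ 0)
    simp only [mem_ofPred_eq, Nat.succ_eq_add_one, skeleton_succ'] at hn
    linarith [skeleton_fst_nonneg (δ := δ) h (δ * (x + waitingTime lam x (e 0)))
      (fun i => e (i + 1)) m]
  simp [process, hN, skeleton]

/-- The strong Markov property at the first jump, path by path. Boundedness of the jump set is
needed because the supremum of an unbounded set of naturals is `0` by convention, which would break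
the count "one plus the later jumps". -/
lemma process_of_le {x t : ℝ} {e : ℕ → ℝ} (ht : waitingTime lam x (e 0) ≤ t)
    (hb : BddAbove {n : ℕ | (skeleton lam δ (δ * (x + waitingTime lam x (e 0)))
      (fun i => e (i + 1)) n).1 ≤ t - waitingTime lam x (e 0)}) :
    process lam δ x e t = process lam δ (δ * (x + waitingTime lam x (e 0)))
      (fun i => e (i + 1)) (t - waitingTime lam x (e 0)) := by
  set τ := waitingTime lam x (e 0) with hτ
  set e' : ℕ → ℝ := fun i => e (i + 1)
  set A := {n : ℕ | (skeleton lam δ x e n).1 ≤ t}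
  set A' := {n : ℕ | (skeleton lam δ (δ * (x + τ)) e' n).1 ≤ t - τ} with hA'
  have hA : ∀ n, n + 1 ∈ A ↔ n ∈ A' := fun n => by
    simp only [A, A', mem_ofPred_eq, skeleton_succ']
    constructor <;> intro <;> linarith
  have h0 : 0 ∈ A' := zero_mem_jumpSet (sub_nonneg.2 ht) _ _
  have hN : sSup A = sSup A' + 1 := by
    have hbA : BddAbove A := by
      obtain ⟨N, hN⟩ := hb
      refine ⟨N + 1, fun n hn => ?_⟩
      cases n with
      | zero => omega
      | succ n => exact Nat.succ_le_succ (hN ((hA n).1 hn))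
    apply le_antisymm
    · refine csSup_le ⟨0 + 1, (hA 0).2 h0⟩ fun n hn => ?_
      cases n with
      | zero => omega
      | succ n => exact Nat.succ_le_succ (le_csSup hb ((hA n).1 hn))
    · exact le_csSup hbA ((hA _).2 (Nat.sSup_mem ⟨0, h0⟩ hb))
  simp only [process, numJumps]
  change (skeleton lam δ x e (sSup A)).2 + (t - (skeleton lam δ x e (sSup A)).1) = _
  rw [hN, skeleton_succ']
  simp only [A', e', ← hτ]
  ring

/-- Non-explosion. Up to time `t` the position is at most `x + t`, so the rate is at most `lam (x +
t)`; the levels consumed by jumps before `t` therefore add up to at most `lam (x + t) * t`, which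
contradicts the divergence of their sum. -/
lemma bddAbove_jumpSet (h : GoodRate lam) (hδ0 : 0 ≤ δ) (hδ1 : δ ≤ 1) {x : ℝ} (hx : 0 ≤ x)
    {e : ℕ → ℝ} (he : ∀ C : ℝ, ∃ n, C < ∑ i ∈ Finset.range n, max (e i) 0) (t : ℝ) :
    BddAbove {n : ℕ | (skeleton lam δ x e n).1 ≤ t} := by
  have key : ∀ n, (skeleton lam δ x e n).1 ≤ t →
      ∑ i ∈ Finset.range n, max (e i) 0 ≤ lam (x + t) * (skeleton lam δ x e n).1 := by
    intro n
    induction n with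
    | zero => simp [skeleton]
    | succ n ih =>
      intro hn
      have hn' := (skeleton_fst_mono (δ := δ) h x e (Nat.le_succ n)).trans hn
      have h1 := ih hn'
      have h2 := skeleton_snd_mem h hδ0 hδ1 hx e n
      have h3 := h.prim_add_waitingTime (skeleton lam δ x e n).2 (e n)
      have h4 := h.waitingTime_nonneg (skeleton lam δ x e n).2 (e n)
      rw [Finset.sum_range_succ]
      simp only [skeleton] at hn ⊢
      set p := skeleton lam δ x e n
      set τ := waitingTime lam p.2 (e n)
      have h5 := h.prim_sub_le (x := p.2) (y := p.2 + τ) (by linarith)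
      have h6 : lam (p.2 + τ) ≤ lam (x + t) := h.mono (by linarith [h2.2])
      have h7 := mul_le_mul_of_nonneg_right h6 h4
      rw [h3] at h5
      have : p.2 + τ - p.2 = τ := by ring
      rw [this] at h5
      linarith
  obtain ⟨N, hN⟩ := he (lam (x + t) * t)
  refine ⟨N, fun n hn => ?_⟩
  by_contra hlt
  have h1 := (skeleton_fst_mono (δ := δ) h x e (not_le.1 hlt).le).trans hn
  have h2 := key N h1
  have h3 := mul_le_mul_of_nonneg_left h1 (h.pos' (x + t)).le
  linarith

lemma continuous_skeleton (h : GoodRate lam) (δ : ℝ) (n : ℕ) :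
    Continuous fun p : ℝ × (ℕ → ℝ) => skeleton lam δ p.1 p.2 n := by
  induction n with
  | zero => simp only [skeleton]; fun_prop
  | succ n ih =>
    simp only [skeleton]
    have h1 : Continuous fun p : ℝ × (ℕ → ℝ) =>
        waitingTime lam (skeleton lam δ p.1 p.2 n).2 (p.2 n) :=
      h.continuous_waitingTime.comp (ih.snd.prodMk (by fun_prop))
    exact (ih.fst.add h1).prodMk (continuous_const.mul (ih.snd.add h1))

/-- A positive value of the supremum is described by countably many comparisons of jump times with
`t`. The value `0` also covers the conventional suprema of empty and unbounded sets, so it is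
treated as the complement of all the others. -/
lemma measurable_numJumps (h : GoodRate lam) (δ : ℝ) :
    Measurable fun p : ℝ × ℝ × (ℕ → ℝ) => numJumps lam δ p.2.1 p.2.2 p.1 := by
  set A : ℕ → Set (ℝ × ℝ × (ℕ → ℝ)) := fun n => {p | (skeleton lam δ p.2.1 p.2.2 n).1 ≤ p.1}
  have hA : ∀ n, MeasurableSet (A n) := fun n =>
    measurableSet_le (((continuous_skeleton h δ n).measurable.comp measurable_snd).fst)
      measurable_fst
  have key : ∀ n, (fun p : ℝ × ℝ × (ℕ → ℝ) => numJumps lam δ p.2.1 p.2.2 p.1) ⁻¹' {n + 1} =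
      A (n + 1) ∩ ⋂ m, ⋂ (_ : n + 1 < m), (A m)ᶜ := by
    intro n
    ext p
    simp only [mem_preimage, mem_singleton_iff, numJumps, mem_inter_iff, mem_iInter, mem_compl_iff]
    set B := {n : ℕ | (skeleton lam δ p.2.1 p.2.2 n).1 ≤ p.1} with hB
    have hAB : ∀ m, p ∈ A m ↔ m ∈ B := fun m => Iff.rfl
    simp only [hAB]
    constructor
    · intro hs
      have hbdd : BddAbove B := by
        by_contra hb
        rw [Nat.sSup_of_not_bddAbove hb] at hs
        omega
      have hne : B.Nonempty := by
        rw [nonempty_iff_ne_empty]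
        intro he
        rw [he] at hs
        simp at hs
      refine ⟨hs ▸ Nat.sSup_mem hne hbdd, fun m hm hmB => ?_⟩
      have := le_csSup hbdd hmB
      omega
    · rintro ⟨h1, h2⟩
      have hub : ∀ m ∈ B, m ≤ n + 1 := fun m hm => not_lt.1 fun hlt => h2 m hlt hm
      exact le_antisymm (csSup_le ⟨_, h1⟩ hub) (le_csSup ⟨n + 1, hub⟩ h1)
  have hs : ∀ n, MeasurableSet
      ((fun p : ℝ × ℝ × (ℕ → ℝ) => numJumps lam δ p.2.1 p.2.2 p.1) ⁻¹' {n + 1}) := fun n => by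
    rw [key]
    exact (hA _).inter (MeasurableSet.iInter fun m => MeasurableSet.iInter fun _ => (hA m).compl)
  refine measurable_to_countable' fun n => ?_
  cases n with
  | succ n => exact hs n
  | zero =>
    have : (fun p : ℝ × ℝ × (ℕ → ℝ) => numJumps lam δ p.2.1 p.2.2 p.1) ⁻¹' {0} =
        (⋃ n, (fun p : ℝ × ℝ × (ℕ → ℝ) => numJumps lam δ p.2.1 p.2.2 p.1) ⁻¹' {n + 1})ᶜ := by
      ext p
      simp only [mem_preimage, mem_singleton_iff, mem_compl_iff, mem_iUnion, not_exists]
      constructor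
      · intro h0 n; omega
      · intro h0
        by_contra hne
        obtain ⟨m, hm⟩ := Nat.exists_eq_succ_of_ne_zero hne
        exact h0 m hm
    rw [this]
    exact (MeasurableSet.iUnion hs).compl

lemma measurable_process (h : GoodRate lam) (δ : ℝ) :
    Measurable fun p : ℝ × ℝ × (ℕ → ℝ) => process lam δ p.2.1 p.2.2 p.1 := by
  have h1 : ∀ n : ℕ, Measurable fun p : ℝ × ℝ × (ℕ → ℝ) =>
      (skeleton lam δ p.2.1 p.2.2 n).2 + (p.1 - (skeleton lam δ p.2.1 p.2.2 n).1) := fun n => by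
    have := (continuous_skeleton h δ n).measurable.comp
      (measurable_snd : Measurable fun p : ℝ × ℝ × (ℕ → ℝ) => p.2)
    exact this.snd.add (measurable_fst.sub this.fst)
  have h2 : Measurable fun q : ℕ × (ℝ × ℝ × (ℕ → ℝ)) =>
      (skeleton lam δ q.2.2.1 q.2.2.2 q.1).2 +
        (q.2.1 - (skeleton lam δ q.2.2.1 q.2.2.2 q.1).1) :=
    measurable_from_prod_countable_right h1
  exact h2.comp ((measurable_numJumps h δ).prodMk measurable_id)

end Deterministic

/-! ### The random levels and the renewal equation. -/

section Renewal

variable {lam : ℝ → ℝ} {δ : ℝ}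

instance : IsProbabilityMeasure (expMeasure 1) := isProbabilityMeasure_expMeasure one_pos

instance : IsProbabilityMeasure expSeq := by unfold expSeq; infer_instance

/-- The sequence with head `r` and tail `e`. -/
def seqCons (p : ℝ × (ℕ → ℝ)) : ℕ → ℝ
  | 0 => p.1
  | n + 1 => p.2 n

lemma measurable_seqCons : Measurable seqCons :=
  measurable_pi_lambda _ fun n => by
    cases n with
    | zero => exact measurable_fst
    | succ n => exact (measurable_pi_apply n).comp measurable_snd

/-- Splits off the first level, which is independent of the others. A product measure is
characterised by finite boxes, and the preimage of a box is a box in the head times a box in the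
tail with indices lowered by one. -/
lemma map_seqCons : ((expMeasure 1).prod expSeq).map seqCons = expSeq := by
  refine Measure.eq_infinitePi _ fun s t ht => ?_
  classical
  have hpre : seqCons ⁻¹' (Set.pi s t) =
      (if 0 ∈ s then t 0 else univ) ×ˢ
        (Set.pi ((s.erase 0).image Nat.pred : Finset ℕ) fun i => t (i + 1)) := by
    ext p
    simp only [mem_preimage, Set.mem_pi, mem_prod, Finset.coe_image, Finset.coe_erase]
    constructor
    · intro h
      refine ⟨?_, ?_⟩
      · split_ifs with h0
        · exact h 0 h0
        · trivial
      · rintro i ⟨j, ⟨hj, hj0⟩, rfl⟩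
        obtain ⟨m, rfl⟩ := Nat.exists_eq_succ_of_ne_zero (by simpa using hj0 : j ≠ 0)
        exact h _ hj
    · rintro ⟨h1, h2⟩ i hi
      cases i with
      | zero =>
        have : 0 ∈ s := hi
        rw [if_pos this] at h1
        exact h1
      | succ i => exact h2 i ⟨i + 1, ⟨hi, by simp⟩, rfl⟩
  rw [Measure.map_apply measurable_seqCons (MeasurableSet.pi s.countable_toSet fun i _ => ht i),
    hpre, Measure.prod_prod, expSeq, Measure.infinitePi_pi _ (fun i _ => ht (i + 1)),
    Finset.prod_image]
  · have : ∀ i ∈ s.erase 0, (expMeasure 1) (t (i.pred + 1)) = (expMeasure 1) (t i) := by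
      intro i hi
      rw [Nat.pred_eq_sub_one, Nat.sub_add_cancel
        (Nat.one_le_iff_ne_zero.2 (Finset.ne_of_mem_erase hi))]
    rw [Finset.prod_congr rfl this]
    split_ifs with h0
    · exact Finset.mul_prod_erase s (fun i => (expMeasure 1) (t i)) h0
    · rw [measure_univ, one_mul, Finset.erase_eq_of_notMem h0]
  · intro i hi j hj hij
    have hi0 := Finset.ne_of_mem_erase hi
    have hj0 := Finset.ne_of_mem_erase hj
    simp only [Nat.pred_eq_sub_one] at hij
    omega

lemma integral_expSeq {F : (ℕ → ℝ) → ℝ} (hF : Measurable F) {B : ℝ} (hB : ∀ e, |F e| ≤ B) :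
    ∫ e, F e ∂expSeq = ∫ r, ∫ e, F (seqCons (r, e)) ∂expSeq ∂(expMeasure 1) := by
  have h1 := integral_map (μ := (expMeasure 1).prod expSeq) measurable_seqCons.aemeasurable
    (f := F) hF.aestronglyMeasurable
  rw [map_seqCons] at h1
  rw [h1]
  refine integral_prod _ (Integrable.of_bound (hF.comp measurable_seqCons).aestronglyMeasurable B
    (ae_of_all _ fun p => hB _))

lemma integral_expMeasure (g : ℝ → ℝ) :
    ∫ r, g r ∂(expMeasure 1) = ∫ r in Ioi (0 : ℝ), Real.exp (-r) * g r := by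
  have h1 : expMeasure 1 = volume.withDensity (exponentialPDF 1) := rfl
  have hm : Measurable (exponentialPDF 1) :=
    ENNReal.measurable_ofReal.comp (measurable_exponentialPDFReal 1)
  rw [h1, integral_withDensity_eq_integral_toReal_smul hm
    (ae_of_all _ fun x => ENNReal.ofReal_lt_top), ← integral_Ici_eq_integral_Ioi,
    ← integral_indicator measurableSet_Ici]
  refine integral_congr_ae (ae_of_all _ fun r => ?_)
  simp only [indicator, mem_Ici, exponentialPDF_eq, smul_eq_mul]
  split_ifs with h
  · rw [ENNReal.toReal_ofReal (by positivity)]; simp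
  · simp

/-- Second Borel–Cantelli lemma: the independent events that the `n`-th level exceeds `1` share the
same positive probability, so almost surely infinitely many occur and the partial sums diverge. -/
lemma ae_sum_unbounded :
    ∀ᵐ e ∂expSeq, ∀ C : ℝ, ∃ n, C < ∑ i ∈ Finset.range n, max (e i) 0 := by
  set s : ℕ → Set (ℕ → ℝ) := fun n => {e | e n ∈ Ioi (1 : ℝ)}
  have hsm : ∀ n, MeasurableSet (s n) := fun n => measurable_pi_apply n measurableSet_Ioi
  have hpi : ∀ S : Finset ℕ, expSeq (⋂ i ∈ S, s i) = ∏ _i ∈ S, expMeasure 1 (Ioi (1 : ℝ)) := by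
    intro S
    have : (⋂ i ∈ S, s i) = Set.pi S fun _ => Ioi (1 : ℝ) := by
      ext e; simp [s, Set.mem_pi]
    rw [this, expSeq, Measure.infinitePi_pi _ fun _ _ => measurableSet_Ioi]
  have hone : ∀ n, expSeq (s n) = expMeasure 1 (Ioi (1 : ℝ)) := fun n => by
    simpa using hpi {n}
  have hind : iIndepSet s expSeq := by
    rw [iIndepSet_iff_meas_biInter hsm]
    intro S
    rw [hpi]
    exact Finset.prod_congr rfl fun i _ => (hone i).symm
  have hpos : expMeasure 1 (Ioi (1 : ℝ)) ≠ 0 := by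
    intro h0
    have h1 : expMeasure 1 = volume.withDensity (exponentialPDF 1) := rfl
    have hm : Measurable (exponentialPDF 1) :=
      ENNReal.measurable_ofReal.comp (measurable_exponentialPDFReal 1)
    rw [h1, withDensity_apply_eq_zero hm] at h0
    have h2 : {x | exponentialPDF 1 x ≠ 0} ∩ Ioi (1 : ℝ) = Ioi 1 := by
      refine inter_eq_right.2 fun x hx => ?_
      have : (0 : ℝ) ≤ x := by linarith [mem_Ioi.1 hx]
      simp only [mem_ofPred_eq, exponentialPDF_of_nonneg this]
      simp [Real.exp_pos]
    rw [h2, Real.volume_Ioi] at h0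
    exact ENNReal.top_ne_zero h0
  have hlim := measure_limsup_eq_one hsm hind (by
    simp_rw [hone]
    exact ENNReal.tsum_const_eq_top_of_ne_zero hpos)
  have hae : ∀ᵐ e ∂expSeq, e ∈ limsup s atTop := by
    rw [← prob_compl_eq_zero_iff (MeasurableSet.measurableSet_limsup hsm)] at hlim
    exact hlim
  filter_upwards [hae] with e he C
  rw [mem_limsup_iff_frequently_mem] at he
  have hinf : {n | e ∈ s n}.Infinite := Nat.frequently_atTop_iff_infinite.1 he
  obtain ⟨N, hN⟩ := exists_nat_gt C
  obtain ⟨T, hT, hTc⟩ := hinf.exists_subset_card_eq N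
  refine ⟨T.sup id + 1, hN.trans_le ?_⟩
  calc (N : ℝ) = ∑ _i ∈ T, (1 : ℝ) := by simp [hTc]
    _ ≤ ∑ i ∈ T, max (e i) 0 := Finset.sum_le_sum fun i hi =>
        (mem_Ioi.1 (hT hi)).le.trans (le_max_left _ _)
    _ ≤ _ := Finset.sum_le_sum_of_subset_of_nonneg
        (fun i hi => Finset.mem_range.2 (Nat.lt_succ_of_le (Finset.le_sup (f := id) hi)))
        fun i _ _ => le_max_right _ _

lemma abs_semigroup_le (h : GoodRate lam) (hδ0 : 0 ≤ δ) (hδ1 : δ ≤ 1) {f : ℝ → ℝ} {x t B : ℝ}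
    (hx : 0 ≤ x) (ht : 0 ≤ t) (hB : ∀ y ∈ Icc 0 (x + t), |f y| ≤ B) :
    |semigroup lam δ t f x| ≤ B := by
  have := norm_integral_le_of_norm_le_const (μ := expSeq) (C := B)
    (f := fun e => f (process lam δ x e t))
    (ae_of_all _ fun e => hB _ (process_mem h hδ0 hδ1 hx ht e))
  simpa [semigroup] using this

lemma measurable_semigroup (h : GoodRate lam) (δ : ℝ) {f : ℝ → ℝ} (hf : Measurable f) :
    Measurable fun p : ℝ × ℝ => semigroup lam δ p.1 f p.2 := by
  have h1 : StronglyMeasurable fun q : (ℝ × ℝ) × (ℕ → ℝ) =>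
      f (process lam δ q.1.2 q.2 q.1.1) := by
    refine (hf.comp ((measurable_process h δ).comp
      (g := fun p : ℝ × ℝ × (ℕ → ℝ) => process lam δ p.2.1 p.2.2 p.1)
      (f := fun q : (ℝ × ℝ) × (ℕ → ℝ) => (q.1.1, q.1.2, q.2)) ?_)).stronglyMeasurable
    fun_prop
  exact (h1.integral_prod_right' (ν := expSeq)).measurable

lemma measurable_process_path (h : GoodRate lam) (δ x t : ℝ) :
    Measurable fun e : ℕ → ℝ => process lam δ x e t :=
  (measurable_process h δ).comp (f := fun e : ℕ → ℝ => (t, x, e)) (by fun_prop)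

lemma continuous_cumRate (h : GoodRate lam) : Continuous fun p : ℝ × ℝ => cumRate lam p.1 p.2 := by
  simp only [h.cumRate_eq]
  have := h.continuous_prim
  fun_prop

lemma hasDerivAt_cumRate (h : GoodRate lam) (x s : ℝ) :
    HasDerivAt (cumRate lam x) (lam (x + s)) s := by
  have h1 : cumRate lam x = fun s => prim lam (x + s) - prim lam x := funext fun s => h.cumRate_eq x s
  rw [h1]
  simpa using ((h.hasDerivAt_prim (x + s)).comp_const_add x s).sub_const (prim lam x)

lemma cumRate_zero (lam : ℝ → ℝ) (x : ℝ) : cumRate lam x 0 = 0 := by simp [cumRate]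

lemma le_cumRate (h : GoodRate lam) (x : ℝ) {s : ℝ} (hs : 0 ≤ s) :
    lam 0 * s ≤ cumRate lam x s := by
  have := h.le_prim_sub (x := x) (y := x + s) (by linarith)
  rw [h.cumRate_eq]
  simpa using this

lemma tendsto_cumRate (h : GoodRate lam) (x : ℝ) : Tendsto (cumRate lam x) atTop atTop := by
  refine tendsto_atTop_mono' _ ?_ (tendsto_id.const_mul_atTop h.pos)
  filter_upwards [eventually_ge_atTop 0] with s hs using le_cumRate h x hs

lemma hasDerivAt_survival (h : GoodRate lam) (x s : ℝ) :
    HasDerivAt (fun s => -Real.exp (-cumRate lam x s))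
      (lam (x + s) * Real.exp (-cumRate lam x s)) s := by
  exact (hasDerivAt_cumRate h x s).neg.exp.neg.congr_deriv
    (by simp only [Pi.neg_apply]; ring)

lemma tendsto_survival (h : GoodRate lam) (x : ℝ) :
    Tendsto (fun s => -Real.exp (-cumRate lam x s)) atTop (𝓝 0) := by
  have := (Real.tendsto_exp_neg_atTop_nhds_zero.comp (tendsto_cumRate h x)).neg
  simpa using this

lemma integrableOn_density (h : GoodRate lam) (x t : ℝ) :
    IntegrableOn (fun s => lam (x + s) * Real.exp (-cumRate lam x s)) (Ioi t) :=
  integrableOn_Ioi_deriv_of_nonneg' (fun s _ => hasDerivAt_survival h x s)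
    (fun _ _ => mul_nonneg (h.pos' _).le (Real.exp_pos _).le) (tendsto_survival h x)

lemma integral_density (h : GoodRate lam) (x t : ℝ) :
    ∫ s in Ioi t, lam (x + s) * Real.exp (-cumRate lam x s) = Real.exp (-cumRate lam x t) := by
  rw [integral_Ioi_of_hasDerivAt_of_nonneg' (fun s _ => hasDerivAt_survival h x s)
    (fun _ _ => mul_nonneg (h.pos' _).le (Real.exp_pos _).le) (tendsto_survival h x)]
  ring

/-- Change of variables `r = Λ_x(s)`: the exponential law of the level becomes the density `λ(x + s)
exp (-Λ_x(s))` of the first waiting time. -/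
lemma integral_waitingTime (h : GoodRate lam) (x : ℝ) (Ψ : ℝ → ℝ) :
    ∫ r, Ψ (waitingTime lam x r) ∂(expMeasure 1) =
      ∫ s in Ioi (0 : ℝ), lam (x + s) * Real.exp (-cumRate lam x s) * Ψ s := by
  have hmono : StrictMono (cumRate lam x) :=
    strictMono_of_hasDerivAt_pos (hasDerivAt_cumRate h x) fun _ => h.pos' _
  have himg : cumRate lam x '' Ioi 0 = Ioi 0 := by
    ext r
    constructor
    · rintro ⟨s, hs, rfl⟩
      have := hmono (mem_Ioi.1 hs)
      rwa [cumRate_zero] at this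
    · intro hr
      have h1 : cumRate lam x (waitingTime lam x r) = r := by
        rw [h.cumRate_eq, h.prim_add_waitingTime, max_eq_left (mem_Ioi.1 hr).le]; ring
      refine ⟨waitingTime lam x r, ?_, h1⟩
      refine mem_Ioi.2 (hmono.lt_iff_lt.1 ?_)
      rw [h1, cumRate_zero]; exact hr
  rw [integral_expMeasure, ← himg, integral_image_eq_integral_abs_deriv_smul measurableSet_Ioi
    (fun s _ => (hasDerivAt_cumRate h x s).hasDerivWithinAt) hmono.injective.injOn, himg]
  refine setIntegral_congr_fun measurableSet_Ioi fun s hs => ?_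
  simp only [h.waitingTime_cumRate (mem_Ioi.1 hs).le, abs_of_pos (h.pos' _), smul_eq_mul, mul_assoc]

/-- The renewal equation: decomposition of the semigroup at the first jump. -/
theorem semigroup_renewal (h : GoodRate lam) (hδ0 : 0 ≤ δ) (hδ1 : δ ≤ 1) {f : ℝ → ℝ}
    (hf : Measurable f) {x t B : ℝ} (hx : 0 ≤ x) (ht : 0 ≤ t) (hB : ∀ y ∈ Icc 0 (x + t), |f y| ≤ B) :
    semigroup lam δ t f x = Real.exp (-cumRate lam x t) * f (x + t) +
      ∫ s in (0 : ℝ)..t, lam (x + s) * Real.exp (-cumRate lam x s) *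
        semigroup lam δ (t - s) f (δ * (x + s)) := by
  classical
  -- The conditional expectation of `f (X_t)` given that the first jump occurs at time `s`.
  set Ψ : ℝ → ℝ := fun s => if t < s then f (x + t) else semigroup lam δ (t - s) f (δ * (x + s))
  have h1 : semigroup lam δ t f x = ∫ r, Ψ (waitingTime lam x r) ∂(expMeasure 1) := by
    rw [semigroup, integral_expSeq (F := fun e => f (process lam δ x e t)) (hf.comp (measurable_process_path h δ x t))
      (fun e => hB _ (process_mem h hδ0 hδ1 hx ht e))]
    refine integral_congr_ae (ae_of_all _ fun r => ?_)
    simp only [Ψ]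
    split_ifs with hlt
    · have : ∀ e, process lam δ x (seqCons (r, e)) t = x + t := fun e => process_of_lt h hlt
      simp [this]
    · have hle := not_lt.1 hlt
      have hpos : 0 ≤ δ * (x + waitingTime lam x r) :=
        mul_nonneg hδ0 (by linarith [h.waitingTime_nonneg x r])
      refine integral_congr_ae ?_
      -- The restart at the first jump is only available on the almost sure event that excludes
      -- explosion.
      filter_upwards [ae_sum_unbounded] with e he
      rw [process_of_le (e := seqCons (r, e)) hle (bddAbove_jumpSet h hδ0 hδ1 hpos he _)]
      rfl
  have hΨm : Measurable Ψ := by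
    refine Measurable.ite measurableSet_Ioi measurable_const ?_
    exact (measurable_semigroup h δ hf).comp (f := fun s => (t - s, δ * (x + s))) (by fun_prop)
  have hint : IntegrableOn (fun s => lam (x + s) * Real.exp (-cumRate lam x s) * Ψ s) (Ioi 0) := by
    refine Integrable.mul_bdd (c := B) (integrableOn_density h x 0) hΨm.aestronglyMeasurable ?_
    refine (ae_restrict_iff' measurableSet_Ioi).2 (ae_of_all _ fun s hs => ?_)
    simp only [Ψ]
    have hs0 : 0 ≤ s := (mem_Ioi.1 hs).le
    split_ifs with hlt
    · exact hB _ ⟨by linarith, le_rfl⟩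
    · have h2 : 0 ≤ x + s := by linarith
      have h3 := mul_le_of_le_one_left h2 hδ1
      exact abs_semigroup_le h hδ0 hδ1 (mul_nonneg hδ0 h2) (by linarith)
        fun y hy => hB y ⟨hy.1, by linarith [hy.2]⟩
  rw [h1, integral_waitingTime h, ← Ioc_union_Ioi_eq_Ioi ht, setIntegral_union
    Ioc_disjoint_Ioi_same measurableSet_Ioi (hint.mono_set Ioc_subset_Ioi_self)
    (hint.mono_set (Ioi_subset_Ioi ht)), add_comm, intervalIntegral.integral_of_le ht]
  congr 1
  · rw [← integral_density h x t, ← integral_mul_const]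
    refine setIntegral_congr_fun measurableSet_Ioi fun s hs => ?_
    simp only [Ψ, if_pos (mem_Ioi.1 hs)]
  · refine setIntegral_congr_fun measurableSet_Ioc fun s hs => ?_
    simp only [Ψ, if_neg (not_lt.2 hs.2)]

end Renewal

/-! ### Finite-order classes of functions of polynomial growth, suited to induction on the order. -/

/-- At most polynomial growth on `[0, ∞)`. -/
def Growth (f : ℝ → ℝ) : Prop := ∃ (C : ℝ) (k : ℕ), ∀ x, 0 ≤ x → |f x| ≤ C * (1 + x) ^ k

/-- Functions of class `C^n` on `[0, ∞)` with derivatives up to order `n` of polynomial growth. -/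
def Cls : ℕ → (ℝ → ℝ) → Prop
  | 0, f => ContinuousOn f (Ici 0) ∧ Growth f
  | n + 1, f => DifferentiableOn ℝ f (Ici 0) ∧ Growth f ∧ Cls n (D f)

/-- The generator of the process. -/
def gen (lam : ℝ → ℝ) (δ : ℝ) (f : ℝ → ℝ) (x : ℝ) : ℝ := D f x + lam x * (f (δ * x) - f x)

section Algebra

variable {f g : ℝ → ℝ} {n : ℕ}

lemma pow_growth_mono {C x : ℝ} {k l : ℕ} (hx : 0 ≤ x) (hkl : k ≤ l) :
    C * (1 + x) ^ k ≤ |C| * (1 + x) ^ l := by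
  have h1 : (1 + x) ^ k ≤ (1 + x) ^ l := pow_le_pow_right₀ (by linarith) hkl
  have h2 : 0 ≤ (1 + x) ^ k := by positivity
  calc C * (1 + x) ^ k ≤ |C| * (1 + x) ^ k := mul_le_mul_of_nonneg_right (le_abs_self C) h2
    _ ≤ _ := mul_le_mul_of_nonneg_left h1 (abs_nonneg C)

lemma Growth.mono (hg : Growth g) (hfg : ∀ x, 0 ≤ x → |f x| ≤ |g x|) : Growth f := by
  obtain ⟨C, k, h⟩ := hg
  exact ⟨C, k, fun x hx => (hfg x hx).trans (h x hx)⟩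

lemma Growth.add (hf : Growth f) (hg : Growth g) : Growth fun x => f x + g x := by
  obtain ⟨C, k, hC⟩ := hf
  obtain ⟨C', k', hC'⟩ := hg
  refine ⟨|C| + |C'|, max k k', fun x hx => (abs_add_le _ _).trans ?_⟩
  rw [add_mul]
  exact add_le_add ((hC x hx).trans (pow_growth_mono hx (le_max_left _ _)))
    ((hC' x hx).trans (pow_growth_mono hx (le_max_right _ _)))

lemma Growth.mul (hf : Growth f) (hg : Growth g) : Growth fun x => f x * g x := by
  obtain ⟨C, k, hC⟩ := hf
  obtain ⟨C', k', hC'⟩ := hg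
  refine ⟨C * C', k + k', fun x hx => ?_⟩
  rw [abs_mul, pow_add]
  calc |f x| * |g x| ≤ (C * (1 + x) ^ k) * (C' * (1 + x) ^ k') :=
        mul_le_mul (hC x hx) (hC' x hx) (abs_nonneg _) ((abs_nonneg _).trans (hC x hx))
    _ = _ := by ring

lemma Growth.const (c : ℝ) : Growth fun _ => c := ⟨|c|, 0, fun x _ => by simp⟩

lemma Growth.id : Growth fun x => x :=
  ⟨1, 1, fun x hx => by rw [abs_of_nonneg hx]; linarith⟩

lemma Growth.comp_mul {δ : ℝ} (hδ0 : 0 ≤ δ) (hδ1 : δ ≤ 1) (hf : Growth f) :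
    Growth fun x => f (δ * x) := by
  obtain ⟨C, k, hC⟩ := hf
  refine ⟨|C|, k, fun x hx => (hC _ (mul_nonneg hδ0 hx)).trans ?_⟩
  refine (pow_growth_mono (mul_nonneg hδ0 hx) le_rfl).trans ?_
  have : δ * x ≤ x := mul_le_of_le_one_left hx hδ1
  have h0 : 0 ≤ δ * x := mul_nonneg hδ0 hx
  gcongr

lemma D_congr (h : EqOn f g (Ici 0)) : EqOn (D f) (D g) (Ici 0) := fun _ hx =>
  derivWithin_congr h (h hx)

lemma hasDerivWithinAt_D (hf : DifferentiableOn ℝ f (Ici 0)) {x : ℝ} (hx : 0 ≤ x) :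
    HasDerivWithinAt f (D f x) (Ici 0) x := (hf x hx).hasDerivWithinAt

lemma D_eq {f' x : ℝ} (hx : 0 ≤ x) (h : HasDerivWithinAt f f' (Ici 0) x) : D f x = f' :=
  h.derivWithin (uniqueDiffOn_Ici 0 x hx)

lemma Cls.growth (hf : Cls n f) : Growth f := by
  cases n with
  | zero => exact hf.2
  | succ n => exact hf.2.1

lemma Cls.continuousOn (hf : Cls n f) : ContinuousOn f (Ici 0) := by
  cases n with
  | zero => exact hf.1
  | succ n => exact hf.1.continuousOn

lemma Cls.zero (hf : Cls n f) : Cls 0 f := ⟨hf.continuousOn, hf.growth⟩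

lemma Cls.pred : ∀ {n : ℕ} {f : ℝ → ℝ}, Cls (n + 1) f → Cls n f
  | 0, _, hf => hf.zero
  | _ + 1, _, hf => ⟨hf.1, hf.2.1, Cls.pred hf.2.2⟩

lemma Cls.one (hf : Cls (n + 1) f) : Cls 1 f := ⟨hf.1, hf.2.1, hf.2.2.zero⟩

lemma Cls.congr : ∀ {n : ℕ} {f g : ℝ → ℝ}, Cls n f → EqOn g f (Ici 0) → Cls n g
  | 0, _, _, hf, h => ⟨hf.1.congr h, hf.2.mono fun x hx => by rw [h hx]⟩
  | _ + 1, _, _, hf, h =>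
    ⟨hf.1.congr h, hf.2.1.mono fun x hx => by rw [h hx], Cls.congr hf.2.2 (D_congr h)⟩

lemma Cls.add : ∀ {n : ℕ} {f g : ℝ → ℝ}, Cls n f → Cls n g → Cls n fun x => f x + g x
  | 0, _, _, hf, hg => ⟨hf.1.add hg.1, hf.2.add hg.2⟩
  | _ + 1, _, _, hf, hg => ⟨hf.1.add hg.1, hf.2.1.add hg.2.1, (hf.2.2.add hg.2.2).congr
      fun _ hx => D_eq hx ((hasDerivWithinAt_D hf.1 hx).add (hasDerivWithinAt_D hg.1 hx))⟩

lemma Cls.mul : ∀ {n : ℕ} {f g : ℝ → ℝ}, Cls n f → Cls n g → Cls n fun x => f x * g x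
  | 0, _, _, hf, hg => ⟨hf.1.mul hg.1, hf.2.mul hg.2⟩
  | _ + 1, _, _, hf, hg => ⟨hf.1.mul hg.1, hf.2.1.mul hg.2.1,
      ((hf.2.2.mul hg.pred).add (hf.pred.mul hg.2.2)).congr
      fun _ hx => D_eq hx ((hasDerivWithinAt_D hf.1 hx).mul (hasDerivWithinAt_D hg.1 hx))⟩

lemma Cls.const : ∀ (n : ℕ) (c : ℝ), Cls n fun _ => c
  | 0, c => ⟨continuousOn_const, Growth.const c⟩
  | n + 1, c => ⟨differentiableOn_const c, Growth.const c, (Cls.const n 0).congr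
      fun _ hx => D_eq hx (hasDerivWithinAt_const _ _ c)⟩

lemma Cls.id (n : ℕ) : Cls n fun x => x := by
  cases n with
  | zero => exact ⟨continuousOn_id, Growth.id⟩
  | succ n => exact ⟨differentiableOn_id, Growth.id, (Cls.const n 1).congr
      fun x hx => D_eq hx (hasDerivWithinAt_id x _)⟩

lemma Cls.pow (hf : Cls n f) (p : ℕ) : Cls n fun x => f x ^ p := by
  induction p with
  | zero => simpa using Cls.const n 1
  | succ p ih => simpa [pow_succ] using ih.mul hf

lemma Cls.sub (hf : Cls n f) (hg : Cls n g) : Cls n fun x => f x - g x := by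
  simpa [sub_eq_add_neg] using hf.add ((Cls.const n (-1)).mul hg)

lemma hasDerivWithinAt_comp_mul {δ : ℝ} (hδ0 : 0 ≤ δ) (hf : DifferentiableOn ℝ f (Ici 0)) {x : ℝ}
    (hx : 0 ≤ x) : HasDerivWithinAt (fun x => f (δ * x)) (δ * D f (δ * x)) (Ici 0) x := by
  have h1 : HasDerivWithinAt (fun x : ℝ => δ * x) δ (Ici 0) x := by
    simpa using (hasDerivWithinAt_id x (Ici 0)).const_mul δ
  have h2 := (hasDerivWithinAt_D hf (mul_nonneg hδ0 hx)).comp x h1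
    (fun y hy => mul_nonneg hδ0 hy)
  rwa [mul_comm] at h2

lemma Cls.comp_mul {δ : ℝ} (hδ0 : 0 ≤ δ) (hδ1 : δ ≤ 1) :
    ∀ {n : ℕ} {f : ℝ → ℝ}, Cls n f → Cls n fun x => f (δ * x)
  | 0, _, hf => ⟨hf.1.comp (by fun_prop) (fun _ hx => mul_nonneg hδ0 hx), hf.2.comp_mul hδ0 hδ1⟩
  | n + 1, _, hf => ⟨fun _ hx => (hasDerivWithinAt_comp_mul hδ0 hf.1 hx).differentiableWithinAt,
      hf.2.1.comp_mul hδ0 hδ1, ((Cls.const n δ).mul (Cls.comp_mul hδ0 hδ1 hf.2.2)).congr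
      fun _ hx => D_eq hx (hasDerivWithinAt_comp_mul hδ0 hf.1 hx)⟩

lemma Cls.gen {lam : ℝ → ℝ} {δ : ℝ} (hδ0 : 0 ≤ δ) (hδ1 : δ ≤ 1) (hlam : Cls n lam)
    (hf : Cls (n + 1) f) : Cls n (gen lam δ f) :=
  hf.2.2.add (hlam.mul ((hf.pred.comp_mul hδ0 hδ1).sub hf.pred))

lemma iteratedDerivWithin_succ_D (n : ℕ) (x : ℝ) :
    iteratedDerivWithin (n + 1) f (Ici 0) x = iteratedDerivWithin n (D f) (Ici 0) x := by
  rw [iteratedDerivWithin_succ']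
  rfl

lemma TestFun.D (hf : TestFun f) : TestFun (D f) := by
  refine ⟨hf.1.derivWithin (uniqueDiffOn_Ici 0) (by simp), fun n => ?_⟩
  obtain ⟨C, k, h⟩ := hf.2 (n + 1)
  exact ⟨C, k, fun x hx => by rw [← iteratedDerivWithin_succ_D n x]; exact h x hx⟩

lemma TestFun.cls (hf : TestFun f) (n : ℕ) : Cls n f := by
  have hg : ∀ g : ℝ → ℝ, TestFun g → Growth g := fun g hg => by
    obtain ⟨C, k, h⟩ := hg.2 0
    exact ⟨C, k, fun x hx => by simpa using h x hx⟩
  induction n generalizing f with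
  | zero => exact ⟨hf.1.continuousOn, hg f hf⟩
  | succ n ih => exact ⟨hf.1.differentiableOn (by simp), hg f hf, ih hf.D⟩

lemma testFun_of_cls (hf : ∀ n, Cls n f) : TestFun f := by
  constructor
  · rw [contDiffOn_infty]
    intro n
    have : ∀ {n : ℕ} {f : ℝ → ℝ}, Cls n f → ContDiffOn ℝ n f (Ici 0) := by
      intro n
      induction n with
      | zero => intro f hf; exact contDiffOn_zero.2 hf.1
      | succ n ih =>
        intro f hf
        push_cast
        rw [contDiffOn_succ_iff_derivWithin (uniqueDiffOn_Ici 0)]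
        exact ⟨hf.1, by simp, ih hf.2.2⟩
    exact this (hf n)
  · intro n
    have : ∀ {n : ℕ} {f : ℝ → ℝ}, Cls n f → Growth (iteratedDerivWithin n f (Ici 0)) := by
      intro n
      induction n with
      | zero => intro f hf; exact hf.2.mono fun x _ => by simp
      | succ n ih =>
        intro f hf
        exact (ih hf.2.2).mono fun x hx => by rw [iteratedDerivWithin_succ_D n x]
    obtain ⟨C, k, h⟩ := this (hf n)
    exact ⟨C, k, fun x hx => h x hx⟩

end Algebra

/-! ### Picard iteration for the renewal equation: continuity and uniqueness. -/

section Regularity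

variable {lam : ℝ → ℝ} {δ : ℝ}

/-- The extension of a function on `[0, ∞)` by its value at the origin. -/
def clamp (f : ℝ → ℝ) (x : ℝ) : ℝ := f (max x 0)

lemma clamp_of_nonneg (f : ℝ → ℝ) {x : ℝ} (hx : 0 ≤ x) : clamp f x = f x := by
  rw [clamp, max_eq_left hx]

lemma continuous_clamp {f : ℝ → ℝ} (hf : ContinuousOn f (Ici 0)) : Continuous (clamp f) :=
  hf.comp_continuous (by fun_prop) fun _ => mem_Ici.2 (le_max_right _ _)

lemma semigroup_congr (h : GoodRate lam) (hδ0 : 0 ≤ δ) (hδ1 : δ ≤ 1) {f g : ℝ → ℝ}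
    (hfg : EqOn f g (Ici 0)) {x t : ℝ} (hx : 0 ≤ x) (ht : 0 ≤ t) :
    semigroup lam δ t f x = semigroup lam δ t g x :=
  integral_congr_ae (ae_of_all _ fun e => hfg (process_mem h hδ0 hδ1 hx ht e).1)

lemma semigroup_clamp (h : GoodRate lam) (hδ0 : 0 ≤ δ) (hδ1 : δ ≤ 1) (f : ℝ → ℝ) {x t : ℝ}
    (hx : 0 ≤ x) (ht : 0 ≤ t) : semigroup lam δ t (clamp f) x = semigroup lam δ t f x :=
  semigroup_congr h hδ0 hδ1 (fun _ hy => clamp_of_nonneg f hy) hx ht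

lemma continuous_density (h : GoodRate lam) :
    Continuous fun p : ℝ × ℝ => lam (p.1 + p.2) * Real.exp (-cumRate lam p.1 p.2) := by
  have h1 := continuous_cumRate h
  have h2 := h.cont
  fun_prop

lemma continuous_density' (h : GoodRate lam) (x : ℝ) :
    Continuous fun s : ℝ => lam (x + s) * Real.exp (-cumRate lam x s) :=
  (continuous_density h).comp (f := fun s : ℝ => (x, s)) (by fun_prop)

lemma intervalIntegral_density (h : GoodRate lam) (x t : ℝ) :
    ∫ s in (0 : ℝ)..t, lam (x + s) * Real.exp (-cumRate lam x s) =
      1 - Real.exp (-cumRate lam x t) := by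
  rw [intervalIntegral.integral_eq_sub_of_hasDerivAt (fun s _ => hasDerivAt_survival h x s)
    ((continuous_density' h x).intervalIntegrable _ _), cumRate_zero]
  simp
  ring

lemma survival_ge (h : GoodRate lam) {x t R : ℝ} (hx : 0 ≤ x) (ht : 0 ≤ t) (hR : x + t ≤ R) :
    Real.exp (-(lam R * R)) ≤ Real.exp (-cumRate lam x t) := by
  refine Real.exp_le_exp.2 (neg_le_neg ?_)
  have h1 := h.prim_sub_le (x := x) (y := x + t) (by linarith)
  rw [h.cumRate_eq]
  refine h1.trans ?_
  exact mul_le_mul (h.mono hR) (by linarith) (by linarith) (h.pos' R).le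

/-- The kernel has for mass the probability of a jump before `t`. This is bounded away from `1`
while `x + t ≤ R`, so the renewal operator is a strict contraction there. -/
lemma abs_renewal_integral_le (h : GoodRate lam) {x t R A : ℝ} (hx : 0 ≤ x) (ht : 0 ≤ t)
    (hR : x + t ≤ R) (hA0 : 0 ≤ A) {d : ℝ → ℝ} (hA : ∀ s ∈ Icc 0 t, |d s| ≤ A) :
    |∫ s in (0 : ℝ)..t, lam (x + s) * Real.exp (-cumRate lam x s) * d s| ≤
      (1 - Real.exp (-(lam R * R))) * A := by
  have h1 : ∀ s, 0 ≤ lam (x + s) * Real.exp (-cumRate lam x s) := fun s =>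
    mul_nonneg (h.pos' _).le (Real.exp_pos _).le
  have h2 := intervalIntegral.norm_integral_le_of_norm_le ht
    (f := fun s => lam (x + s) * Real.exp (-cumRate lam x s) * d s)
    (g := fun s => lam (x + s) * Real.exp (-cumRate lam x s) * A) (μ := volume)
    (ae_of_all _ fun s hs => by
      rw [Real.norm_eq_abs, abs_mul, abs_of_nonneg (h1 s)]
      exact mul_le_mul_of_nonneg_left (hA s (Ioc_subset_Icc_self hs)) (h1 s))
    (((continuous_density' h x).mul continuous_const).intervalIntegrable _ _)
  rw [intervalIntegral.integral_mul_const, intervalIntegral_density h] at h2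
  refine h2.trans (mul_le_mul_of_nonneg_right ?_ hA0)
  linarith [survival_ge h hx ht hR]

/-- The region `x + t ≤ R` is stable under one renewal step: the time left shrinks as fast as the
position grows, and a jump does not increase the position. All estimates can thus be local although
the rate may be unbounded. -/
lemma renewal_step_mem (hδ0 : 0 ≤ δ) (hδ1 : δ ≤ 1) {x t R s : ℝ} (hx : 0 ≤ x)
    (hR : x + t ≤ R) (hs : s ∈ Icc 0 t) :
    0 ≤ t - s ∧ 0 ≤ δ * (x + s) ∧ δ * (x + s) + (t - s) ≤ R := by
  have h1 : 0 ≤ x + s := add_nonneg hx hs.1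
  have := mul_le_of_le_one_left h1 hδ1
  exact ⟨sub_nonneg.2 hs.2, mul_nonneg hδ0 h1, by linarith⟩

lemma intervalIntegrable_renewal (h : GoodRate lam) {x t A : ℝ} (ht : 0 ≤ t) {d : ℝ → ℝ}
    (hd : Measurable d) (hA : ∀ s ∈ Icc 0 t, |d s| ≤ A) :
    IntervalIntegrable (fun s => lam (x + s) * Real.exp (-cumRate lam x s) * d s) volume 0 t := by
  refine IntervalIntegrable.continuousOn_mul ?_ (continuous_density' h x).continuousOn
  rw [intervalIntegrable_iff_integrableOn_Ioc_of_le ht]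
  refine Measure.integrableOn_of_bounded (M := A) (by simp) hd.aestronglyMeasurable ?_
  exact (ae_restrict_iff' measurableSet_Ioc).2
    (ae_of_all _ fun s hs => hA s (Ioc_subset_Icc_self hs))

/-- Picard iterates of the renewal equation. -/
def picard (lam : ℝ → ℝ) (δ : ℝ) (f : ℝ → ℝ) : ℕ → ℝ × ℝ → ℝ
  | 0 => fun _ => 0
  | n + 1 => fun p => Real.exp (-cumRate lam p.2 p.1) * f (p.2 + p.1) +
      ∫ s in (0 : ℝ)..p.1, lam (p.2 + s) * Real.exp (-cumRate lam p.2 s) *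
        picard lam δ f n (p.1 - s, δ * (p.2 + s))

lemma continuous_picard (h : GoodRate lam) (δ : ℝ) {f : ℝ → ℝ} (hf : Continuous f) (n : ℕ) :
    Continuous (picard lam δ f n) := by
  induction n with
  | zero => exact continuous_const
  | succ n ih =>
    have h1 : Continuous fun p : ℝ × ℝ => cumRate lam p.2 p.1 :=
      (continuous_cumRate h).comp (f := fun p : ℝ × ℝ => (p.2, p.1)) (by fun_prop)
    have h2 : Continuous fun p : (ℝ × ℝ) × ℝ =>
        lam (p.1.2 + p.2) * Real.exp (-cumRate lam p.1.2 p.2) :=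
      (continuous_density h).comp (f := fun p : (ℝ × ℝ) × ℝ => (p.1.2, p.2)) (by fun_prop)
    refine Continuous.add (by fun_prop) ?_
    refine intervalIntegral.continuous_parametric_intervalIntegral_of_continuous
      (f := fun (p : ℝ × ℝ) s => lam (p.2 + s) * Real.exp (-cumRate lam p.2 s) *
        picard lam δ f n (p.1 - s, δ * (p.2 + s))) ?_ continuous_fst
    exact h2.mul (ih.comp (f := fun p : (ℝ × ℝ) × ℝ => (p.1.1 - p.2, δ * (p.1.2 + p.2)))
      (by fun_prop))

/-- The semigroup is a fixed point of the contraction of which `picard` lists the iterates. The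
locally uniform geometric rate lets it inherit their continuity. -/
lemma abs_semigroup_sub_picard_le (h : GoodRate lam) (hδ0 : 0 ≤ δ) (hδ1 : δ ≤ 1) {f : ℝ → ℝ}
    (hf : Continuous f) {R B : ℝ} (hB : ∀ y ∈ Icc 0 R, |f y| ≤ B) (n : ℕ) :
    ∀ t x : ℝ, 0 ≤ t → 0 ≤ x → x + t ≤ R →
      |semigroup lam δ t f x - picard lam δ f n (t, x)| ≤
        (1 - Real.exp (-(lam R * R))) ^ n * B := by
  have hbd : ∀ t x : ℝ, 0 ≤ t → 0 ≤ x → x + t ≤ R → |semigroup lam δ t f x| ≤ B :=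
    fun t x ht hx hR => abs_semigroup_le h hδ0 hδ1 hx ht fun y hy => hB y ⟨hy.1, hy.2.trans hR⟩
  induction n with
  | zero => intro t x ht hx hR; simpa [picard] using hbd t x ht hx hR
  | succ n ih =>
    intro t x ht hx hR
    have hR0 : 0 ≤ R := by linarith
    have hB0 : 0 ≤ B := (abs_nonneg _).trans (hB 0 ⟨le_rfl, hR0⟩)
    have hq : 0 ≤ 1 - Real.exp (-(lam R * R)) := by
      rw [sub_nonneg, Real.exp_le_one_iff]
      linarith [mul_nonneg (h.pos' R).le hR0]
    rw [semigroup_renewal h hδ0 hδ1 hf.measurable hx ht fun y hy => hB y ⟨hy.1, hy.2.trans hR⟩,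
      picard, add_sub_add_left_eq_sub, ← intervalIntegral.integral_sub]
    · simp_rw [← mul_sub]
      rw [pow_succ', mul_assoc]
      refine abs_renewal_integral_le h hx ht hR (by positivity) fun s hs => ?_
      obtain ⟨h1, h2, h3⟩ := renewal_step_mem hδ0 hδ1 hx hR hs
      exact ih _ _ h1 h2 h3
    · refine intervalIntegrable_renewal h ht (A := B) ?_ fun s hs => ?_
      · exact (measurable_semigroup h δ hf.measurable).comp (f := fun s => (t - s, δ * (x + s)))
          (by fun_prop)
      · obtain ⟨h1, h2, h3⟩ := renewal_step_mem hδ0 hδ1 hx hR hs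
        exact hbd _ _ h1 h2 h3
    · exact ((continuous_density' h x).mul ((continuous_picard h δ hf n).comp
        (f := fun s => (t - s, δ * (x + s))) (by fun_prop))).intervalIntegrable _ _

/-- The semigroup is jointly continuous in time and space on continuous functions. -/
theorem continuousOn_semigroup (h : GoodRate lam) (hδ0 : 0 ≤ δ) (hδ1 : δ ≤ 1) {f : ℝ → ℝ}
    (hf : ContinuousOn f (Ici 0)) :
    ContinuousOn (fun p : ℝ × ℝ => semigroup lam δ p.1 f p.2) (Ici 0 ×ˢ Ici 0) := by
  have hc := continuous_clamp hf
  suffices hs : ContinuousOn (fun p : ℝ × ℝ => semigroup lam δ p.1 (clamp f) p.2)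
      (Ici 0 ×ˢ Ici 0) from
    hs.congr fun p hp => (semigroup_clamp h hδ0 hδ1 f hp.2 hp.1).symm
  refine TendstoLocallyUniformlyOn.continuousOn (F := picard lam δ (clamp f)) (p := atTop) ?_
    (Frequently.of_forall fun n => (continuous_picard h δ hc n).continuousOn)
  rw [Metric.tendstoLocallyUniformlyOn_iff]
  intro ε hε p hp
  -- One unit of room, so that `x + t < R` holds in a neighbourhood of the given point.
  set R := p.1 + p.2 + 1
  obtain ⟨B, hB⟩ := isCompact_Icc.exists_bound_of_continuousOn (s := Icc 0 R) hc.continuousOn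
  refine ⟨{q | q.2 + q.1 < R} ∩ Ici 0 ×ˢ Ici 0, ?_, ?_⟩
  · refine inter_mem (mem_nhdsWithin_of_mem_nhds ?_) self_mem_nhdsWithin
    refine (isOpen_lt (by fun_prop) continuous_const).mem_nhds ?_
    simp only [R, mem_ofPred_eq]; linarith
  · have hR : 0 ≤ R := by
      have h1 : 0 ≤ p.1 := hp.1
      have h2 : 0 ≤ p.2 := hp.2
      simp only [R]; linarith
    have hq0 : 0 ≤ 1 - Real.exp (-(lam R * R)) := by
      rw [sub_nonneg, Real.exp_le_one_iff]
      linarith [mul_nonneg (h.pos' R).le hR]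
    have hlim : Tendsto (fun n : ℕ => (1 - Real.exp (-(lam R * R))) ^ n * B) atTop (𝓝 0) := by
      simpa using (tendsto_pow_atTop_nhds_zero_of_lt_one hq0
        (by linarith [Real.exp_pos (-(lam R * R))])).mul_const B
    filter_upwards [hlim.eventually_lt_const hε] with n hn q hq
    rw [Real.dist_eq]
    exact (abs_semigroup_sub_picard_le h hδ0 hδ1 hc hB n q.1 q.2 hq.2.1 hq.2.2
      (mem_ofPred_eq ▸ hq.1).le).trans_lt hn

lemma integral_triangle_swap {F : ℝ → ℝ → ℝ} (hF : Continuous (Function.uncurry F)) {t : ℝ}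
    (ht : 0 ≤ t) :
    ∫ r in (0 : ℝ)..t, ∫ s in (0 : ℝ)..r, F r s = ∫ s in (0 : ℝ)..t, ∫ r in s..t, F r s := by
  set G : ℝ → ℝ → ℝ := fun r s => {p : ℝ × ℝ | p.2 ≤ p.1}.indicator (Function.uncurry F) (r, s)
  have hGi : Integrable (Function.uncurry G)
      ((volume.restrict (Ioc 0 t)).prod (volume.restrict (Ioc 0 t))) := by
    have h1 : Integrable (Function.uncurry F)
        ((volume.restrict (Ioc 0 t)).prod (volume.restrict (Ioc 0 t))) := by
      rw [Measure.prod_restrict]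
      exact (hF.continuousOn.integrableOn_compact
        (isCompact_Icc.prod isCompact_Icc)).mono_set
        (prod_mono Ioc_subset_Icc_self Ioc_subset_Icc_self)
    exact h1.indicator (measurableSet_le measurable_snd measurable_fst)
  have h1 : ∀ r ∈ Ioc 0 t, ∫ s in (0 : ℝ)..r, F r s = ∫ s in Ioc 0 t, G r s := by
    intro r hr
    have : G r = (Iic r).indicator (F r) := by
      ext s; simp only [G, indicator, mem_ofPred_eq, mem_Iic, Function.uncurry]
    rw [this, setIntegral_indicator measurableSet_Iic, intervalIntegral.integral_of_le hr.1.le,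
      Ioc_inter_Iic, min_eq_right hr.2]
  have h2 : ∀ s ∈ Ioc 0 t, ∫ r in s..t, F r s = ∫ r in Ioc 0 t, G r s := by
    intro s hs
    have : (fun r => G r s) = (Ici s).indicator (fun r => F r s) := by
      ext r; simp only [G, indicator, mem_ofPred_eq, mem_Ici, Function.uncurry]
    rw [this, setIntegral_indicator measurableSet_Ici, intervalIntegral.integral_of_le hs.2,
      ← integral_Icc_eq_integral_Ioc]
    congr 2
    ext r
    simp only [mem_Icc, mem_inter_iff, mem_Ioc, mem_Ici]
    constructor
    · intro hr; exact ⟨⟨hs.1.trans_le hr.1, hr.2⟩, hr.1⟩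
    · intro hr; exact ⟨hr.2, hr.1.2⟩
  rw [intervalIntegral.integral_of_le ht, intervalIntegral.integral_of_le ht,
    setIntegral_congr_fun measurableSet_Ioc h1, setIntegral_congr_fun measurableSet_Ioc h2]
  exact integral_integral_swap hGi

/-- Uniqueness of locally bounded solutions of the renewal equation. -/
lemma renewal_unique (h : GoodRate lam) (hδ0 : 0 ≤ δ) (hδ1 : δ ≤ 1) {d : ℝ → ℝ → ℝ}
    (hbdd : ∀ R, ∃ A, ∀ t x, 0 ≤ t → 0 ≤ x → x + t ≤ R → |d t x| ≤ A)
    (hd : ∀ t x, 0 ≤ t → 0 ≤ x → d t x = ∫ s in (0 : ℝ)..t,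
      lam (x + s) * Real.exp (-cumRate lam x s) * d (t - s) (δ * (x + s)))
    {t x : ℝ} (ht : 0 ≤ t) (hx : 0 ≤ x) : d t x = 0 := by
  set R := x + t with hR
  obtain ⟨A, hA⟩ := hbdd R
  have hA0 : 0 ≤ A := (abs_nonneg _).trans (hA t x ht hx le_rfl)
  have hR0 : 0 ≤ R := by linarith
  have hq0 : 0 ≤ 1 - Real.exp (-(lam R * R)) := by
    rw [sub_nonneg, Real.exp_le_one_iff]
    linarith [mul_nonneg (h.pos' R).le hR0]
  have key : ∀ n : ℕ, ∀ t x, 0 ≤ t → 0 ≤ x → x + t ≤ R →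
      |d t x| ≤ (1 - Real.exp (-(lam R * R))) ^ n * A := by
    intro n
    induction n with
    | zero => simpa using hA
    | succ n ih =>
      intro t x ht hx hR
      rw [hd t x ht hx, pow_succ', mul_assoc]
      refine abs_renewal_integral_le h hx ht hR (by positivity) fun s hs => ?_
      obtain ⟨h1, h2, h3⟩ := renewal_step_mem hδ0 hδ1 hx hR hs
      exact ih _ _ h1 h2 h3
  have hlim : Tendsto (fun n : ℕ => (1 - Real.exp (-(lam R * R))) ^ n * A) atTop (𝓝 0) := by
    simpa using (tendsto_pow_atTop_nhds_zero_of_lt_one hq0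
      (by linarith [Real.exp_pos (-(lam R * R))])).mul_const A
  have := ge_of_tendsto' hlim fun n => key n t x ht hx le_rfl
  exact abs_eq_zero.1 (le_antisymm this (abs_nonneg _))

end Regularity

/-! ### Dynkin's formula and differentiability of the semigroup in time and space. -/

section Dynkin

variable {lam : ℝ → ℝ} {δ : ℝ} {f : ℝ → ℝ}

/-- The semigroup extended to negative times and positions by its values at the origin. -/
def semigroupExt (lam : ℝ → ℝ) (δ : ℝ) (f : ℝ → ℝ) (t x : ℝ) : ℝ :=
  semigroup lam δ (max t 0) f (max x 0)

lemma semigroupExt_eq (f : ℝ → ℝ) {t x : ℝ} (ht : 0 ≤ t) (hx : 0 ≤ x) :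
    semigroupExt lam δ f t x = semigroup lam δ t f x := by
  rw [semigroupExt, max_eq_left ht, max_eq_left hx]

lemma continuous_semigroupExt (h : GoodRate lam) (hδ0 : 0 ≤ δ) (hδ1 : δ ≤ 1)
    (hf : ContinuousOn f (Ici 0)) :
    Continuous fun p : ℝ × ℝ => semigroupExt lam δ f p.1 p.2 :=
  (continuousOn_semigroup h hδ0 hδ1 hf).comp_continuous
    (f := fun p : ℝ × ℝ => (max p.1 0, max p.2 0)) (by fun_prop)
    fun _ => ⟨mem_Ici.2 (le_max_right _ _), mem_Ici.2 (le_max_right _ _)⟩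

lemma renewal_of_continuousOn (h : GoodRate lam) (hδ0 : 0 ≤ δ) (hδ1 : δ ≤ 1)
    (hf : ContinuousOn f (Ici 0)) {x t : ℝ} (hx : 0 ≤ x) (ht : 0 ≤ t) :
    semigroup lam δ t f x = Real.exp (-cumRate lam x t) * f (x + t) +
      ∫ s in (0 : ℝ)..t, lam (x + s) * Real.exp (-cumRate lam x s) *
        semigroupExt lam δ f (t - s) (δ * (x + s)) := by
  have hc := continuous_clamp hf
  obtain ⟨B, hB⟩ := isCompact_Icc.exists_bound_of_continuousOn (s := Icc 0 (x + t)) hc.continuousOn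
  rw [← semigroup_clamp h hδ0 hδ1 f hx ht, semigroup_renewal h hδ0 hδ1 hc.measurable hx ht hB,
    clamp_of_nonneg f (by linarith)]
  congr 1
  refine intervalIntegral.integral_congr fun s hs => ?_
  rw [uIcc_of_le ht] at hs
  obtain ⟨h1, h2, -⟩ := renewal_step_mem hδ0 hδ1 hx le_rfl hs
  simp only [semigroup_clamp h hδ0 hδ1 f h2 h1, semigroupExt_eq f h1 h2]

lemma semigroup_zero (h : GoodRate lam) (hδ0 : 0 ≤ δ) (hδ1 : δ ≤ 1)
    (hf : ContinuousOn f (Ici 0)) {x : ℝ} (hx : 0 ≤ x) : semigroup lam δ 0 f x = f x := by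
  rw [renewal_of_continuousOn h hδ0 hδ1 hf hx le_rfl]
  simp [cumRate_zero]

lemma growth_semigroup (h : GoodRate lam) (hδ0 : 0 ≤ δ) (hδ1 : δ ≤ 1) (hf : Growth f) :
    ∃ (C : ℝ) (k : ℕ), 0 ≤ C ∧ ∀ t x, 0 ≤ t → 0 ≤ x → |semigroup lam δ t f x| ≤
      C * (1 + x + t) ^ k := by
  obtain ⟨C, k, hC⟩ := hf
  refine ⟨|C|, k, abs_nonneg C, fun t x ht hx => ?_⟩
  refine abs_semigroup_le h hδ0 hδ1 hx ht fun y hy => (hC y hy.1).trans ?_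
  refine (pow_growth_mono hy.1 le_rfl).trans (mul_le_mul_of_nonneg_left ?_ (abs_nonneg C))
  exact pow_le_pow_left₀ (by linarith [hy.1]) (by linarith [hy.2]) k

lemma cls_zero_semigroup (h : GoodRate lam) (hδ0 : 0 ≤ δ) (hδ1 : δ ≤ 1) (hf : Cls 0 f) {t : ℝ}
    (ht : 0 ≤ t) : Cls 0 (semigroup lam δ t f) := by
  constructor
  · exact (continuousOn_semigroup h hδ0 hδ1 hf.1).comp (f := fun x : ℝ => (t, x)) (by fun_prop)
      fun x hx => ⟨ht, hx⟩
  · obtain ⟨C, k, hC0, hC⟩ := growth_semigroup h hδ0 hδ1 hf.2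
    refine ⟨C * (1 + t) ^ k, k, fun x hx => (hC t x ht hx).trans ?_⟩
    rw [mul_assoc, ← mul_pow]
    refine mul_le_mul_of_nonneg_left (pow_le_pow_left₀ (by positivity) ?_ k) hC0
    nlinarith [mul_nonneg ht hx]

/-- Dynkin's formula up to the first jump: the fundamental theorem of calculus for `exp (-Λ_x(r)) f
(x + r)`, after which the jump part of the generator is moved to the other side. -/
lemma renewal_gen (h : GoodRate lam) (hδ0 : 0 ≤ δ) (hf : Cls 1 f) {x t : ℝ}
    (hx : 0 ≤ x) (ht : 0 ≤ t) :
    f x + ∫ r in (0 : ℝ)..t, Real.exp (-cumRate lam x r) * gen lam δ f (x + r) =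
      Real.exp (-cumRate lam x t) * f (x + t) +
        ∫ s in (0 : ℝ)..t, lam (x + s) * Real.exp (-cumRate lam x s) * f (δ * (x + s)) := by
  have hcE : Continuous fun r => Real.exp (-cumRate lam x r) :=
    Real.continuous_exp.comp ((continuous_cumRate h).comp (f := fun r : ℝ => (x, r))
      (by fun_prop)).neg
  have hshift : ∀ {g : ℝ → ℝ}, ContinuousOn g (Ici 0) →
      ContinuousOn (fun r => g (x + r)) (Icc 0 t) := fun hg =>
    hg.comp (by fun_prop) fun r hr => mem_Ici.2 (add_nonneg hx hr.1)
  have hD : ContinuousOn (D f) (Ici 0) := hf.2.2.1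
  have hcl : ContinuousOn (fun r => lam (x + r)) (Icc 0 t) :=
    (h.cont.comp (by fun_prop : Continuous fun r : ℝ => x + r)).continuousOn
  have hfδ : ContinuousOn (fun r => f (δ * (x + r))) (Icc 0 t) :=
    hf.1.continuousOn.comp (by fun_prop) fun r hr => mul_nonneg hδ0 (add_nonneg hx hr.1)
  have hderiv : ∀ r ∈ Ioo 0 t, HasDerivAt (fun r => Real.exp (-cumRate lam x r) * f (x + r))
      (Real.exp (-cumRate lam x r) * (D f (x + r) - lam (x + r) * f (x + r))) r := by
    intro r hr
    have hp : 0 < x + r := by linarith [hr.1]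
    have h1 := ((hasDerivWithinAt_D hf.1 hp.le).hasDerivAt (Ici_mem_nhds hp)).comp_const_add x r
    have h2 := (hasDerivAt_cumRate h x r).neg.exp
    refine (h2.mul h1).congr_deriv ?_
    simp only [Pi.neg_apply]; ring
  have hint : ContinuousOn (fun r => Real.exp (-cumRate lam x r) *
      (D f (x + r) - lam (x + r) * f (x + r))) (Icc 0 t) :=
    hcE.continuousOn.mul ((hshift hD).sub (hcl.mul (hshift hf.1.continuousOn)))
  have hint2 : ContinuousOn (fun r => lam (x + r) * Real.exp (-cumRate lam x r) *
      f (δ * (x + r))) (Icc 0 t) := (hcl.mul hcE.continuousOn).mul hfδ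
  have hftc := intervalIntegral.integral_eq_sub_of_hasDerivAt_of_le ht
    (hcE.continuousOn.mul (hshift hf.1.continuousOn)) hderiv
    (hint.intervalIntegrable_of_Icc ht)
  have hsplit : ∫ r in (0 : ℝ)..t, Real.exp (-cumRate lam x r) * gen lam δ f (x + r) =
      (∫ r in (0 : ℝ)..t, Real.exp (-cumRate lam x r) *
        (D f (x + r) - lam (x + r) * f (x + r))) +
      ∫ s in (0 : ℝ)..t, lam (x + s) * Real.exp (-cumRate lam x s) * f (δ * (x + s)) := by
    rw [← intervalIntegral.integral_add (hint.intervalIntegrable_of_Icc ht)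
      (hint2.intervalIntegrable_of_Icc ht)]
    congr 1; ext r
    simp only [gen]; ring
  rw [hsplit, hftc]
  simp only [Pi.mul_apply, cumRate_zero, add_zero, neg_zero, Real.exp_zero, one_mul]
  ring

/-- Dynkin's formula. -/
theorem dynkin (h : GoodRate lam) (hδ0 : 0 ≤ δ) (hδ1 : δ ≤ 1) (hlam : Cls 0 lam) (hf : Cls 1 f)
    {x t : ℝ} (hx : 0 ≤ x) (ht : 0 ≤ t) :
    semigroup lam δ t f x =
      f x + ∫ s in (0 : ℝ)..t, semigroupExt lam δ (gen lam δ f) s x := by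
  have hg : Cls 0 (gen lam δ f) := Cls.gen hδ0 hδ1 hlam hf
  set U := semigroupExt lam δ (gen lam δ f)
  have hU : Continuous fun p : ℝ × ℝ => U p.1 p.2 := continuous_semigroupExt h hδ0 hδ1 hg.1
  have hV : Continuous fun p : ℝ × ℝ => semigroupExt lam δ f p.1 p.2 :=
    continuous_semigroupExt h hδ0 hδ1 hf.continuousOn
  have hcf := continuous_clamp hf.continuousOn
  have hIU : Continuous fun p : ℝ × ℝ => ∫ s in (0 : ℝ)..p.1, U s p.2 := by
    refine intervalIntegral.continuous_parametric_intervalIntegral_of_continuous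
      (f := fun (p : ℝ × ℝ) s => U s p.2) ?_ continuous_fst
    exact hU.comp (f := fun q : (ℝ × ℝ) × ℝ => (q.2, q.1.2)) (by fun_prop)
  -- The defect in Dynkin's formula. It is continuous, hence locally bounded, and solves the renewal
  -- equation without source term, so uniqueness makes it vanish.
  set d : ℝ → ℝ → ℝ := fun t x =>
    semigroupExt lam δ f t x - (clamp f x + ∫ s in (0 : ℝ)..t, U s x)
  have hdc : Continuous fun p : ℝ × ℝ => d p.1 p.2 :=
    hV.sub ((hcf.comp continuous_snd).add hIU)
  suffices hs : d t x = 0 by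
    have := sub_eq_zero.1 hs
    rwa [semigroupExt_eq f ht hx, clamp_of_nonneg f hx] at this
  refine renewal_unique h hδ0 hδ1 (d := d) ?_ ?_ ht hx
  · intro R
    obtain ⟨A, hA⟩ := (isCompact_Icc.prod isCompact_Icc).exists_bound_of_continuousOn
      (s := Icc 0 R ×ˢ Icc 0 R) hdc.continuousOn
    exact ⟨A, fun t x ht hx hR => hA (t, x) ⟨⟨ht, by linarith⟩, ⟨hx, by linarith⟩⟩⟩
  · intro t x ht hx
    have hk := continuous_density' h x
    have hstep : ∀ {g : ℝ → ℝ → ℝ}, Continuous (fun p : ℝ × ℝ => g p.1 p.2) →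
        IntervalIntegrable (fun s => lam (x + s) * Real.exp (-cumRate lam x s) *
          g (t - s) (δ * (x + s))) volume 0 t := fun hg =>
      (hk.mul (hg.comp (f := fun s : ℝ => (t - s, δ * (x + s))) (by fun_prop))).intervalIntegrable
        _ _
    -- The renewal equation for `P_r (L f)`, integrated in `r`; exchanging the integrals over the
    -- triangle `s ≤ r ≤ t` shows that the time integral solves a renewal equation too.
    have hIUeq : ∫ r in (0 : ℝ)..t, U r x =
        (∫ r in (0 : ℝ)..t, Real.exp (-cumRate lam x r) * gen lam δ f (x + r)) +
        ∫ s in (0 : ℝ)..t, lam (x + s) * Real.exp (-cumRate lam x s) *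
          ∫ r in (0 : ℝ)..(t - s), U r (δ * (x + s)) := by
      have hF : Continuous (Function.uncurry fun r s : ℝ =>
          lam (x + s) * Real.exp (-cumRate lam x s) * U (r - s) (δ * (x + s))) :=
        (hk.comp continuous_snd).mul
          (hU.comp (f := fun p : ℝ × ℝ => (p.1 - p.2, δ * (x + p.2))) (by fun_prop))
      have hinner : ∀ s : ℝ, ∫ r in s..t, lam (x + s) * Real.exp (-cumRate lam x s) *
          U (r - s) (δ * (x + s)) = lam (x + s) * Real.exp (-cumRate lam x s) *
          ∫ r in (0 : ℝ)..(t - s), U r (δ * (x + s)) := fun s => by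
        rw [intervalIntegral.integral_const_mul,
          intervalIntegral.integral_comp_sub_right (fun r => U r (δ * (x + s))) s, sub_self]
      simp_rw [← hinner]
      rw [← integral_triangle_swap hF ht, ← intervalIntegral.integral_add]
      · refine intervalIntegral.integral_congr fun r hr => ?_
        rw [uIcc_of_le ht] at hr
        simp only [U]
        rw [semigroupExt_eq _ hr.1 hx, renewal_of_continuousOn h hδ0 hδ1 hg.1 hx hr.1]
      · refine ContinuousOn.intervalIntegrable_of_Icc ht ?_
        refine ContinuousOn.mul (Real.continuous_exp.comp ((continuous_cumRate h).comp
          (f := fun r : ℝ => (x, r)) (by fun_prop)).neg).continuousOn ?_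
        exact hg.1.comp (by fun_prop) fun r hr => mem_Ici.2 (add_nonneg hx hr.1)
      · refine Continuous.intervalIntegrable ?_ _ _
        exact intervalIntegral.continuous_parametric_intervalIntegral_of_continuous hF
          continuous_id
    have hfeq := renewal_gen h hδ0 hf hx ht
    have hcfeq : ∫ s in (0 : ℝ)..t, lam (x + s) * Real.exp (-cumRate lam x s) * f (δ * (x + s)) =
        ∫ s in (0 : ℝ)..t, lam (x + s) * Real.exp (-cumRate lam x s) *
          clamp f (δ * (x + s)) := by
      refine intervalIntegral.integral_congr fun s hs => ?_
      rw [uIcc_of_le ht] at hs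
      simp only [clamp_of_nonneg f (mul_nonneg hδ0 (add_nonneg hx hs.1))]
    have hpt : (fun s => lam (x + s) * Real.exp (-cumRate lam x s) * d (t - s) (δ * (x + s))) =
        fun s => lam (x + s) * Real.exp (-cumRate lam x s) *
            semigroupExt lam δ f (t - s) (δ * (x + s)) -
          (lam (x + s) * Real.exp (-cumRate lam x s) * clamp f (δ * (x + s)) +
            lam (x + s) * Real.exp (-cumRate lam x s) *
              ∫ r in (0 : ℝ)..(t - s), U r (δ * (x + s))) := by
      ext s; simp only [d]; ring
    rw [hpt]
    simp only [d]
    rw [intervalIntegral.integral_sub (hstep hV), intervalIntegral.integral_add,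
      semigroupExt_eq f ht hx, renewal_of_continuousOn h hδ0 hδ1 hf.continuousOn hx ht,
      clamp_of_nonneg f hx, hIUeq, ← hcfeq]
    · linarith
    · exact hstep (g := fun _ y => clamp f y) (hcf.comp continuous_snd)
    · exact hstep (g := fun t y => ∫ s in (0 : ℝ)..t, U s y) hIU
    · exact (hstep (g := fun _ y => clamp f y) (hcf.comp continuous_snd)).add
        (hstep (g := fun t y => ∫ s in (0 : ℝ)..t, U s y) hIU)

/-- The time derivative of the semigroup. -/
lemma hasDerivWithinAt_semigroup_time (h : GoodRate lam) (hδ0 : 0 ≤ δ) (hδ1 : δ ≤ 1)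
    (hlam : Cls 0 lam) (hf : Cls 1 f) {x t : ℝ} (hx : 0 ≤ x) (ht : 0 ≤ t) :
    HasDerivWithinAt (fun t => semigroup lam δ t f x) (semigroup lam δ t (gen lam δ f) x)
      (Ici 0) t := by
  have hg : Cls 0 (gen lam δ f) := Cls.gen hδ0 hδ1 hlam hf
  have hU : Continuous fun s => semigroupExt lam δ (gen lam δ f) s x :=
    (continuous_semigroupExt h hδ0 hδ1 hg.1).comp (f := fun s : ℝ => (s, x)) (by fun_prop)
  have h1 := ((hU.integral_hasStrictDerivAt 0 t).hasDerivAt.const_add (f x)).hasDerivWithinAt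
    (s := Ici 0)
  rw [semigroupExt_eq _ ht hx] at h1
  exact h1.congr (fun s hs => dynkin h hδ0 hδ1 hlam hf hx hs) (dynkin h hδ0 hδ1 hlam hf hx ht)

/-- Rescaling to `[0, 1]` writes the integral as `ε` times a continuous function of `ε`, so no
differentiability of `Ψ` in its first argument is required. -/
lemma hasDerivAt_integral_diagonal {Ψ : ℝ → ℝ → ℝ} (hΨ : Continuous fun p : ℝ × ℝ => Ψ p.1 p.2) :
    HasDerivAt (fun ε => ∫ s in (0 : ℝ)..ε, Ψ ε s) (Ψ 0 0) 0 := by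
  set m : ℝ → ℝ := fun ε => ∫ s in (0 : ℝ)..1, Ψ ε (ε * s)
  have hm : Continuous m :=
    intervalIntegral.continuous_parametric_intervalIntegral_of_continuous'
      (f := fun ε s => Ψ ε (ε * s))
      (hΨ.comp (f := fun p : ℝ × ℝ => (p.1, p.1 * p.2)) (by fun_prop)) 0 1
  have hm0 : m 0 = Ψ 0 0 := by simp [m]
  have heq : ∀ ε, ∫ s in (0 : ℝ)..ε, Ψ ε s = ε * m ε := fun ε => by
    have := intervalIntegral.smul_integral_comp_mul_left (a := 0) (b := 1) (Ψ ε) ε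
    simp only [mul_zero, mul_one, smul_eq_mul] at this
    rw [← this]
  simp_rw [heq]
  rw [hasDerivAt_iff_tendsto_slope_zero, ← hm0]
  refine (hm.tendsto 0).mono_left nhdsWithin_le_nhds |>.congr' ?_
  filter_upwards [self_mem_nhdsWithin] with ε hε
  have : ε ≠ 0 := hε
  simp [this]

/-- Decomposition according to the jumps before time `ε` only. It links the value at `(t, x + ε)` to
the value at `(t + ε, x)`, so that regularity in time can be turned into regularity in space. -/
lemma renewal_flow (h : GoodRate lam) (hδ0 : 0 ≤ δ) (hδ1 : δ ≤ 1)
    (hf : ContinuousOn f (Ici 0)) {x t ε : ℝ} (hx : 0 ≤ x) (ht : 0 ≤ t) (hε : 0 ≤ ε) :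
    semigroup lam δ (t + ε) f x = Real.exp (-cumRate lam x ε) * semigroup lam δ t f (x + ε) +
      ∫ s in (0 : ℝ)..ε, lam (x + s) * Real.exp (-cumRate lam x s) *
        semigroupExt lam δ f (t + ε - s) (δ * (x + s)) := by
  have hsum : ∀ s, Real.exp (-cumRate lam x ε) * Real.exp (-cumRate lam (x + ε) s) =
      Real.exp (-cumRate lam x (s + ε)) := fun s => by
    rw [← Real.exp_add, h.cumRate_eq, h.cumRate_eq, h.cumRate_eq,
      show x + (s + ε) = x + ε + s by ring]
    congr 1; ring
  have hc : Continuous fun s => lam (x + s) * Real.exp (-cumRate lam x s) *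
      semigroupExt lam δ f (t + ε - s) (δ * (x + s)) :=
    (continuous_density' h x).mul ((continuous_semigroupExt h hδ0 hδ1 hf).comp
      (f := fun s : ℝ => (t + ε - s, δ * (x + s))) (by fun_prop))
  have hshift := intervalIntegral.integral_comp_add_right (a := 0) (b := t)
    (fun s => lam (x + s) * Real.exp (-cumRate lam x s) *
      semigroupExt lam δ f (t + ε - s) (δ * (x + s))) ε
  rw [zero_add] at hshift
  rw [renewal_of_continuousOn h hδ0 hδ1 hf hx (by linarith),
    renewal_of_continuousOn h hδ0 hδ1 hf (by linarith : 0 ≤ x + ε) ht, mul_add, ← mul_assoc, hsum,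
    ← intervalIntegral.integral_const_mul, add_assoc,
    ← intervalIntegral.integral_add_adjacent_intervals (hc.intervalIntegrable 0 ε)
      (hc.intervalIntegrable ε (t + ε)), ← hshift, show x + (t + ε) = x + ε + t by ring,
    add_comm (∫ s in (0 : ℝ)..ε, _)]
  congr 2
  refine intervalIntegral.integral_congr fun s _ => ?_
  rw [← hsum, show t + ε - (s + ε) = t - s by ring, show x + (s + ε) = x + ε + s by ring]
  ring

/-- The space derivative of the semigroup. -/
theorem hasDerivWithinAt_semigroup (h : GoodRate lam) (hδ0 : 0 ≤ δ) (hδ1 : δ ≤ 1)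
    (hlam : Cls 0 lam) (hf : Cls 1 f) {x t : ℝ} (hx : 0 ≤ x) (ht : 0 ≤ t) :
    HasDerivWithinAt (semigroup lam δ t f) (semigroup lam δ t (gen lam δ f) x -
      lam x * (semigroup lam δ t f (δ * x) - semigroup lam δ t f x)) (Ici 0) x := by
  have hg : Cls 0 (gen lam δ f) := Cls.gen hδ0 hδ1 hlam hf
  set w : ℝ → ℝ := fun x => semigroup lam δ t (gen lam δ f) x -
      lam x * (semigroup lam δ t f (δ * x) - semigroup lam δ t f x)
  have hv0 : Cls 0 (semigroup lam δ t f) := cls_zero_semigroup h hδ0 hδ1 hf.zero ht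
  have hw0 : Cls 0 w := (cls_zero_semigroup h hδ0 hδ1 hg ht).sub
    (hlam.mul ((hv0.comp_mul hδ0 hδ1).sub hv0))
  -- Solving `renewal_flow` for the value at `y + ε` expresses it through the time derivative and a
  -- diagonal integral. As `ε ≥ 0`, only the right derivative is obtained.
  have hright : ∀ y, 0 ≤ y → HasDerivWithinAt (semigroup lam δ t f) (w y) (Ici y) y := by
    intro y hy
    set J : ℝ → ℝ := fun ε => ∫ s in (0 : ℝ)..ε, lam (y + s) * Real.exp (-cumRate lam y s) *
        semigroupExt lam δ f (t + ε - s) (δ * (y + s))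
    have hJ : HasDerivWithinAt J (lam y * semigroup lam δ t f (δ * y)) (Ici 0) 0 := by
      have := hasDerivAt_integral_diagonal (Ψ := fun ε s =>
        lam (y + s) * Real.exp (-cumRate lam y s) *
        semigroupExt lam δ f (t + ε - s) (δ * (y + s)))
        (((continuous_density' h y).comp continuous_snd).mul
          ((continuous_semigroupExt h hδ0 hδ1 hf.continuousOn).comp
          (f := fun p : ℝ × ℝ => (t + p.1 - p.2, δ * (y + p.2))) (by fun_prop)))
      simp only [cumRate_zero, add_zero, sub_zero, neg_zero, Real.exp_zero, mul_one,
        semigroupExt_eq f ht (mul_nonneg hδ0 hy)] at this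
      exact this.hasDerivWithinAt
    have hG : HasDerivWithinAt (fun ε => semigroup lam δ (t + ε) f y)
        (semigroup lam δ t (gen lam δ f) y) (Ici 0) 0 := by
      have h1 := hasDerivWithinAt_semigroup_time h hδ0 hδ1 hlam hf hy ht
      have h2 : HasDerivWithinAt (fun ε : ℝ => t + ε) 1 (Ici 0) 0 :=
        (hasDerivWithinAt_id 0 _).const_add t
      have h3 : HasDerivWithinAt (fun t => semigroup lam δ t f y)
        (semigroup lam δ t (gen lam δ f) y) (Ici 0) (t + 0) := by rwa [add_zero]
      have h4 := h3.comp 0 h2 fun ε hε => mem_Ici.2 (add_nonneg ht hε)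
      rwa [mul_one] at h4
    have hE : HasDerivWithinAt (fun ε => Real.exp (cumRate lam y ε)) (lam y) (Ici 0) 0 := by
      have := (hasDerivAt_cumRate h y 0).exp.hasDerivWithinAt (s := Ici 0)
      simpa [cumRate_zero] using this
    have hφ := hE.mul (hG.sub hJ)
    have hφ' : HasDerivWithinAt (fun ε => semigroup lam δ t f (y + ε)) (w y) (Ici 0) 0 := by
      refine (hφ.congr_of_eventuallyEq ?_ ?_).congr_deriv ?_
      · filter_upwards [self_mem_nhdsWithin] with ε hε
        simp only [Pi.mul_apply, Pi.sub_apply, J]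
        rw [renewal_flow h hδ0 hδ1 hf.continuousOn hy ht hε, add_sub_cancel_right, ← mul_assoc,
          ← Real.exp_add, add_neg_cancel, Real.exp_zero, one_mul]
      · simp [J, cumRate_zero]
      · simp only [w, J, Pi.sub_apply, cumRate_zero, intervalIntegral.integral_same, add_zero,
          Real.exp_zero]
        ring
    have h2 : HasDerivWithinAt (fun z : ℝ => z - y) 1 (Ici y) y :=
      (hasDerivWithinAt_id y _).sub_const y
    have h3 : HasDerivWithinAt (fun ε => semigroup lam δ t f (y + ε)) (w y) (Ici 0) (y - y) := by
      rwa [sub_self]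
    have h4 := h3.comp (h := fun z => z - y) y h2 fun z hz => mem_Ici.2 (sub_nonneg.2 hz)
    rw [mul_one] at h4
    simpa [Function.comp_def] using h4
  have hcw := continuous_clamp hw0.1
  have hprim : ∀ y, HasDerivAt (fun y => ∫ z in (0 : ℝ)..y, clamp w z) (clamp w y) y := fun y =>
    (hcw.integral_hasStrictDerivAt 0 y).hasDerivAt
  -- A continuous function with a continuous right derivative is a primitive of it: the difference
  -- from the primitive of `w` has zero right derivative. This upgrades one-sided to two-sided
  -- differentiability.
  have hrep : ∀ y, 0 ≤ y → semigroup lam δ t f y =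
      semigroup lam δ t f 0 + ∫ z in (0 : ℝ)..y, clamp w z := by
    intro y hy
    have := constant_of_has_deriv_right_zero (a := 0) (b := y)
      (f := fun y => semigroup lam δ t f y - ∫ z in (0 : ℝ)..y, clamp w z) ?_ ?_ y ⟨hy, le_rfl⟩
    · simp only [intervalIntegral.integral_same, sub_zero] at this
      linarith
    · refine ContinuousOn.sub (hv0.1.mono Icc_subset_Ici_self) ?_
      exact (continuous_iff_continuousAt.2 fun z => (hprim z).continuousAt).continuousOn
    · intro z hz
      have := (hright z hz.1).sub (hprim z).hasDerivWithinAt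
      rw [clamp_of_nonneg w hz.1, sub_self] at this
      exact this
  have hfin := ((hprim x).const_add (semigroup lam δ t f 0)).hasDerivWithinAt (s := Ici 0)
  rw [clamp_of_nonneg w hx] at hfin
  exact hfin.congr (fun y hy => hrep y hy) (hrep x hx)

lemma D_semigroup (h : GoodRate lam) (hδ0 : 0 ≤ δ) (hδ1 : δ ≤ 1)
    (hlam : Cls 0 lam) (hf : Cls 1 f) {x t : ℝ} (hx : 0 ≤ x) (ht : 0 ≤ t) :
    D (semigroup lam δ t f) x = semigroup lam δ t (gen lam δ f) x -
      lam x * (semigroup lam δ t f (δ * x) - semigroup lam δ t f x) :=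
  D_eq hx (hasDerivWithinAt_semigroup h hδ0 hδ1 hlam hf hx ht)

/-- The generator commutes with the semigroup. -/
lemma gen_semigroup (h : GoodRate lam) (hδ0 : 0 ≤ δ) (hδ1 : δ ≤ 1)
    (hlam : Cls 0 lam) (hf : Cls 1 f) {x t : ℝ} (hx : 0 ≤ x) (ht : 0 ≤ t) :
    gen lam δ (semigroup lam δ t f) x = semigroup lam δ t (gen lam δ f) x := by
  rw [gen, D_semigroup h hδ0 hδ1 hlam hf hx ht]; ring

/-- The semigroup preserves the regularity classes. -/
theorem cls_semigroup (h : GoodRate lam) (hδ0 : 0 ≤ δ) (hδ1 : δ ≤ 1) {n : ℕ}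
    (hlam : Cls n lam) {t : ℝ} (ht : 0 ≤ t) (hf : Cls n f) : Cls n (semigroup lam δ t f) := by
  induction n generalizing f with
  | zero => exact cls_zero_semigroup h hδ0 hδ1 hf ht
  | succ n ih =>
    have hv := ih hlam.pred hf.pred
    refine ⟨fun x hx => (hasDerivWithinAt_semigroup h hδ0 hδ1 hlam.zero hf.one hx
      ht).differentiableWithinAt, hv.growth, ?_⟩
    -- The formula for the space derivative involves only the semigroup itself, applied to `f` and
    -- to `gen lam δ f`. The generator costs one order of regularity, which the induction provides.
    exact ((ih hlam.pred (Cls.gen hδ0 hδ1 hlam.pred hf)).sub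
      (hlam.pred.mul ((hv.comp_mul hδ0 hδ1).sub hv))).congr
      fun x hx => D_semigroup h hδ0 hδ1 hlam.zero hf.one hx ht

end Dynkin

/-! ### Moments of the invariant law and infinitesimal stationarity. -/

section Invariant

variable {lam : ℝ → ℝ} {δ : ℝ} {f : ℝ → ℝ} {μ : Measure ℝ}

lemma integrable_process (h : GoodRate lam) (hδ0 : 0 ≤ δ) (hδ1 : δ ≤ 1)
    (hf : ContinuousOn f (Ici 0)) {x t : ℝ} (hx : 0 ≤ x) (ht : 0 ≤ t) :
    Integrable (fun e => f (process lam δ x e t)) expSeq := by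
  have hc := continuous_clamp hf
  obtain ⟨B, hB⟩ := isCompact_Icc.exists_bound_of_continuousOn (s := Icc 0 (x + t)) hc.continuousOn
  have h1 : Integrable (fun e => clamp f (process lam δ x e t)) expSeq :=
    Integrable.of_bound (hc.measurable.comp (measurable_process_path h δ x t)).aestronglyMeasurable
      B (ae_of_all _ fun e => hB _ (process_mem h hδ0 hδ1 hx ht e))
  exact h1.congr (ae_of_all _ fun e => clamp_of_nonneg f (process_mem h hδ0 hδ1 hx ht e).1)

/-- Supersolutions of the exponential relaxation equation. -/
lemma semigroup_le_of_gen_le (h : GoodRate lam) (hδ0 : 0 ≤ δ) (hδ1 : δ ≤ 1)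
    (hlam : Cls 0 lam) (hf : Cls 1 f) {c C : ℝ} (hc : 0 < c)
    (hgen : ∀ z, 0 ≤ z → gen lam δ f z ≤ C - c * f z) {x t : ℝ} (hx : 0 ≤ x) (ht : 0 ≤ t) :
    semigroup lam δ t f x ≤ C / c + Real.exp (-(c * t)) * (f x - C / c) := by
  have hder : ∀ s, 0 ≤ s → semigroup lam δ s (gen lam δ f) x ≤ C - c * semigroup lam δ s f x := by
    intro s hs
    have h1 := integral_mono (μ := expSeq)
      (integrable_process h hδ0 hδ1 (Cls.gen hδ0 hδ1 hlam hf).1 hx hs)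
      ((integrable_const C).sub ((integrable_process h hδ0 hδ1 hf.continuousOn hx hs).const_mul c))
      (fun e => hgen _ (process_mem h hδ0 hδ1 hx hs e).1)
    simp only [Pi.sub_apply] at h1
    rw [integral_sub (integrable_const C)
      ((integrable_process h hδ0 hδ1 hf.continuousOn hx hs).const_mul c),
      integral_const_mul] at h1
    simpa [semigroup] using h1
  have hd : ∀ s, 0 ≤ s → HasDerivWithinAt
      (fun s => Real.exp (c * s) * (semigroup lam δ s f x - C / c))
      (Real.exp (c * s) * (semigroup lam δ s (gen lam δ f) x - (C - c * semigroup lam δ s f x)))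
      (Ici 0) s := by
    intro s hs
    have h1 := (hasDerivWithinAt_semigroup_time h hδ0 hδ1 hlam hf hx hs).sub_const (C / c)
    have h2 : HasDerivWithinAt (fun s => Real.exp (c * s)) (Real.exp (c * s) * c) (Ici 0) s := by
      have := ((hasDerivAt_id s).const_mul c).exp.hasDerivWithinAt (s := Ici 0)
      simpa using this
    refine (h2.mul h1).congr_deriv ?_
    field_simp
    ring
  have hanti : AntitoneOn (fun s => Real.exp (c * s) * (semigroup lam δ s f x - C / c))
      (Ici 0) := by
    refine antitoneOn_of_hasDerivWithinAt_nonpos (convex_Ici 0)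
      (fun s hs => (hd s hs).continuousWithinAt)
      (fun s hs => (hd s (interior_subset hs)).mono interior_subset) fun s hs => ?_
    exact mul_nonpos_of_nonneg_of_nonpos (Real.exp_pos _).le
      (sub_nonpos.2 (hder s (interior_subset hs)))
  have h1 := hanti (mem_Ici.2 le_rfl) (mem_Ici.2 ht) ht
  simp only [mul_zero, Real.exp_zero, one_mul] at h1
  rw [semigroup_zero h hδ0 hδ1 hf.continuousOn hx] at h1
  have h2 := mul_le_mul_of_nonneg_left h1 (Real.exp_pos (-(c * t))).le
  rw [← mul_assoc, ← Real.exp_add, neg_add_cancel, Real.exp_zero, one_mul] at h2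
  linarith

lemma IsInvariantLaw.ae_nonneg (hμ : IsInvariantLaw lam δ μ) : ∀ᵐ x ∂μ, 0 ≤ x := by
  have h1 : ∀ᵐ x ∂μ, x ∉ Iio 0 := measure_eq_zero_iff_ae_notMem.1 hμ.2.1
  filter_upwards [h1] with x hx using not_lt.1 hx

lemma IsInvariantLaw.restrict_Ici (hμ : IsInvariantLaw lam δ μ) : μ.restrict (Ici 0) = μ :=
  Measure.restrict_eq_self_of_ae_mem hμ.ae_nonneg

lemma IsInvariantLaw.aestronglyMeasurable (hμ : IsInvariantLaw lam δ μ)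
    (hf : ContinuousOn f (Ici 0)) : AEStronglyMeasurable f μ := by
  rw [← hμ.restrict_Ici]
  exact hf.aestronglyMeasurable measurableSet_Ici

lemma IsInvariantLaw.map_process (h : GoodRate lam) (hμ : IsInvariantLaw lam δ μ) {t : ℝ}
    (ht : 0 ≤ t) : (μ.prod expSeq).map (fun p => process lam δ p.1 p.2 t) = μ := by
  have := hμ.1
  have hm : Measurable fun p : ℝ × (ℕ → ℝ) => process lam δ p.1 p.2 t :=
    (measurable_process h δ).comp (f := fun p : ℝ × (ℕ → ℝ) => (t, p.1, p.2)) (by fun_prop)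
  ext B hB
  rw [Measure.map_apply hm hB, Measure.prod_apply (hm hB), ← hμ.2.2 t ht B hB]
  rfl

lemma IsInvariantLaw.integrable_semigroup (h : GoodRate lam) (hμ : IsInvariantLaw lam δ μ) {t : ℝ}
    (ht : 0 ≤ t) (hf : Integrable f μ) :
    Integrable (fun p : ℝ × (ℕ → ℝ) => f (process lam δ p.1 p.2 t)) (μ.prod expSeq) := by
  have hm : Measurable fun p : ℝ × (ℕ → ℝ) => process lam δ p.1 p.2 t :=
    (measurable_process h δ).comp (f := fun p : ℝ × (ℕ → ℝ) => (t, p.1, p.2)) (by fun_prop)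
  have hf' : Integrable f ((μ.prod expSeq).map fun p => process lam δ p.1 p.2 t) := by
    rwa [hμ.map_process h ht]
  exact hf'.comp_measurable hm

lemma IsInvariantLaw.integral_semigroup (h : GoodRate lam) (hμ : IsInvariantLaw lam δ μ) {t : ℝ}
    (ht : 0 ≤ t) (hf : Integrable f μ) : ∫ x, semigroup lam δ t f x ∂μ = ∫ x, f x ∂μ := by
  have := hμ.1
  have hm : Measurable fun p : ℝ × (ℕ → ℝ) => process lam δ p.1 p.2 t :=
    (measurable_process h δ).comp (f := fun p : ℝ × (ℕ → ℝ) => (t, p.1, p.2)) (by fun_prop)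
  have h1 := integral_map (μ := μ.prod expSeq) hm.aemeasurable (f := f)
    (by rw [hμ.map_process h ht]; exact hf.aestronglyMeasurable)
  rw [hμ.map_process h ht] at h1
  rw [h1, integral_prod _ (hμ.integrable_semigroup h ht hf)]
  rfl

/-- A Lyapunov condition: jumps contribute at most `-2c z ^ (p + 1)`. Half of this controls the
transport term `(p + 1) z ^ p`, the other half is kept. -/
lemma gen_pow_le (h : GoodRate lam) (hδ0 : 0 ≤ δ) (hδ1 : δ ≤ 1) (p : ℕ) {c : ℝ} (hc : 0 < c)
    (hcδ : 2 * c = lam 0 * (1 - δ)) {z : ℝ} (hz : 0 ≤ z) :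
    gen lam δ (fun x => x ^ (p + 1)) z ≤ (p + 1) * ((p + 1) / c) ^ p - c * z ^ (p + 1) := by
  have hD : D (fun x => x ^ (p + 1)) z = (p + 1) * z ^ p := by
    refine D_eq hz ?_
    simpa using (hasDerivAt_pow (p + 1) z).hasDerivWithinAt
  have hp : (0 : ℝ) < p + 1 := by positivity
  have hδp : δ ^ (p + 1) ≤ δ := by
    simpa using pow_le_pow_of_le_one hδ0 hδ1 (Nat.le_add_left 1 p)
  have hzp : 0 ≤ z ^ (p + 1) := by positivity
  have h1 : lam z * ((δ * z) ^ (p + 1) - z ^ (p + 1)) ≤ -(2 * c) * z ^ (p + 1) := by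
    rw [hcδ, mul_pow]
    have h2 : lam 0 * (1 - δ) ≤ lam z * (1 - δ ^ (p + 1)) :=
      mul_le_mul (h.low z) (by linarith) (by linarith) (h.pos' z).le
    nlinarith [mul_le_mul_of_nonneg_right h2 hzp]
  have h3 : (p + 1) * z ^ p - c * z ^ (p + 1) ≤ (p + 1) * ((p + 1) / c) ^ p := by
    -- Beyond this threshold the term `c * z ^ (p + 1)` dominates the transport term.
    rcases le_total z ((p + 1) / c) with hle | hle
    · have := pow_le_pow_left₀ hz hle p
      have := mul_le_mul_of_nonneg_left this hp.le
      linarith [mul_nonneg hc.le hzp]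
    · rw [div_le_iff₀ hc] at hle
      have hz' : 0 ≤ z ^ p := by positivity
      have : 0 ≤ (p + 1) * ((p + 1) / c) ^ p := by positivity
      have h5 := mul_le_mul_of_nonneg_right hle hz'
      rw [pow_succ]
      nlinarith
  rw [gen, hD]
  linarith

/-- The invariant law has moments of all orders. -/
lemma IsInvariantLaw.integrable_pow (h : GoodRate lam) (hδ0 : 0 ≤ δ) (hδ1 : δ < 1)
    (hlam : Cls 0 lam) (hμ : IsInvariantLaw lam δ μ) (p : ℕ) :
    Integrable (fun x => x ^ (p + 1)) μ := by
  have := hμ.1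
  set c := lam 0 * (1 - δ) / 2 with hc
  have hc0 : 0 < c := by have := mul_pos h.pos (sub_pos.2 hδ1); positivity
  set M : ℝ := (p + 1) * ((p + 1) / c) ^ p / c with hM
  have hM0 : 0 ≤ M := by positivity
  set f : ℝ → ℝ := fun x => x ^ (p + 1)
  have hf : Cls 1 f := (Cls.id 1).pow (p + 1)
  have hcf : Continuous (clamp f) := continuous_clamp hf.continuousOn
  have hcf0 : ∀ x, 0 ≤ clamp f x := fun x => pow_nonneg (le_max_right x 0) _
  have hle : ∀ t x, 0 ≤ t → 0 ≤ x → semigroup lam δ t f x ≤ M + Real.exp (-(c * t)) * f x := by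
    intro t x ht hx
    have := semigroup_le_of_gen_le h hδ0 hδ1.le hlam hf hc0
      (fun z hz => gen_pow_le h hδ0 hδ1.le p hc0 (by rw [hc]; ring) hz) hx ht
    have h2 := mul_nonneg (Real.exp_pos (-(c * t))).le hM0
    rw [← hM] at this
    linarith
  -- Integrability of `f` is the goal, so invariance is used on truncations: their mean is bounded
  -- by that of `min (M + exp (-c t) f, K)`, which tends to `min M K` as `t → ∞`.
  have hbound : ∀ K : ℕ, ∫ x, min (clamp f x) K ∂μ ≤ M := by
    intro K
    have hcK : Continuous fun x => min (clamp f x) (K : ℝ) := hcf.min continuous_const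
    have hK0 : ∀ x, 0 ≤ min (clamp f x) (K : ℝ) := fun x => le_min (hcf0 x) (by positivity)
    have hKi : Integrable (fun x => min (clamp f x) (K : ℝ)) μ :=
      Integrable.of_bound hcK.aestronglyMeasurable K (ae_of_all _ fun x => by
        rw [Real.norm_eq_abs, abs_of_nonneg (hK0 x)]; exact min_le_right _ _)
    have hgi : ∀ t : ℝ, Integrable (fun x => min (M + Real.exp (-(c * t)) * clamp f x) (K : ℝ)) μ :=
      fun t => Integrable.of_bound
        ((continuous_const.add (continuous_const.mul hcf)).min
          continuous_const).aestronglyMeasurable K (ae_of_all _ fun x => by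
        rw [Real.norm_eq_abs, abs_of_nonneg (le_min (add_nonneg hM0
          (mul_nonneg (Real.exp_pos _).le (hcf0 x))) (by positivity))]; exact min_le_right _ _)
    have h1 : ∀ n : ℕ, ∫ x, min (clamp f x) K ∂μ ≤
        ∫ x, min (M + Real.exp (-(c * n)) * clamp f x) (K : ℝ) ∂μ := by
      intro n
      have hn : (0 : ℝ) ≤ n := by positivity
      rw [← hμ.integral_semigroup h hn hKi]
      refine integral_mono_ae (hμ.integrable_semigroup h hn hKi).integral_prod_left (hgi n) ?_
      filter_upwards [hμ.ae_nonneg] with x hx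
      have hi1 := integrable_process h hδ0 hδ1.le hcK.continuousOn hx hn
      have hi2 := integrable_process h hδ0 hδ1.le hcf.continuousOn hx hn
      refine le_min ?_ ?_
      · rw [clamp_of_nonneg f hx]
        refine le_trans ?_ (hle n x hn hx)
        rw [← semigroup_clamp h hδ0 hδ1.le f hx hn]
        exact integral_mono hi1 hi2 fun e => min_le_left _ _
      · have := integral_mono hi1 (integrable_const (K : ℝ)) fun e => min_le_right _ _
        simpa [semigroup] using this
    have h2 : Tendsto (fun n : ℕ => ∫ x, min (M + Real.exp (-(c * n)) * clamp f x) (K : ℝ) ∂μ)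
        atTop (𝓝 (∫ _x, min M (K : ℝ) ∂μ)) := by
      refine tendsto_integral_of_dominated_convergence (fun _ => (K : ℝ))
        (fun n => (hgi n).aestronglyMeasurable) (integrable_const _) (fun n => ?_) ?_
      · refine ae_of_all _ fun x => ?_
        rw [Real.norm_eq_abs, abs_of_nonneg (le_min (add_nonneg hM0
          (mul_nonneg (Real.exp_pos _).le (hcf0 x))) (by positivity))]
        exact min_le_right _ _
      · refine ae_of_all _ fun x => ?_
        have he : Tendsto (fun n : ℕ => Real.exp (-(c * n))) atTop (𝓝 0) :=
          Real.tendsto_exp_neg_atTop_nhds_zero.comp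
            (tendsto_natCast_atTop_atTop.const_mul_atTop hc0)
        have h3 : Tendsto (fun n : ℕ => M + Real.exp (-(c * n)) * clamp f x) atTop (𝓝 M) := by
          simpa using (he.mul_const (clamp f x)).const_add M
        exact h3.min tendsto_const_nhds
    refine (ge_of_tendsto' h2 h1).trans ?_
    simp
  have hint : Integrable (clamp f) μ := by
    -- Fatou's lemma: the bound on the truncated means does not depend on the truncation.
    refine integrable_of_tendsto (G := fun n : ℕ => fun x => min (clamp f x) (n : ℝ))
      (ae_of_all _ fun x => ?_) (fun n => (hcf.min continuous_const).aestronglyMeasurable) ?_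
    · refine tendsto_const_nhds.congr' ?_
      filter_upwards [eventually_ge_atTop ⌈clamp f x⌉₊] with n hn
      exact (min_eq_left ((Nat.le_ceil _).trans (by exact_mod_cast hn))).symm
    · refine ne_top_of_le_ne_top (ENNReal.ofReal_ne_top (r := M)) ?_
      refine liminf_le_of_le (by isBoundedDefault) fun b hb => ?_
      obtain ⟨n, hn⟩ := hb.exists
      refine hn.trans ?_
      have hK0 : ∀ x, 0 ≤ min (clamp f x) (n : ℝ) := fun x => le_min (hcf0 x) (by positivity)
      have heq : ∫⁻ x, ‖min (clamp f x) (n : ℝ)‖ₑ ∂μ =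
          ENNReal.ofReal (∫ x, min (clamp f x) (n : ℝ) ∂μ) := by
        rw [ofReal_integral_eq_lintegral_ofReal
          (Integrable.of_bound (hcf.min continuous_const).aestronglyMeasurable n
            (ae_of_all _ fun x => by
              rw [Real.norm_eq_abs, abs_of_nonneg (hK0 x)]; exact min_le_right _ _))
          (ae_of_all _ hK0)]
        exact lintegral_congr fun x => Real.enorm_of_nonneg (hK0 x)
      rw [heq]
      exact ENNReal.ofReal_le_ofReal (hbound n)
  refine hint.congr ?_
  filter_upwards [hμ.ae_nonneg] with x hx using clamp_of_nonneg f hx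

lemma IsInvariantLaw.integrable_one_add_pow (h : GoodRate lam) (hδ0 : 0 ≤ δ) (hδ1 : δ < 1)
    (hlam : Cls 0 lam) (hμ : IsInvariantLaw lam δ μ) (a : ℝ) (ha : 0 ≤ a) (k : ℕ) :
    Integrable (fun x => (a + x) ^ k) μ := by
  have := hμ.1
  have h1 : Integrable (fun x : ℝ => 2 ^ (k - 1) * (a ^ k + x ^ k)) μ := by
    refine ((integrable_const _).add ?_).const_mul _
    cases k with
    | zero => simp
    | succ k => exact hμ.integrable_pow h hδ0 hδ1 hlam k
  refine h1.mono' (by fun_prop) ?_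
  filter_upwards [hμ.ae_nonneg] with x hx
  rw [Real.norm_eq_abs, abs_of_nonneg (by positivity)]
  exact add_pow_le ha hx k

/-- Continuous functions of polynomial growth are integrable. -/
lemma IsInvariantLaw.integrable (h : GoodRate lam) (hδ0 : 0 ≤ δ) (hδ1 : δ < 1)
    (hlam : Cls 0 lam) (hμ : IsInvariantLaw lam δ μ) (hf : Cls 0 f) : Integrable f μ := by
  obtain ⟨C, k, hC⟩ := hf.2
  refine ((hμ.integrable_one_add_pow h hδ0 hδ1 hlam 1 zero_le_one k).const_mul C).mono'
    (hμ.aestronglyMeasurable hf.1) ?_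
  filter_upwards [hμ.ae_nonneg] with x hx using hC x hx

/-- Infinitesimal stationarity. -/
theorem IsInvariantLaw.integral_gen (h : GoodRate lam) (hδ0 : 0 ≤ δ) (hδ1 : δ < 1)
    (hlam : Cls 0 lam) (hμ : IsInvariantLaw lam δ μ) (hf : Cls 1 f) :
    ∫ x, gen lam δ f x ∂μ = 0 := by
  have := hμ.1
  have hg : Cls 0 (gen lam δ f) := Cls.gen hδ0 hδ1.le hlam hf
  have hU := continuous_semigroupExt h hδ0 hδ1.le hg.1
  have hfin : IsFiniteMeasure (volume.restrict (uIoc (0 : ℝ) 1)) :=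
    ⟨by simp [uIoc_of_le]⟩
  have hi : Integrable (Function.uncurry fun s x => semigroupExt lam δ (gen lam δ f) s x)
      ((volume.restrict (uIoc 0 1)).prod μ) := by
    obtain ⟨C, k, hC0, hC⟩ := growth_semigroup h hδ0 hδ1.le hg.2
    refine (((hμ.integrable_one_add_pow h hδ0 hδ1 hlam 2 zero_le_two k).const_mul C).comp_snd
      (volume.restrict (uIoc 0 1))).mono' hU.aestronglyMeasurable ?_
    have h1 : ∀ᵐ p : ℝ × ℝ ∂((volume.restrict (uIoc 0 1)).prod μ), p.1 ∈ uIoc (0 : ℝ) 1 :=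
      Measure.quasiMeasurePreserving_fst.ae (ae_restrict_mem measurableSet_uIoc)
    have h2 : ∀ᵐ p : ℝ × ℝ ∂((volume.restrict (uIoc 0 1)).prod μ), 0 ≤ p.2 :=
      Measure.quasiMeasurePreserving_snd.ae hμ.ae_nonneg
    filter_upwards [h1, h2] with p hp1 hp2
    rw [uIoc_of_le zero_le_one] at hp1
    have := hC p.1 p.2 hp1.1.le hp2
    rw [Real.norm_eq_abs, Function.uncurry, semigroupExt_eq _ hp1.1.le hp2]
    refine this.trans (mul_le_mul_of_nonneg_left (pow_le_pow_left₀ ?_ ?_ k) hC0)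
    · linarith [hp1.1]
    · linarith [hp1.2]
  -- Dynkin's formula over the time interval `[0, 1]`, integrated against `μ`: by invariance the
  -- time average of `μ (P_s L f)` is `μ (L f)`, while the increment of `f` has mean zero.
  have hswap := intervalIntegral_integral_swap hi
  have hl : ∫ s in (0 : ℝ)..1, ∫ x, semigroupExt lam δ (gen lam δ f) s x ∂μ =
      ∫ x, gen lam δ f x ∂μ := by
    have : ∀ s ∈ uIcc (0 : ℝ) 1, ∫ x, semigroupExt lam δ (gen lam δ f) s x ∂μ =
        ∫ x, gen lam δ f x ∂μ := by
      intro s hs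
      rw [uIcc_of_le zero_le_one] at hs
      rw [← hμ.integral_semigroup h hs.1 (hμ.integrable h hδ0 hδ1 hlam hg)]
      refine integral_congr_ae ?_
      filter_upwards [hμ.ae_nonneg] with x hx using semigroupExt_eq _ hs.1 hx
    rw [intervalIntegral.integral_congr this]
    simp
  rw [← hl, hswap]
  have hr : ∀ᵐ x ∂μ, ∫ s in (0 : ℝ)..1, semigroupExt lam δ (gen lam δ f) s x =
      semigroup lam δ 1 f x - f x := by
    filter_upwards [hμ.ae_nonneg] with x hx
    rw [dynkin h hδ0 hδ1.le hlam hf hx zero_le_one]; ring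
  have hfi := hμ.integrable h hδ0 hδ1 hlam hf.zero
  rw [integral_congr_ae hr, integral_sub
    (hμ.integrable h hδ0 hδ1 hlam (cls_zero_semigroup h hδ0 hδ1.le hf.zero zero_le_one)) hfi,
    hμ.integral_semigroup h zero_le_one hfi, sub_self]

end Invariant

/-! ### Integration along one inter-jump stretch, and the Hardy inequalities. -/

/-- The function `x ↦ ∫₀^∞ exp (-Λ_x(s)) f (x + s) ds`. -/
def resolv (lam f : ℝ → ℝ) (x : ℝ) : ℝ :=
  ∫ s in Ioi (0 : ℝ), Real.exp (-cumRate lam x s) * f (x + s)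

section Resolvent

variable {lam : ℝ → ℝ} {f g : ℝ → ℝ}

lemma integrableOn_exp_mul_pow {b : ℝ} (hb : 0 < b) (k : ℕ) :
    IntegrableOn (fun s => Real.exp (-(b * s)) * (1 + s) ^ k) (Ioi 0) := by
  have h1 : ∀ n : ℕ, IntegrableOn (fun s => Real.exp (-(b * s)) * s ^ n) (Ioi 0) := fun n => by
    have := integrableOn_rpow_mul_exp_neg_mul_rpow (p := 1) (s := n) (b := b)
      (by linarith [Nat.cast_nonneg (α := ℝ) n]) zero_lt_one hb
    refine this.congr_fun (fun s _ => ?_) measurableSet_Ioi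
    simp [mul_comm]
  have h2 : IntegrableOn (fun s => 2 ^ (k - 1) * (Real.exp (-(b * s)) * s ^ 0 +
      Real.exp (-(b * s)) * s ^ k)) (Ioi 0) := ((h1 0).add (h1 k)).const_mul _
  refine h2.mono' (by fun_prop) ((ae_restrict_iff' measurableSet_Ioi).2 (ae_of_all _ fun s hs => ?_))
  have hs0 : 0 ≤ s := (mem_Ioi.1 hs).le
  rw [Real.norm_eq_abs, abs_of_nonneg (by positivity)]
  have := mul_le_mul_of_nonneg_left (add_pow_le zero_le_one hs0 k) (Real.exp_pos (-(b * s))).le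
  refine this.trans (le_of_eq ?_)
  simp; ring

lemma continuousOn_resolv_integrand (h : GoodRate lam) (hf : ContinuousOn f (Ici 0)) {x : ℝ}
    (hx : 0 ≤ x) : ContinuousOn (fun s => Real.exp (-cumRate lam x s) * f (x + s)) (Ici 0) := by
  refine ContinuousOn.mul (Real.continuous_exp.comp ((continuous_cumRate h).comp
    (f := fun r : ℝ => (x, r)) (by fun_prop)).neg).continuousOn ?_
  exact hf.comp (by fun_prop) fun s hs => mem_Ici.2 (add_nonneg hx hs)

lemma resolv_integrand_bound (h : GoodRate lam) {C : ℝ} {k : ℕ}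
    (hC : ∀ y, 0 ≤ y → |f y| ≤ C * (1 + y) ^ k) {x s : ℝ} (hx : 0 ≤ x) (hs : 0 ≤ s) :
    ‖Real.exp (-cumRate lam x s) * f (x + s)‖ ≤
      |C| * (1 + x) ^ k * (Real.exp (-(lam 0 * s)) * (1 + s) ^ k) := by
  rw [Real.norm_eq_abs, abs_mul, abs_of_pos (Real.exp_pos _)]
  have h1 : Real.exp (-cumRate lam x s) ≤ Real.exp (-(lam 0 * s)) :=
    Real.exp_le_exp.2 (neg_le_neg (le_cumRate h x hs))
  have h2 : |f (x + s)| ≤ |C| * ((1 + x) ^ k * (1 + s) ^ k) := by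
    refine (hC _ (by positivity)).trans ((pow_growth_mono (by positivity) le_rfl).trans ?_)
    rw [← mul_pow]
    refine mul_le_mul_of_nonneg_left (pow_le_pow_left₀ (by positivity) ?_ k) (abs_nonneg C)
    nlinarith [mul_nonneg hx hs]
  calc _ ≤ Real.exp (-(lam 0 * s)) * (|C| * ((1 + x) ^ k * (1 + s) ^ k)) :=
        mul_le_mul h1 h2 (abs_nonneg _) (Real.exp_pos _).le
    _ = _ := by ring

lemma integrableOn_resolv (h : GoodRate lam) (hf : Cls 0 f) {x : ℝ} (hx : 0 ≤ x) :
    IntegrableOn (fun s => Real.exp (-cumRate lam x s) * f (x + s)) (Ioi 0) := by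
  obtain ⟨C, k, hC⟩ := hf.2
  refine ((integrableOn_exp_mul_pow h.pos k).const_mul (|C| * (1 + x) ^ k)).mono'
    (((continuousOn_resolv_integrand h hf.1 hx).mono
      Ioi_subset_Ici_self).aestronglyMeasurable measurableSet_Ioi) ?_
  exact (ae_restrict_iff' measurableSet_Ioi).2
    (ae_of_all _ fun s hs => resolv_integrand_bound h hC hx (mem_Ioi.1 hs).le)

lemma growth_resolv (h : GoodRate lam) (hf : Cls 0 f) : Growth (resolv lam f) := by
  obtain ⟨C, k, hC⟩ := hf.2
  refine ⟨|C| * ∫ s in Ioi (0 : ℝ), Real.exp (-(lam 0 * s)) * (1 + s) ^ k, k, fun x hx => ?_⟩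
  have h1 := norm_integral_le_of_norm_le
    ((integrableOn_exp_mul_pow h.pos k).const_mul (|C| * (1 + x) ^ k))
    ((ae_restrict_iff' measurableSet_Ioi).2
      (ae_of_all _ fun s hs => resolv_integrand_bound h hC hx (mem_Ioi.1 hs).le))
  rw [integral_const_mul] at h1
  refine h1.trans (le_of_eq ?_)
  ring

lemma resolv_add (h : GoodRate lam) (hf : Cls 0 f) (hg : Cls 0 g) {x : ℝ} (hx : 0 ≤ x) :
    resolv lam (fun y => f y + g y) x = resolv lam f x + resolv lam g x := by
  rw [resolv, resolv, resolv, ← integral_add (integrableOn_resolv h hf hx)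
    (integrableOn_resolv h hg hx)]
  simp only [mul_add]

lemma resolv_const_mul (c : ℝ) (x : ℝ) :
    resolv lam (fun y => c * f y) x = c * resolv lam f x := by
  rw [resolv, resolv, ← integral_const_mul]
  congr 1; ext s; ring

lemma resolv_mono (h : GoodRate lam) (hf : Cls 0 f) (hg : Cls 0 g) {x : ℝ} (hx : 0 ≤ x)
    (hfg : ∀ y, x ≤ y → f y ≤ g y) : resolv lam f x ≤ resolv lam g x :=
  setIntegral_mono_on (integrableOn_resolv h hf hx) (integrableOn_resolv h hg hx)
    measurableSet_Ioi fun s hs => mul_le_mul_of_nonneg_left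
      (hfg _ (by linarith [mem_Ioi.1 hs])) (Real.exp_pos _).le

lemma resolv_congr {x : ℝ} (hfg : ∀ y, x ≤ y → f y = g y) : resolv lam f x = resolv lam g x :=
  setIntegral_congr_fun measurableSet_Ioi fun s hs => by
    simp only [hfg (x + s) (by linarith [mem_Ioi.1 hs])]

lemma resolv_nonneg {x : ℝ} (hf : ∀ y, x ≤ y → 0 ≤ f y) : 0 ≤ resolv lam f x :=
  setIntegral_nonneg measurableSet_Ioi fun s hs =>
    mul_nonneg (Real.exp_pos _).le (hf _ (by linarith [mem_Ioi.1 hs]))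

/-- The weight `λ(x + s) exp (-Λ_x(s))` is the probability density of the waiting time. -/
lemma resolv_rate (h : GoodRate lam) (x : ℝ) : resolv lam lam x = 1 := by
  have := integral_density h x 0
  rw [cumRate_zero, neg_zero, Real.exp_zero] at this
  rw [resolv, ← this]
  congr 1; ext s; ring

lemma meanWait_eq (lam : ℝ → ℝ) (x : ℝ) : meanWait lam x = resolv lam (fun _ => 1) x := by
  simp [meanWait, resolv]

lemma resolv_const (c x : ℝ) : resolv lam (fun _ => c) x = c * meanWait lam x := by
  rw [meanWait_eq, ← resolv_const_mul]; simp

/-- With `A` the primitive of the rate, the function is `exp (A(x)) ∫_x^∞ exp (-A) f`, so `x` enters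
only through a factor and an endpoint. No derivative of `f` is needed. -/
lemma hasDerivWithinAt_resolv (h : GoodRate lam) (hf : Cls 0 f) {x : ℝ} (hx : 0 ≤ x) :
    HasDerivWithinAt (resolv lam f) (lam x * resolv lam f x - f x) (Ici 0) x := by
  set e : ℝ → ℝ := fun y => Real.exp (-prim lam y) * clamp f y
  have hc : Continuous e := (Real.continuous_exp.comp h.continuous_prim.neg).mul
    (continuous_clamp hf.1)
  have hrep : ∀ y, 0 ≤ y → resolv lam f y = Real.exp (prim lam y) * ∫ z in Ioi y, e z := by
    intro y hy
    have h1 : (fun z : ℝ => y + z) '' Ioi 0 = Ioi y := by simp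
    have h2 := integral_image_eq_integral_abs_deriv_smul (s := Ioi (0 : ℝ)) (f := fun z => y + z)
      (f' := fun _ => 1) measurableSet_Ioi
      (fun z _ => ((hasDerivAt_id z).const_add y).hasDerivWithinAt)
      (add_right_injective y).injOn e
    rw [h1] at h2
    rw [h2, resolv, ← integral_const_mul]
    refine setIntegral_congr_fun measurableSet_Ioi fun s hs => ?_
    simp only [e, abs_one, one_smul, h.cumRate_eq,
      clamp_of_nonneg f (add_nonneg hy (mem_Ioi.1 hs).le)]
    rw [← mul_assoc, ← Real.exp_add]
    congr 2; ring
  have hint : IntegrableOn e (Ioi 0) := by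
    have := integrableOn_resolv h hf le_rfl
    refine this.congr_fun (fun s hs => ?_) measurableSet_Ioi
    have h0 : prim lam 0 = 0 := intervalIntegral.integral_same
    simp only [e, h.cumRate_eq, h0, zero_add, sub_zero, clamp_of_nonneg f (mem_Ioi.1 hs).le]
  have hrep2 : ∀ y, 0 ≤ y → resolv lam f y =
      Real.exp (prim lam y) * ((∫ z in Ioi 0, e z) - ∫ z in (0 : ℝ)..y, e z) := by
    intro y hy
    rw [hrep y hy, intervalIntegral.integral_of_le hy, ← Ioc_union_Ioi_eq_Ioi hy, setIntegral_union
      Ioc_disjoint_Ioi_same measurableSet_Ioi (hint.mono_set Ioc_subset_Ioi_self)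
      (hint.mono_set (Ioi_subset_Ioi hy))]
    ring
  have hd := (h.hasDerivAt_prim x).exp.mul
    ((hc.integral_hasStrictDerivAt 0 x).hasDerivAt.const_sub (∫ z in Ioi 0, e z))
  have hd' := hd.hasDerivWithinAt (s := Ici 0)
  refine (hd'.congr (fun y hy => hrep2 y hy) (hrep2 x hx)).congr_deriv ?_
  rw [hrep2 x hx]
  simp only [e, clamp_of_nonneg f hx]
  have : Real.exp (prim lam x) * Real.exp (-prim lam x) = 1 := by
    rw [← Real.exp_add]; simp
  linear_combination -f x * this

lemma D_resolv (h : GoodRate lam) (hf : Cls 0 f) {x : ℝ} (hx : 0 ≤ x) :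
    D (resolv lam f) x = lam x * resolv lam f x - f x :=
  D_eq hx (hasDerivWithinAt_resolv h hf hx)

lemma cls_resolv (h : GoodRate lam) (hlam : Cls 0 lam) (hf : Cls 0 f) :
    Cls 1 (resolv lam f) := by
  have hdiff : DifferentiableOn ℝ (resolv lam f) (Ici 0) := fun x hx =>
    (hasDerivWithinAt_resolv h hf hx).differentiableWithinAt
  have h0 : Cls 0 (resolv lam f) := ⟨hdiff.continuousOn, growth_resolv h hf⟩
  exact ⟨hdiff, h0.2, ((hlam.mul h0).sub hf).congr fun x hx => D_resolv h hf hx⟩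

/-- Integration by parts for the resolvent. -/
lemma resolv_rate_mul (h : GoodRate lam) (hlam : Cls 0 lam) (hf : Cls 1 f) {x : ℝ} (hx : 0 ≤ x) :
    resolv lam (fun y => lam y * f y) x = f x + resolv lam (D f) x := by
  set u : ℝ → ℝ := fun s => Real.exp (-cumRate lam x s) * f (x + s)
  set u' : ℝ → ℝ := fun s => Real.exp (-cumRate lam x s) * D f (x + s) -
    Real.exp (-cumRate lam x s) * (lam (x + s) * f (x + s))
  have hd : ∀ s ∈ Ioi (0 : ℝ), HasDerivAt u (u' s) s := by
    intro s hs
    have hp : 0 < x + s := by linarith [mem_Ioi.1 hs]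
    have h1 := ((hasDerivWithinAt_D hf.1 hp.le).hasDerivAt (Ici_mem_nhds hp)).comp_const_add x s
    have h2 := (hasDerivAt_cumRate h x s).neg.exp
    refine (h2.mul h1).congr_deriv ?_
    simp only [Pi.neg_apply, u']; ring
  have hi1 := integrableOn_resolv h hf.2.2 hx
  have hi2 := integrableOn_resolv h (hlam.mul hf.zero) hx
  have hi' : IntegrableOn u' (Ioi 0) := hi1.sub hi2
  have hlim := tendsto_zero_of_hasDerivAt_of_integrableOn_Ioi hd hi'
    (integrableOn_resolv h hf.zero hx)
  have hcu : ContinuousWithinAt u (Ici 0) 0 :=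
    continuousOn_resolv_integrand h hf.continuousOn hx 0 self_mem_Ici
  have hftc := integral_Ioi_of_hasDerivAt_of_tendsto hcu hd hi' hlim
  have hsub : ∫ s in Ioi 0, u' s = resolv lam (D f) x - resolv lam (fun y => lam y * f y) x :=
    integral_sub hi1 hi2
  rw [hsub] at hftc
  simp only [u, cumRate_zero, neg_zero, Real.exp_zero, add_zero, one_mul] at hftc
  linarith

lemma D_resolv_rate_mul (h : GoodRate lam) (hlam : Cls 0 lam) (hf : Cls 1 f) {x : ℝ}
    (hx : 0 ≤ x) :
    D (resolv lam fun y => lam y * f y) x = lam x * resolv lam (D f) x := by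
  rw [D_resolv h (hlam.mul hf.zero) hx, resolv_rate_mul h hlam hf hx]; ring

lemma cls_meanWait (h : GoodRate lam) (hlam : Cls 0 lam) : Cls 1 (meanWait lam) :=
  (cls_resolv h hlam (Cls.const 0 1)).congr fun x _ => meanWait_eq lam x

lemma D_meanWait (h : GoodRate lam) {x : ℝ} (hx : 0 ≤ x) :
    D (meanWait lam) x = lam x * meanWait lam x - 1 := by
  rw [show meanWait lam = resolv lam fun _ => 1 from funext (meanWait_eq lam),
    D_resolv h (Cls.const 0 1) hx]

/-- By monotonicity the rate at `x` is the smallest one met on the stretch, and the rates met there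
integrate to `1` by `resolv_rate`. The contraction of the chain and the monotonicity of `meanWait`
both rest on this. -/
lemma rate_mul_meanWait_le (h : GoodRate lam) (hlam : Cls 0 lam) {x : ℝ} (hx : 0 ≤ x) :
    lam x * meanWait lam x ≤ 1 := by
  rw [← resolv_const, ← resolv_rate h x]
  exact resolv_mono h (Cls.const 0 _) hlam hx fun y hy => h.mono hy

lemma meanWait_pos (h : GoodRate lam) {x : ℝ} (hx : 0 ≤ x) : 0 < meanWait lam x := by
  have hi := integrableOn_resolv h (Cls.const 0 1) hx
  rw [meanWait_eq, resolv, setIntegral_pos_iff_support_of_nonneg_ae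
    (ae_of_all _ fun s => by simp [Real.exp_nonneg]) hi]
  have : Function.support (fun s => Real.exp (-cumRate lam x s) * 1) = univ := by
    ext s; simp [Real.exp_ne_zero]
  rw [this, univ_inter, Real.volume_Ioi]
  exact ENNReal.zero_lt_top

lemma meanWait_le (h : GoodRate lam) (hlam : Cls 0 lam) {x : ℝ} (hx : 0 ≤ x) :
    meanWait lam x ≤ 1 / lam 0 := by
  rw [le_div_iff₀ h.pos, mul_comm]
  exact (mul_le_mul_of_nonneg_right (h.low x) (meanWait_pos h hx).le).trans
    (rate_mul_meanWait_le h hlam hx)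

lemma meanWait_antitoneOn (h : GoodRate lam) (hlam : Cls 0 lam) :
    AntitoneOn (meanWait lam) (Ici 0) := by
  have hc := cls_meanWait h hlam
  refine antitoneOn_of_hasDerivWithinAt_nonpos (convex_Ici 0) hc.continuousOn
    (fun x hx => (hasDerivWithinAt_D hc.1 (interior_subset hx)).mono interior_subset)
    fun x hx => ?_
  rw [D_meanWait h (interior_subset hx)]
  linarith [rate_mul_meanWait_le h hlam (interior_subset hx)]

/-- The Cauchy-Schwarz inequality for the resolvent. -/
lemma resolv_sq_le (h : GoodRate lam) (hf : Cls 0 f) {x : ℝ} (hx : 0 ≤ x) :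
    resolv lam f x ^ 2 ≤ meanWait lam x * resolv lam (fun y => f y ^ 2) x := by
  -- The minimiser of `resolv lam ((f - c)²) x` over constants; non-negativity at the minimum is
  -- Cauchy–Schwarz.
  set c := resolv lam f x / meanWait lam x with hc
  have hh := meanWait_pos h hx
  have h0 : 0 ≤ resolv lam (fun y => (f y ^ 2 + (-(2 * c)) * f y) + c ^ 2) x :=
    resolv_nonneg fun y _ => by nlinarith [sq_nonneg (f y - c)]
  rw [resolv_add h ((hf.pow 2).add ((Cls.const 0 _).mul hf)) (Cls.const 0 _) hx,
    resolv_add h (hf.pow 2) ((Cls.const 0 _).mul hf) hx, resolv_const_mul, resolv_const] at h0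
  have hcm : c * meanWait lam x = resolv lam f x := div_mul_cancel₀ _ hh.ne'
  have h1 : resolv lam f x ^ 2 = c * meanWait lam x * resolv lam f x := by rw [hcm]; ring
  have h2 := mul_nonneg hh.le h0
  have h3 : c ^ 2 * meanWait lam x = c * resolv lam f x := by rw [← hcm]; ring
  rw [h3] at h2
  rw [h1]
  nlinarith

/-- The local Poincaré (Hardy) inequality for the law of the next jump position. -/
lemma resolv_rate_mul_sq_sub_le (h : GoodRate lam) (hlam : Cls 0 lam) (hf : Cls 1 f) {x : ℝ}
    (hx : 0 ≤ x) :
    resolv lam (fun y => lam y * (f y - f x) ^ 2) x ≤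
      4 / lam 0 ^ 2 * resolv lam (fun y => lam y * D f y ^ 2) x := by
  have hf1 : Cls 1 fun y => f y - f x := hf.sub (Cls.const 1 _)
  have hDf : Cls 0 (D f) := hf.2.2
  have hD : ∀ y, x ≤ y → D (fun y => (f y - f x) ^ 2) y = 2 * (f y - f x) * D f y := by
    intro y hy
    refine D_eq (hx.trans hy) ?_
    refine (((hasDerivWithinAt_D hf.1 (hx.trans hy)).sub_const (f x)).pow 2).congr_deriv ?_
    simp
  have h1 := resolv_rate_mul h hlam (hf1.pow 2) hx
  rw [sub_self, zero_pow two_ne_zero, zero_add, resolv_congr hD] at h1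
  have hl := h.pos
  -- Young's inequality, weighted so that half of the left-hand side reappears and can be absorbed;
  -- this doubles `2 / lam 0 ^ 2`. The bound `lam 0 ≤ lam y` puts the weight `lam y` in both terms.
  have h2 : resolv lam (fun y => 2 * (f y - f x) * D f y) x ≤
      resolv lam (fun y => 1 / 2 * (lam y * (f y - f x) ^ 2) +
        2 / lam 0 ^ 2 * (lam y * D f y ^ 2)) x := by
    refine resolv_mono h ?_ ?_ hx fun y _ => ?_
    · exact ((Cls.const 0 2).mul hf1.zero).mul hDf
    · exact ((Cls.const 0 _).mul (hlam.mul (hf1.zero.pow 2))).add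
        ((Cls.const 0 _).mul (hlam.mul (hDf.pow 2)))
    · have h3 := h.low y
      set a := f y - f x
      set b := D f y
      obtain ⟨t, ht⟩ : ∃ t, lam 0 * t = 1 := ⟨1 / lam 0, mul_one_div_cancel hl.ne'⟩
      have ht0 : 0 < t := pos_of_mul_pos_right (ht ▸ one_pos) hl.le
      have ht2 : 2 / lam 0 ^ 2 = 2 * t ^ 2 := by
        rw [div_eq_iff (by positivity)]
        linear_combination (-2 * (lam 0 * t) - 2) * ht
      have e1 : 2 * a * b ≤ 1 / 2 * (lam 0 * a ^ 2) + 2 * t * b ^ 2 := by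
        have : 1 / 2 * (lam 0 * a ^ 2) + 2 * t * b ^ 2 - 2 * a * b =
            1 / 2 * (lam 0 * (a - 2 * t * b) ^ 2) := by
          linear_combination (2 * a * b - 2 * t * b ^ 2) * ht
        have := mul_nonneg hl.le (sq_nonneg (a - 2 * t * b))
        linarith
      have e2 : t ≤ t ^ 2 * lam y := by
        have : t ^ 2 * lam 0 = t := by linear_combination t * ht
        have := mul_le_mul_of_nonneg_left h3 (sq_nonneg t)
        linarith
      rw [ht2]
      nlinarith [mul_le_mul_of_nonneg_right e2 (sq_nonneg b),
        mul_le_mul_of_nonneg_right h3 (sq_nonneg a)]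
  rw [← h1, resolv_add h ((Cls.const 0 _).mul (hlam.mul (hf1.zero.pow 2)))
    ((Cls.const 0 _).mul (hlam.mul (hDf.pow 2))) hx, resolv_const_mul, resolv_const_mul] at h2
  have : 4 / lam 0 ^ 2 = 2 * (2 / lam 0 ^ 2) := by ring
  rw [this]
  linarith

/-- Integration by parts for the weight `exp (-Λ_x)`. It is `resolv_rate_mul` for `meanWait lam *
f`, whose derivative is `lam` times itself, minus `f`, plus `meanWait lam * D f`. The derivative of
`localMean` is computed from it as well. -/
lemma resolv_eq (h : GoodRate lam) (hlam : Cls 0 lam) (hf : Cls 1 f) {x : ℝ} (hx : 0 ≤ x) :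
    resolv lam f x = meanWait lam x * f x + resolv lam (fun y => meanWait lam y * D f y) x := by
  have hm := cls_meanWait h hlam
  have h1 := resolv_rate_mul h hlam (hm.mul hf) hx
  have hDf : Cls 0 (D f) := hf.2.2
  have hD : ∀ y, x ≤ y → D (fun y => meanWait lam y * f y) y =
      (lam y * (meanWait lam y * f y) + (-1) * f y) + meanWait lam y * D f y := by
    intro y hy
    refine D_eq (hx.trans hy) (((hasDerivWithinAt_D hm.1 (hx.trans hy)).mul
      (hasDerivWithinAt_D hf.1 (hx.trans hy))).congr_deriv ?_)
    rw [D_meanWait h (hx.trans hy)]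
    ring
  rw [resolv_congr hD, resolv_add h ((hlam.mul (hm.zero.mul hf.zero)).add
    ((Cls.const 0 _).mul hf.zero)) (hm.zero.mul hDf) hx, resolv_add h
    (hlam.mul (hm.zero.mul hf.zero)) ((Cls.const 0 _).mul hf.zero) hx, resolv_const_mul] at h1
  linarith

/-- The local Poincaré (Hardy) inequality for the law of the position between two jumps. -/
lemma resolv_sq_sub_le (h : GoodRate lam) (hlam : Cls 0 lam) (hf : Cls 1 f) {x : ℝ}
    (hx : 0 ≤ x) :
    resolv lam (fun y => (f y - f x) ^ 2) x ≤
      4 / lam 0 ^ 2 * resolv lam (fun y => D f y ^ 2) x := by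
  have hf1 : Cls 1 fun y => f y - f x := hf.sub (Cls.const 1 _)
  have hDf : Cls 0 (D f) := hf.2.2
  have hm := (cls_meanWait h hlam).zero
  have hD : ∀ y, x ≤ y → meanWait lam y * D (fun y => (f y - f x) ^ 2) y =
      meanWait lam y * (2 * (f y - f x) * D f y) := by
    intro y hy
    congr 1
    refine D_eq (hx.trans hy) ?_
    refine (((hasDerivWithinAt_D hf.1 (hx.trans hy)).sub_const (f x)).pow 2).congr_deriv ?_
    simp
  have h1 := resolv_eq h hlam (hf1.pow 2) hx
  rw [sub_self, zero_pow two_ne_zero, mul_zero, zero_add, resolv_congr hD] at h1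
  have h2 : resolv lam (fun y => meanWait lam y * (2 * (f y - f x) * D f y)) x ≤
      resolv lam (fun y => 1 / 2 * (f y - f x) ^ 2 + 2 / lam 0 ^ 2 * D f y ^ 2) x := by
    refine resolv_mono h ?_ ?_ hx fun y hy => ?_
    · exact hm.mul (((Cls.const 0 2).mul hf1.zero).mul hDf)
    · exact ((Cls.const 0 _).mul (hf1.zero.pow 2)).add ((Cls.const 0 _).mul (hDf.pow 2))
    · have h3 := meanWait_le h hlam (hx.trans hy)
      have h4 := (meanWait_pos h (hx.trans hy)).le
      have h5 : meanWait lam y ^ 2 ≤ 1 / lam 0 ^ 2 := by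
        rw [← one_div_pow]; exact pow_le_pow_left₀ h4 h3 2
      have h6 : 2 / lam 0 ^ 2 = 2 * (1 / lam 0 ^ 2) := by ring
      rw [h6]
      nlinarith [sq_nonneg ((f y - f x) - 2 * meanWait lam y * D f y),
        mul_le_mul_of_nonneg_right h5 (sq_nonneg (D f y))]
  rw [← h1, resolv_add h ((Cls.const 0 _).mul (hf1.zero.pow 2))
    ((Cls.const 0 _).mul (hDf.pow 2)) hx, resolv_const_mul, resolv_const_mul] at h2
  have : 4 / lam 0 ^ 2 = 2 * (2 / lam 0 ^ 2) := by ring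
  rw [this]
  linarith

end Resolvent

/-! ### The chain of positions after the jumps and its Poincaré inequality. -/

/-- A non-decreasing jump rate of polynomial growth, together with an invariant law. -/
structure Stationary (lam : ℝ → ℝ) (δ : ℝ) (μ : Measure ℝ) : Prop where
  rate : GoodRate lam
  nonneg : 0 ≤ δ
  lt_one : δ < 1
  cls : Cls 0 lam
  inv : IsInvariantLaw lam δ μ

/-- The mean of a function under the law of the position after a jump, in the stationary regime. -/
def jumpMean (lam : ℝ → ℝ) (δ : ℝ) (μ : Measure ℝ) (φ : ℝ → ℝ) : ℝ :=
  (∫ x, lam x * φ (δ * x) ∂μ) / ∫ x, lam x ∂μ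

/-- The transition operator of the chain of positions after the jumps. -/
def jumpOp (lam : ℝ → ℝ) (δ : ℝ) (φ : ℝ → ℝ) : ℝ → ℝ := resolv lam fun y => lam y * φ (δ * y)

section Chain

variable {lam : ℝ → ℝ} {δ : ℝ} {μ : Measure ℝ} {f g φ : ℝ → ℝ}

namespace Stationary

lemma integrable (H : Stationary lam δ μ) (hf : Cls 0 f) : Integrable f μ :=
  H.inv.integrable H.rate H.nonneg H.lt_one H.cls hf

lemma cls_comp (H : Stationary lam δ μ) {n : ℕ} (hf : Cls n f) : Cls n fun x => f (δ * x) :=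
  hf.comp_mul H.nonneg H.lt_one.le

lemma integral_rate_pos (H : Stationary lam δ μ) : 0 < ∫ x, lam x ∂μ := by
  have := H.inv.1
  have h1 := integral_mono (μ := μ) (integrable_const (lam 0)) (H.integrable H.cls) H.rate.low
  refine H.rate.pos.trans_le ?_
  simpa using h1

lemma jumpMean_add (H : Stationary lam δ μ) (hf : Cls 0 f) (hg : Cls 0 g) :
    jumpMean lam δ μ (fun x => f x + g x) = jumpMean lam δ μ f + jumpMean lam δ μ g := by
  rw [jumpMean, jumpMean, jumpMean, ← add_div, ← integral_add
    (H.integrable (H.cls.mul (H.cls_comp hf))) (H.integrable (H.cls.mul (H.cls_comp hg)))]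
  simp only [mul_add]

lemma jumpMean_const_mul (c : ℝ) :
    jumpMean lam δ μ (fun x => c * f x) = c * jumpMean lam δ μ f := by
  rw [jumpMean, jumpMean, ← mul_div_assoc, ← integral_const_mul]
  congr 2; ext x; ring

lemma jumpMean_const (H : Stationary lam δ μ) (c : ℝ) : jumpMean lam δ μ (fun _ => c) = c := by
  rw [jumpMean, integral_mul_const]
  field_simp [H.integral_rate_pos.ne']

lemma jumpMean_mono (H : Stationary lam δ μ) (hf : Cls 0 f) (hg : Cls 0 g)
    (hfg : ∀ x, 0 ≤ x → f x ≤ g x) : jumpMean lam δ μ f ≤ jumpMean lam δ μ g := by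
  refine div_le_div_of_nonneg_right ?_ H.integral_rate_pos.le
  refine integral_mono_ae (H.integrable (H.cls.mul (H.cls_comp hf)))
    (H.integrable (H.cls.mul (H.cls_comp hg))) ?_
  filter_upwards [H.inv.ae_nonneg] with x hx
  exact mul_le_mul_of_nonneg_left (hfg _ (mul_nonneg H.nonneg hx)) (H.rate.pos' x).le

lemma jumpMean_congr (H : Stationary lam δ μ) (hfg : ∀ x, 0 ≤ x → f x = g x) :
    jumpMean lam δ μ f = jumpMean lam δ μ g := by
  rw [jumpMean, jumpMean]
  congr 1
  refine integral_congr_ae ?_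
  filter_upwards [H.inv.ae_nonneg] with x hx
  rw [hfg _ (mul_nonneg H.nonneg hx)]

/-- The invariant law is recovered from the law of the positions after the jumps. -/
lemma integral_eq_resolv (H : Stationary lam δ μ) (hf : Cls 0 f) :
    ∫ x, f x ∂μ = ∫ x, lam x * resolv lam f (δ * x) ∂μ := by
  have hR := cls_resolv H.rate H.cls hf
  -- The local terms of the generator of `resolv lam f` reduce to `-f`, leaving only the value after
  -- the jump.
  have h1 := H.inv.integral_gen H.rate H.nonneg H.lt_one H.cls hR
  have h2 : ∀ᵐ x ∂μ, gen lam δ (resolv lam f) x = lam x * resolv lam f (δ * x) - f x := by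
    filter_upwards [H.inv.ae_nonneg] with x hx
    rw [gen, D_resolv H.rate hf hx]; ring
  rw [integral_congr_ae h2, integral_sub (H.integrable (H.cls.mul (H.cls_comp hR.zero)))
    (H.integrable hf)] at h1
  linarith

lemma integral_eq_jumpMean (H : Stationary lam δ μ) (hf : Cls 0 f) :
    ∫ x, f x ∂μ = (∫ x, lam x ∂μ) * jumpMean lam δ μ (resolv lam f) := by
  rw [jumpMean, mul_div_cancel₀ _ H.integral_rate_pos.ne', H.integral_eq_resolv hf]

lemma cls_jumpOp (H : Stationary lam δ μ) (hφ : Cls 0 φ) : Cls 1 (jumpOp lam δ φ) :=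
  cls_resolv H.rate H.cls (H.cls.mul (H.cls_comp hφ))

/-- Invariance of the post-jump law under the chain: it is `integral_eq_resolv` for the function
`lam x * φ (δ * x)`. -/
lemma jumpMean_jumpOp (H : Stationary lam δ μ) (hφ : Cls 0 φ) :
    jumpMean lam δ μ (jumpOp lam δ φ) = jumpMean lam δ μ φ := by
  rw [jumpMean, jumpMean, jumpOp, ← H.integral_eq_resolv (H.cls.mul (H.cls_comp hφ))]

lemma D_comp (H : Stationary lam δ μ) (hφ : Cls 1 φ) {x : ℝ} (hx : 0 ≤ x) :
    D (fun x => φ (δ * x)) x = δ * D φ (δ * x) :=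
  D_eq hx (hasDerivWithinAt_comp_mul H.nonneg hφ.1 hx)

lemma D_jumpOp (H : Stationary lam δ μ) (hφ : Cls 1 φ) {x : ℝ} (hx : 0 ≤ x) :
    D (jumpOp lam δ φ) x = lam x * resolv lam (fun y => δ * D φ (δ * y)) x := by
  rw [jumpOp, D_resolv_rate_mul H.rate H.cls (H.cls_comp hφ) hx]
  rw [resolv_congr fun y hy => H.D_comp hφ (hx.trans hy)]

/-- The gradient commutes with the chain up to a factor `δ` and the replacement of the rate inside
the integral by its value at `x`. Cauchy–Schwarz, `lam x * meanWait lam x ≤ 1` and the monotonicity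
of the rate then restore the chain itself. -/
lemma D_jumpOp_sq_le (H : Stationary lam δ μ) (hφ : Cls 1 φ) {x : ℝ} (hx : 0 ≤ x) :
    D (jumpOp lam δ φ) x ^ 2 ≤ δ ^ 2 * jumpOp lam δ (fun y => D φ y ^ 2) x := by
  have hD : Cls 0 (D φ) := hφ.2.2
  have hDc := H.cls_comp hD
  have h1 := resolv_sq_le H.rate hDc hx
  have h2 : lam x * resolv lam (fun y => D φ (δ * y) ^ 2) x ≤
      jumpOp lam δ (fun y => D φ y ^ 2) x := by
    rw [← resolv_const_mul, jumpOp]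
    refine resolv_mono H.rate ((Cls.const 0 _).mul (hDc.pow 2)) (H.cls.mul (hDc.pow 2)) hx
      fun y hy => mul_le_mul_of_nonneg_right (H.rate.mono hy) (sq_nonneg _)
  have h3 := rate_mul_meanWait_le H.rate H.cls hx
  have h4 : 0 ≤ resolv lam (fun y => D φ (δ * y) ^ 2) x := resolv_nonneg fun y _ => sq_nonneg _
  have hl := (H.rate.pos' x).le
  rw [H.D_jumpOp hφ hx, resolv_const_mul]
  calc (lam x * (δ * resolv lam (fun y => D φ (δ * y)) x)) ^ 2
      = δ ^ 2 * (lam x ^ 2 * resolv lam (fun y => D φ (δ * y)) x ^ 2) := by ring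
    _ ≤ δ ^ 2 * (lam x ^ 2 * (meanWait lam x * resolv lam (fun y => D φ (δ * y) ^ 2) x)) := by
        gcongr
    _ = δ ^ 2 * ((lam x * meanWait lam x) *
          (lam x * resolv lam (fun y => D φ (δ * y) ^ 2) x)) := by ring
    _ ≤ δ ^ 2 * (1 * (lam x * resolv lam (fun y => D φ (δ * y) ^ 2) x)) := by
        gcongr
    _ ≤ _ := by rw [one_mul]; gcongr

/-- Lipschitz constants contract by `δ` at each step, which makes the remainder vanish when the
variance decomposition is iterated. -/
lemma abs_D_jumpOp_le (H : Stationary lam δ μ) (hφ : Cls 1 φ) {l : ℝ} (hl : 0 ≤ l)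
    (hb : ∀ y, 0 ≤ y → |D φ y| ≤ l) {x : ℝ} (hx : 0 ≤ x) :
    |D (jumpOp lam δ φ) x| ≤ δ * l := by
  have hD : Cls 0 (D φ) := hφ.2.2
  have hDc := H.cls_comp hD
  have hlx := (H.rate.pos' x).le
  have h1 : |resolv lam (fun y => D φ (δ * y)) x| ≤ l * meanWait lam x := by
    rw [abs_le, ← resolv_const, ← neg_one_mul, ← resolv_const_mul]
    constructor
    · refine resolv_mono H.rate ((Cls.const 0 _).mul (Cls.const 0 _)) hDc hx fun y hy => ?_
      have := neg_le_of_abs_le (hb (δ * y) (mul_nonneg H.nonneg (hx.trans hy)))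
      linarith
    · exact resolv_mono H.rate hDc (Cls.const 0 _) hx fun y hy =>
        le_of_abs_le (hb (δ * y) (mul_nonneg H.nonneg (hx.trans hy)))
  rw [H.D_jumpOp hφ hx, resolv_const_mul, abs_mul, abs_mul, abs_of_nonneg hlx,
    abs_of_nonneg H.nonneg]
  calc lam x * (δ * |resolv lam (fun y => D φ (δ * y)) x|)
      ≤ lam x * (δ * (l * meanWait lam x)) := by have := H.nonneg; gcongr
    _ = δ * l * (lam x * meanWait lam x) := by ring
    _ ≤ δ * l * 1 := mul_le_mul_of_nonneg_left (rate_mul_meanWait_le H.rate H.cls hx)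
        (mul_nonneg H.nonneg hl)
    _ = δ * l := mul_one _

/-- The variance of one transition is at most the second moment around `φ (δ * x)`, to which the
Hardy inequality applies; `δ ^ 2` comes from differentiating `φ (δ * y)`. -/
lemma jumpOp_sq_sub_le (H : Stationary lam δ μ) (hφ : Cls 1 φ) {x : ℝ} (hx : 0 ≤ x) :
    jumpOp lam δ (fun y => φ y ^ 2) x - jumpOp lam δ φ x ^ 2 ≤
      4 * δ ^ 2 / lam 0 ^ 2 * jumpOp lam δ (fun y => D φ y ^ 2) x := by
  have hG := H.cls_comp hφ
  have hD : Cls 0 (D φ) := hφ.2.2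
  have h1 := resolv_rate_mul_sq_sub_le H.rate H.cls hG hx
  have h2 : resolv lam (fun y => lam y * D (fun x => φ (δ * x)) y ^ 2) x =
      δ ^ 2 * jumpOp lam δ (fun y => D φ y ^ 2) x := by
    rw [jumpOp, ← resolv_const_mul]
    refine resolv_congr fun y hy => ?_
    rw [H.D_comp hφ (hx.trans hy)]; ring
  set c := φ (δ * x)
  have h3 : resolv lam (fun y => lam y * (φ (δ * y) - c) ^ 2) x =
      jumpOp lam δ (fun y => φ y ^ 2) x + (-(2 * c) * jumpOp lam δ φ x + c ^ 2 * 1) := by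
    rw [← resolv_rate H.rate x, jumpOp, jumpOp, ← resolv_const_mul, ← resolv_const_mul,
      ← resolv_add H.rate ((Cls.const 0 _).mul (H.cls.mul hG.zero)) ((Cls.const 0 _).mul H.cls) hx,
      ← resolv_add H.rate (H.cls.mul (hG.zero.pow 2)) (((Cls.const 0 _).mul
        (H.cls.mul hG.zero)).add ((Cls.const 0 _).mul H.cls)) hx]
    exact resolv_congr fun y _ => by ring
  rw [h2, h3] at h1
  have h4 : 4 * δ ^ 2 / lam 0 ^ 2 * jumpOp lam δ (fun y => D φ y ^ 2) x =
      4 / lam 0 ^ 2 * (δ ^ 2 * jumpOp lam δ (fun y => D φ y ^ 2) x) := by ring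
  rw [h4]
  nlinarith [sq_nonneg (jumpOp lam δ φ x - c)]

lemma jumpMean_sq_sub (H : Stationary lam δ μ) (hφ : Cls 0 φ) (c : ℝ) :
    jumpMean lam δ μ (fun x => (φ x - c) ^ 2) =
      jumpMean lam δ μ (fun x => φ x ^ 2) - jumpMean lam δ μ φ ^ 2 +
        (jumpMean lam δ μ φ - c) ^ 2 := by
  have h1 : jumpMean lam δ μ (fun x => (φ x - c) ^ 2) =
      jumpMean lam δ μ (fun x => φ x ^ 2 + (-(2 * c) * φ x + c ^ 2)) := by
    congr 1; ext x; ring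
  rw [h1, H.jumpMean_add (hφ.pow 2) (((Cls.const 0 _).mul hφ).add (Cls.const 0 _)),
    H.jumpMean_add ((Cls.const 0 _).mul hφ) (Cls.const 0 _), jumpMean_const_mul, H.jumpMean_const]
  ring

lemma abs_sub_le_of_D_le (hφ : Cls 1 φ) {l : ℝ} (hb : ∀ y, 0 ≤ y → |D φ y| ≤ l) {x : ℝ}
    (hx : 0 ≤ x) : |φ x - φ 0| ≤ l * x := by
  have := (convex_Ici (0 : ℝ)).norm_image_sub_le_of_norm_hasDerivWithin_le
    (fun y hy => hasDerivWithinAt_D hφ.1 hy) (fun y hy => hb y hy) self_mem_Ici hx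
  rwa [Real.norm_eq_abs, sub_zero, Real.norm_eq_abs, abs_of_nonneg hx] at this

/-- The variance after `n` steps of the chain of positions after the jumps. -/
lemma jumpMean_variance_le_sum (H : Stationary lam δ μ) (n : ℕ) : ∀ {φ : ℝ → ℝ} {l : ℝ},
    Cls 1 φ → 0 ≤ l → (∀ y, 0 ≤ y → |D φ y| ≤ l) →
    jumpMean lam δ μ (fun x => φ x ^ 2) - jumpMean lam δ μ φ ^ 2 ≤
      4 * δ ^ 2 / lam 0 ^ 2 * (∑ i ∈ Finset.range n, (δ ^ 2) ^ i) *
        jumpMean lam δ μ (fun x => D φ x ^ 2) +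
      (δ ^ 2) ^ n * (l ^ 2 * jumpMean lam δ μ (fun x => x ^ 2)) := by
  induction n with
  -- No step taken: the variance is at most the second moment around `φ 0`, and `φ` is
  -- `l`-Lipschitz.
  | zero =>
    intro φ l hφ hl hb
    have h1 := H.jumpMean_sq_sub hφ.zero (φ 0)
    have h2 : jumpMean lam δ μ (fun x => (φ x - φ 0) ^ 2) ≤
        jumpMean lam δ μ (fun x => l ^ 2 * x ^ 2) :=
      H.jumpMean_mono ((hφ.zero.sub (Cls.const 0 _)).pow 2) ((Cls.const 0 _).mul ((Cls.id 0).pow 2))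
        fun x hx => by
          rw [← mul_pow, ← sq_abs]
          exact pow_le_pow_left₀ (abs_nonneg _) (abs_sub_le_of_D_le hφ hb hx) 2
    rw [jumpMean_const_mul] at h2
    simp only [Finset.range_zero, Finset.sum_empty, mul_zero, zero_mul, pow_zero, one_mul, zero_add]
    linarith [sq_nonneg (jumpMean lam δ μ φ - φ 0)]
  | succ n ih =>
    intro φ l hφ hl hb
    have hq := H.cls_jumpOp hφ.zero
    have hD : Cls 0 (D φ) := hφ.2.2
    have hDq : Cls 0 (D (jumpOp lam δ φ)) := hq.2.2
    -- Total variance: by invariance the variance of `φ` is the mean variance of one transition plus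
    -- the variance of `jumpOp lam δ φ`. The induction hypothesis bounds the latter with the
    -- gradient reduced by `δ ^ 2`.
    have h1 := ih hq (mul_nonneg H.nonneg hl) fun y hy => H.abs_D_jumpOp_le hφ hl hb hy
    have h2 := H.jumpMean_mono (((H.cls_jumpOp (hφ.zero.pow 2)).zero.add
      ((Cls.const 0 (-1)).mul (hq.zero.pow 2)))) ((Cls.const 0 (4 * δ ^ 2 / lam 0 ^ 2)).mul
      (H.cls_jumpOp (hD.pow 2)).zero)
      fun x hx => by linarith [H.jumpOp_sq_sub_le hφ hx]
    rw [H.jumpMean_add (H.cls_jumpOp (hφ.zero.pow 2)).zero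
      ((Cls.const 0 (-1)).mul (hq.zero.pow 2)), jumpMean_const_mul, jumpMean_const_mul,
      H.jumpMean_jumpOp (hφ.zero.pow 2), H.jumpMean_jumpOp (hD.pow 2)] at h2
    have h3 := H.jumpMean_mono (hDq.pow 2) ((Cls.const 0 (δ ^ 2)).mul
      (H.cls_jumpOp (hD.pow 2)).zero) fun x hx => H.D_jumpOp_sq_le hφ hx
    rw [jumpMean_const_mul, H.jumpMean_jumpOp (hD.pow 2)] at h3
    rw [H.jumpMean_jumpOp hφ.zero] at h1
    have ha : 0 ≤ 4 * δ ^ 2 / lam 0 ^ 2 * (∑ i ∈ Finset.range n, (δ ^ 2) ^ i) := by positivity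
    have h4 := mul_le_mul_of_nonneg_left h3 ha
    rw [Finset.sum_range_succ', ← Finset.sum_congr rfl fun i _ => (pow_succ (δ ^ 2) i).symm,
      ← Finset.sum_mul, pow_zero]
    have h5 : (δ ^ 2) ^ (n + 1) * (l ^ 2 * jumpMean lam δ μ (fun x => x ^ 2)) =
        (δ ^ 2) ^ n * ((δ * l) ^ 2 * jumpMean lam δ μ (fun x => x ^ 2)) := by ring
    rw [h5]
    linarith

/-- The Poincaré inequality for the law of the positions after the jumps, Lipschitz case. -/
lemma jumpMean_variance_le_of_bounded (H : Stationary lam δ μ) (hφ : Cls 1 φ) {l : ℝ} (hl : 0 ≤ l)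
    (hb : ∀ y, 0 ≤ y → |D φ y| ≤ l) :
    jumpMean lam δ μ (fun x => φ x ^ 2) - jumpMean lam δ μ φ ^ 2 ≤
      4 * δ ^ 2 / (lam 0 ^ 2 * (1 - δ ^ 2)) * jumpMean lam δ μ (fun x => D φ x ^ 2) := by
  have hδ2 : δ ^ 2 < 1 := by have := H.nonneg; have := H.lt_one; nlinarith
  have hD : Cls 0 (D φ) := hφ.2.2
  have hE : 0 ≤ jumpMean lam δ μ (fun x => D φ x ^ 2) := by
    rw [← H.jumpMean_const 0]
    exact H.jumpMean_mono (Cls.const 0 0) (hD.pow 2) fun x _ => sq_nonneg _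
  have hlim : Tendsto (fun n : ℕ => 4 * δ ^ 2 / (lam 0 ^ 2 * (1 - δ ^ 2)) *
      jumpMean lam δ μ (fun x => D φ x ^ 2) +
      (δ ^ 2) ^ n * (l ^ 2 * jumpMean lam δ μ (fun x => x ^ 2))) atTop
      (𝓝 (4 * δ ^ 2 / (lam 0 ^ 2 * (1 - δ ^ 2)) *
      jumpMean lam δ μ (fun x => D φ x ^ 2))) := by
    simpa using ((tendsto_pow_atTop_nhds_zero_of_lt_one (sq_nonneg δ) hδ2).mul_const
      (l ^ 2 * jumpMean lam δ μ (fun x => x ^ 2))).const_add (4 * δ ^ 2 / (lam 0 ^ 2 * (1 - δ ^ 2)) *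
      jumpMean lam δ μ (fun x => D φ x ^ 2))
  refine ge_of_tendsto' hlim fun n => (H.jumpMean_variance_le_sum n hφ hl hb).trans ?_
  gcongr
  rw [← div_div, div_eq_mul_inv _ (1 - δ ^ 2)]
  have hs : ∑ i ∈ Finset.range n, (δ ^ 2) ^ i ≤ (1 - δ ^ 2)⁻¹ := by
    rw [geom_sum_eq hδ2.ne, ← neg_div_neg_eq, neg_sub, neg_sub, div_eq_mul_inv]
    have : 0 ≤ (1 - δ ^ 2)⁻¹ := inv_nonneg.2 (by linarith)
    have h0 : 0 ≤ (δ ^ 2) ^ n := by positivity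
    nlinarith
  gcongr

end Stationary

end Chain

/-! ### From the post-jump law to the invariant law. -/

section PoincareInequality

variable {lam : ℝ → ℝ} {δ : ℝ} {μ : Measure ℝ} {f φ ψ : ℝ → ℝ}

lemma hasDerivWithinAt_integral_clamp (hψ : ContinuousOn ψ (Ici 0)) {x : ℝ} (hx : 0 ≤ x) :
    HasDerivWithinAt (fun x => ∫ y in (0 : ℝ)..x, clamp ψ y) (ψ x) (Ici 0) x := by
  have := ((continuous_clamp hψ).integral_hasStrictDerivAt 0 x).hasDerivAt.hasDerivWithinAt
    (s := Ici 0)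
  rwa [clamp_of_nonneg ψ hx] at this

lemma cls_integral_clamp (hψ : Cls 0 ψ) : Cls 1 fun x => ∫ y in (0 : ℝ)..x, clamp ψ y := by
  refine ⟨fun x hx => (hasDerivWithinAt_integral_clamp hψ.1 hx).differentiableWithinAt, ?_,
    hψ.congr fun x hx => D_eq hx (hasDerivWithinAt_integral_clamp hψ.1 hx)⟩
  obtain ⟨C, k, hC⟩ := hψ.2
  refine ⟨|C|, k + 1, fun x hx => ?_⟩
  have h1 := intervalIntegral.norm_integral_le_of_norm_le_const (a := 0) (b := x) (f := clamp ψ)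
    (C := |C| * (1 + x) ^ k) fun y hy => by
      rw [uIoc_of_le hx] at hy
      rw [clamp_of_nonneg ψ hy.1.le]
      refine (hC y hy.1.le).trans ((pow_growth_mono hy.1.le le_rfl).trans ?_)
      have := hy.1
      have := hy.2
      gcongr
  rw [sub_zero, abs_of_nonneg hx, Real.norm_eq_abs] at h1
  refine h1.trans ?_
  rw [pow_succ, mul_assoc]
  have : 0 ≤ (1 + x) ^ k := by positivity
  gcongr
  linarith

lemma D_integral_clamp (hψ : Cls 0 ψ) {x : ℝ} (hx : 0 ≤ x) :
    D (fun x => ∫ y in (0 : ℝ)..x, clamp ψ y) x = ψ x :=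
  D_eq hx (hasDerivWithinAt_integral_clamp hψ.1 hx)

lemma cls_min_const (hψ : Cls 0 ψ) (N : ℝ) : Cls 0 fun x => min (ψ x) N := by
  refine ⟨hψ.1.inf continuousOn_const, ?_⟩
  refine (((hψ.mul hψ).growth.add (Growth.const (N ^ 2))).add (Growth.const 1)).mono fun x _ => ?_
  rw [abs_le, abs_of_nonneg (by linarith [mul_self_nonneg (ψ x), sq_nonneg N])]
  constructor
  · exact le_min (by nlinarith [sq_nonneg (ψ x + 1), sq_nonneg N])
      (by nlinarith [sq_nonneg (N + 1), mul_self_nonneg (ψ x)])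
  · exact (min_le_left _ _).trans (by nlinarith [sq_nonneg (ψ x - 1), sq_nonneg N])

namespace Stationary

lemma tendsto_jumpMean (H : Stationary lam δ μ) {F : ℕ → ℝ → ℝ} {G : ℝ → ℝ}
    (hF : ∀ n, Cls 0 (F n)) (hG : Cls 0 G) (hle : ∀ n x, 0 ≤ x → |F n x| ≤ G x)
    (hlim : ∀ x, 0 ≤ x → Tendsto (fun n => F n x) atTop (𝓝 (f x))) :
    Tendsto (fun n => jumpMean lam δ μ (F n)) atTop (𝓝 (jumpMean lam δ μ f)) := by
  refine Tendsto.div_const ?_ _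
  refine tendsto_integral_of_dominated_convergence (fun x => lam x * G (δ * x))
    (fun n => (H.integrable (H.cls.mul (H.cls_comp (hF n)))).aestronglyMeasurable)
    (H.integrable (H.cls.mul (H.cls_comp hG))) (fun n => ?_) ?_
  · filter_upwards [H.inv.ae_nonneg] with x hx
    rw [Real.norm_eq_abs, abs_mul, abs_of_pos (H.rate.pos' x)]
    exact mul_le_mul_of_nonneg_left (hle n _ (mul_nonneg H.nonneg hx)) (H.rate.pos' x).le
  · filter_upwards [H.inv.ae_nonneg] with x hx
    exact (hlim _ (mul_nonneg H.nonneg hx)).const_mul _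

/-- The Poincaré inequality for the law of the positions after the jumps, monotone case. -/
lemma jumpMean_variance_le (H : Stationary lam δ μ) (hψ : Cls 0 ψ) (hψ0 : ∀ x, 0 ≤ x → 0 ≤ ψ x) :
    jumpMean lam δ μ (fun x => (∫ y in (0 : ℝ)..x, clamp ψ y) ^ 2) -
      jumpMean lam δ μ (fun x => ∫ y in (0 : ℝ)..x, clamp ψ y) ^ 2 ≤
      4 * δ ^ 2 / (lam 0 ^ 2 * (1 - δ ^ 2)) * jumpMean lam δ μ (fun x => ψ x ^ 2) := by
  set Φ : ℝ → ℝ := fun x => ∫ y in (0 : ℝ)..x, clamp ψ y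
  -- Truncating the derivative gives Lipschitz primitives, for which the inequality is known. They
  -- increase to the given primitive because `ψ` is non-negative.
  set ψn : ℕ → ℝ → ℝ := fun n x => min (ψ x) n
  set Φn : ℕ → ℝ → ℝ := fun n x => ∫ y in (0 : ℝ)..x, clamp (ψn n) y
  have hψn : ∀ n, Cls 0 (ψn n) := fun n => cls_min_const hψ n
  have hψn0 : ∀ n x, 0 ≤ x → 0 ≤ ψn n x := fun n x hx => le_min (hψ0 x hx) (Nat.cast_nonneg n)
  have hΦ : Cls 1 Φ := cls_integral_clamp hψ
  have hΦn : ∀ n, Cls 1 (Φn n) := fun n => cls_integral_clamp (hψn n)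
  have hΦn0 : ∀ n x, 0 ≤ x → 0 ≤ Φn n x := fun n x hx =>
    intervalIntegral.integral_nonneg hx fun y hy => by
      rw [clamp_of_nonneg _ hy.1]; exact hψn0 n y hy.1
  have hΦle : ∀ n x, 0 ≤ x → Φn n x ≤ Φ x := fun n x hx =>
    intervalIntegral.integral_mono_on hx
      ((continuous_clamp (hψn n).1).intervalIntegrable _ _)
      ((continuous_clamp hψ.1).intervalIntegrable _ _) fun y _ => min_le_left _ _
  have hΦlim : ∀ x, 0 ≤ x → Tendsto (fun n => Φn n x) atTop (𝓝 (Φ x)) := by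
    intro x hx
    obtain ⟨B, hB⟩ := isCompact_Icc.exists_bound_of_continuousOn (s := Icc 0 x)
      (continuous_clamp hψ.1).continuousOn
    refine tendsto_const_nhds.congr' ?_
    filter_upwards [eventually_ge_atTop ⌈B⌉₊] with n hn
    refine intervalIntegral.integral_congr fun y hy => ?_
    rw [uIcc_of_le hx] at hy
    have h1 : clamp ψ y ≤ n := (le_abs_self _).trans
      ((hB y hy).trans ((Nat.le_ceil B).trans (by exact_mod_cast hn)))
    exact (min_eq_left h1).symm
  have hψlim : ∀ x, 0 ≤ x → Tendsto (fun n => ψn n x ^ 2) atTop (𝓝 (ψ x ^ 2)) := by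
    intro x _
    refine tendsto_const_nhds.congr' ?_
    filter_upwards [eventually_ge_atTop ⌈ψ x⌉₊] with n hn
    simp only [ψn]
    rw [min_eq_left ((Nat.le_ceil _).trans (by exact_mod_cast hn))]
  have t1 := H.tendsto_jumpMean (fun n => ((hΦn n).zero.pow 2)) (hΦ.zero.pow 2)
    (fun n x hx => by
      rw [abs_of_nonneg (sq_nonneg _)]
      exact pow_le_pow_left₀ (hΦn0 n x hx) (hΦle n x hx) 2)
    (fun x hx => (hΦlim x hx).pow 2)
  have t2 := H.tendsto_jumpMean (fun n => (hΦn n).zero) hΦ.zero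
    (fun n x hx => by
      rw [abs_of_nonneg (hΦn0 n x hx)]
      exact hΦle n x hx) hΦlim
  have t3 := H.tendsto_jumpMean (fun n => ((hψn n).pow 2)) (hψ.pow 2)
    (fun n x hx => by
      rw [abs_of_nonneg (sq_nonneg _)]
      exact pow_le_pow_left₀ (hψn0 n x hx) (min_le_left _ _) 2) hψlim
  refine le_of_tendsto_of_tendsto' (t1.sub (t2.pow 2)) (t3.const_mul _) fun n => ?_
  have h1 := H.jumpMean_variance_le_of_bounded (hΦn n) (l := n) (Nat.cast_nonneg n) fun y hy => by
    rw [D_integral_clamp (hψn n) hy, abs_of_nonneg (hψn0 n y hy)]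
    exact min_le_right _ _
  have h2 : ∀ x, 0 ≤ x → D (Φn n) x ^ 2 = ψn n x ^ 2 := fun x hx => by
    simp only [Φn]
    rw [D_integral_clamp (hψn n) hx]
  rwa [H.jumpMean_congr h2] at h1

/-- The chain sends the identity to `δ x + δ h(x)`, at most `δ x + δ / λ_*`; invariance turns this
into a bound on the mean. -/
lemma jumpMean_id_le (H : Stationary lam δ μ) :
    jumpMean lam δ μ (fun x => x) ≤ δ / (lam 0 * (1 - δ)) := by
  have hid : Cls 0 fun x : ℝ => x := Cls.id 0
  have h1 := H.jumpMean_jumpOp hid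
  have hD : ∀ y, (0 : ℝ) ≤ y → D (fun x : ℝ => x) y = 1 := fun y hy =>
    D_eq hy (hasDerivWithinAt_id y _)
  have h2 : ∀ x, 0 ≤ x → jumpOp lam δ (fun x => x) x = δ * x + δ * meanWait lam x := by
    intro x hx
    have h3 := resolv_rate_mul H.rate H.cls (Cls.id 1) hx
    rw [resolv_congr fun y hy => hD y (hx.trans hy), ← meanWait_eq] at h3
    rw [jumpOp, resolv_congr (g := fun y => δ * (lam y * y)) fun y _ => by ring, resolv_const_mul,
      h3]
    ring
  have hm := (cls_meanWait H.rate H.cls).zero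
  rw [H.jumpMean_congr h2, H.jumpMean_add ((Cls.const 0 _).mul hid) ((Cls.const 0 _).mul hm),
    jumpMean_const_mul, jumpMean_const_mul] at h1
  have h4 := H.jumpMean_mono hm (Cls.const 0 (1 / lam 0)) fun x hx => meanWait_le H.rate H.cls hx
  rw [H.jumpMean_const] at h4
  have h5 := mul_le_mul_of_nonneg_left h4 H.nonneg
  have h6 := sub_pos.2 H.lt_one
  rw [← div_div, le_div_iff₀ h6]
  have h7 : δ / lam 0 = δ * (1 / lam 0) := by ring
  rw [h7]
  linarith

/-- A point, not further than twice the mean, where a non-decreasing function is close to its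
mean. -/
lemma exists_jumpMean_sq_sub_le (H : Stationary lam δ μ) (hφ : Cls 0 φ)
    (hmono : MonotoneOn φ (Ici 0)) :
    ∃ x₀ ∈ Icc 0 (2 * δ / (lam 0 * (1 - δ))), jumpMean lam δ μ (fun x => (φ x - φ x₀) ^ 2) ≤
      3 * (jumpMean lam δ μ (fun x => φ x ^ 2) - jumpMean lam δ μ φ ^ 2) := by
  set m₀ := 2 * δ / (lam 0 * (1 - δ)) with hm₀
  set E := jumpMean lam δ μ φ
  set v := jumpMean lam δ μ (fun x => φ x ^ 2) - E ^ 2 with hv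
  have hm₀0 : 0 ≤ m₀ :=
    div_nonneg (mul_nonneg zero_le_two H.nonneg) (mul_nonneg H.rate.pos.le (sub_pos.2 H.lt_one).le)
  have hvE : jumpMean lam δ μ (fun x => (φ x - E) ^ 2) = v := by
    rw [H.jumpMean_sq_sub hφ]; ring
  have hv0 : 0 ≤ v := by
    rw [← hvE, ← H.jumpMean_const 0]
    exact H.jumpMean_mono (Cls.const 0 0) ((hφ.sub (Cls.const 0 _)).pow 2) fun x _ => sq_nonneg _
  -- If the mean does not exceed `φ m₀`, it is attained on `[0, m₀]`. Otherwise `m₀` itself serves,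
  -- at the cost of a squared bias of at most `2 * v`.
  rcases le_or_gt E (φ m₀) with hle | hlt
  · have h0 : φ 0 ≤ E := by
      rw [← H.jumpMean_const (φ 0)]
      exact H.jumpMean_mono (Cls.const 0 _) hφ fun x hx => hmono self_mem_Ici hx hx
    obtain ⟨x₀, hx₀, hφx₀⟩ := intermediate_value_Icc hm₀0 (hφ.1.mono Icc_subset_Ici_self) ⟨h0, hle⟩
    refine ⟨x₀, hx₀, ?_⟩
    rw [hφx₀, hvE]
    linarith
  · refine ⟨m₀, ⟨hm₀0, le_rfl⟩, ?_⟩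
    rw [H.jumpMean_sq_sub hφ]
    suffices hs : (E - φ m₀) ^ 2 ≤ 2 * v by linarith
    -- For `δ = 0` every jump lands at the origin, so the mean equals `φ 0 = φ m₀`, contrary to the
    -- case at hand.
    have hm₀pos : 0 < m₀ := by
      rcases H.nonneg.eq_or_lt with h0 | h0
      · exfalso
        have hz : m₀ = 0 := by rw [hm₀, ← h0]; simp
        have : E = φ 0 := by
          simp only [E]
          rw [← H.jumpMean_const (φ 0), jumpMean, jumpMean]
          simp [← h0]
        rw [hz, this] at hlt
        exact lt_irrefl _ hlt
      · exact div_pos (by linarith) (mul_pos H.rate.pos (sub_pos.2 H.lt_one))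
    -- A Markov-type argument: on `[0, m₀]`, by monotonicity, `φ` is at least `E - φ m₀` below `E`,
    -- and beyond `m₀` the left side is non-positive. As `m₀` is twice the bound on the mean
    -- position, `m₀ - x` has mean at least `m₀ / 2`.
    have h1 : jumpMean lam δ μ (fun x => (E - φ m₀) ^ 2 * (m₀ + (-1) * x)) ≤
        jumpMean lam δ μ (fun x => m₀ * (φ x - E) ^ 2) := by
      refine H.jumpMean_mono ((Cls.const 0 _).mul ((Cls.const 0 _).add
        ((Cls.const 0 _).mul (Cls.id 0)))) ((Cls.const 0 _).mul ((hφ.sub (Cls.const 0 _)).pow 2))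
        fun x hx => ?_
      rcases le_total x m₀ with hxm | hxm
      · have h2 := hmono hx hm₀0 hxm
        have h3 : (E - φ m₀) ^ 2 ≤ (φ x - E) ^ 2 := by nlinarith
        nlinarith [sq_nonneg (E - φ m₀)]
      · have h2 : (E - φ m₀) ^ 2 * (m₀ + (-1) * x) ≤ 0 :=
          mul_nonpos_of_nonneg_of_nonpos (sq_nonneg _) (by linarith)
        exact h2.trans (by positivity)
    rw [jumpMean_const_mul, jumpMean_const_mul, H.jumpMean_add (Cls.const 0 _)
      ((Cls.const 0 _).mul (Cls.id 0)), jumpMean_const_mul, H.jumpMean_const, hvE] at h1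
    have h2 : jumpMean lam δ μ (fun x => x) ≤ m₀ / 2 := by
      refine H.jumpMean_id_le.trans (le_of_eq ?_)
      rw [hm₀]; ring
    have h3 := mul_le_mul_of_nonneg_left (show m₀ / 2 ≤ m₀ + -1 * jumpMean lam δ μ (fun x => x) by
      linarith) (sq_nonneg (E - φ m₀))
    have h4 : m₀ * (E - φ m₀) ^ 2 ≤ m₀ * (2 * v) := by linarith
    exact le_of_mul_le_mul_left h4 hm₀pos

end Stationary

/-- The mean of `f` over the positions between two jumps, starting from `x`. -/
def localMean (lam f : ℝ → ℝ) (x : ℝ) : ℝ := resolv lam f x / meanWait lam x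

/-- In the quotient rule the terms with `lam x` cancel, and `resolv_eq` identifies what remains as
an average of `D f`. -/
lemma hasDerivWithinAt_localMean (h : GoodRate lam) (hlam : Cls 0 lam) (hf : Cls 1 f) {x : ℝ}
    (hx : 0 ≤ x) : HasDerivWithinAt (localMean lam f)
      (resolv lam (fun y => meanWait lam y * D f y) x / meanWait lam x ^ 2) (Ici 0) x := by
  have hm := cls_meanWait h hlam
  have hp := (meanWait_pos h hx).ne'
  refine ((hasDerivWithinAt_resolv h hf.zero hx).div (hasDerivWithinAt_D hm.1 hx)
    hp).congr_deriv ?_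
  rw [D_meanWait h hx, resolv_eq h hlam hf hx]
  congr 1
  ring

/-- Cauchy–Schwarz gives one factor `meanWait lam x`; since `meanWait` is non-increasing, two more
come out of the integral and cancel the denominator. -/
lemma meanWait_mul_deriv_localMean_sq_le (h : GoodRate lam) (hlam : Cls 0 lam) (hf : Cls 1 f)
    {x : ℝ} (hx : 0 ≤ x) :
    meanWait lam x * (resolv lam (fun y => meanWait lam y * D f y) x / meanWait lam x ^ 2) ^ 2 ≤
      resolv lam (fun y => D f y ^ 2) x := by
  have hm := (cls_meanWait h hlam).zero
  have hp := meanWait_pos h hx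
  have hD : Cls 0 (D f) := hf.2.2
  have h1 := resolv_sq_le h (hm.mul hD) hx
  have h2 : resolv lam (fun y => (meanWait lam y * D f y) ^ 2) x ≤
      meanWait lam x ^ 2 * resolv lam (fun y => D f y ^ 2) x := by
    rw [← resolv_const_mul]
    refine resolv_mono h ((hm.mul hD).pow 2) ((Cls.const 0 _).mul (hD.pow 2)) hx fun y hy => ?_
    rw [mul_pow]
    exact mul_le_mul_of_nonneg_right (pow_le_pow_left₀ (meanWait_pos h (hx.trans hy)).le
      (meanWait_antitoneOn h hlam hx (hx.trans hy) hy) 2) (sq_nonneg _)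
  rw [div_pow, ← mul_div_assoc, div_le_iff₀ (by positivity)]
  calc meanWait lam x * resolv lam (fun y => meanWait lam y * D f y) x ^ 2
      ≤ meanWait lam x * (meanWait lam x *
        (meanWait lam x ^ 2 * resolv lam (fun y => D f y ^ 2) x)) :=
        mul_le_mul_of_nonneg_left (h1.trans (mul_le_mul_of_nonneg_left h2 hp.le)) hp.le
    _ = _ := by ring

/-- Bias and variance on one stretch: the second moment around `c` is the one around the local mean
plus a squared bias, and the former is at most the one around `f x`, where the Hardy inequality
applies. -/
lemma resolv_sq_sub_const_le (h : GoodRate lam) (hlam : Cls 0 lam) (hf : Cls 1 f) (c : ℝ) {x : ℝ}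
    (hx : 0 ≤ x) : resolv lam (fun y => (f y - c) ^ 2) x ≤
      4 / lam 0 ^ 2 * resolv lam (fun y => D f y ^ 2) x +
        meanWait lam x * (localMean lam f x - c) ^ 2 := by
  have hexp : ∀ a : ℝ, resolv lam (fun y => (f y - a) ^ 2) x =
      resolv lam (fun y => f y ^ 2) x + (-(2 * a)) * resolv lam f x + a ^ 2 * meanWait lam x := by
    intro a
    rw [← resolv_const, ← resolv_const_mul, ← resolv_add h (hf.zero.pow 2)
      ((Cls.const 0 _).mul hf.zero) hx, ← resolv_add h ((hf.zero.pow 2).add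
      ((Cls.const 0 _).mul hf.zero)) (Cls.const 0 _) hx]
    exact resolv_congr fun y _ => by ring
  have h1 := resolv_sq_sub_le h hlam hf hx
  have hp := meanWait_pos h hx
  have hk : resolv lam f x = meanWait lam x * localMean lam f x := by
    rw [localMean, mul_div_cancel₀ _ hp.ne']
  rw [hexp, hk] at h1 ⊢
  nlinarith [mul_nonneg hp.le (sq_nonneg (localMean lam f x - f x))]

/-- The weighted comparison between the local means and the primitive of `|k'| √h`. -/
lemma meanWait_mul_sq_sub_le (h : GoodRate lam) (hlam : Cls 0 lam) {k k' : ℝ → ℝ}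
    (hk : ∀ x, 0 ≤ x → HasDerivWithinAt k (k' x) (Ici 0) x) (hk' : ContinuousOn k' (Ici 0))
    {x x₀ : ℝ} (hx : 0 ≤ x) (hx₀ : 0 ≤ x₀) :
    meanWait lam x * (k x - k x₀) ^ 2 ≤ 1 / (lam 0 * meanWait lam x₀) *
      ((∫ y in (0 : ℝ)..x, clamp (fun y => |k' y| * √(meanWait lam y)) y) -
        ∫ y in (0 : ℝ)..x₀, clamp (fun y => |k' y| * √(meanWait lam y)) y) ^ 2 := by
  set ψ : ℝ → ℝ := fun y => |k' y| * √(meanWait lam y)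
  have hm := (cls_meanWait h hlam).zero
  have hanti := meanWait_antitoneOn h hlam
  have hψc : ContinuousOn ψ (Ici 0) := hk'.abs.mul hm.1.sqrt
  have key : ∀ a b : ℝ, 0 ≤ a → a ≤ b → √(meanWait lam b) * |k b - k a| ≤
      (∫ y in (0 : ℝ)..b, clamp ψ y) - ∫ y in (0 : ℝ)..a, clamp ψ y := by
    intro a b ha hab
    have hsub : Icc a b ⊆ Ici 0 := fun y hy => mem_Ici.2 (ha.trans hy.1)
    have hint : IntervalIntegrable k' volume a b :=
      (hk'.mono hsub).intervalIntegrable_of_Icc hab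
    have hftc : ∫ y in a..b, k' y = k b - k a :=
      intervalIntegral.integral_eq_sub_of_hasDerivAt_of_le hab
        (fun y hy => ((hk y (hsub hy)).continuousWithinAt).mono hsub)
        (fun y hy => (hk y (ha.trans hy.1.le)).hasDerivAt (Ici_mem_nhds (ha.trans_lt hy.1))) hint
    rw [intervalIntegral.integral_interval_sub_left
      ((continuous_clamp hψc).intervalIntegrable _ _)
      ((continuous_clamp hψc).intervalIntegrable _ _), ← hftc]
    calc √(meanWait lam b) * |∫ y in a..b, k' y|
        ≤ √(meanWait lam b) * ∫ y in a..b, |k' y| := mul_le_mul_of_nonneg_left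
          (intervalIntegral.abs_integral_le_integral_abs hab) (Real.sqrt_nonneg _)
      _ = ∫ y in a..b, √(meanWait lam b) * |k' y| :=
          (intervalIntegral.integral_const_mul _ _).symm
      _ ≤ _ := by
          refine intervalIntegral.integral_mono_on hab (hint.abs.const_mul _)
            ((continuous_clamp hψc).intervalIntegrable _ _) fun y hy => ?_
          rw [clamp_of_nonneg ψ (hsub hy), mul_comm]
          exact mul_le_mul_of_nonneg_left (Real.sqrt_le_sqrt
            (hanti (hsub hy) (ha.trans hab) hy.2)) (abs_nonneg _)
  have hp := meanWait_pos h hx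
  have hp0 := meanWait_pos h hx₀
  set Δ := (∫ y in (0 : ℝ)..x, clamp ψ y) - ∫ y in (0 : ℝ)..x₀, clamp ψ y
  have hsq : ∀ {a b : ℝ}, 0 ≤ a → a * b ^ 2 = (√a * |b|) ^ 2 := fun ha => by
    rw [mul_pow, Real.sq_sqrt ha, sq_abs]
  have hlh : ∀ y, 0 ≤ y → lam 0 * meanWait lam y ≤ 1 := fun y hy => by
    have := meanWait_le h hlam hy
    rwa [le_div_iff₀ h.pos, mul_comm] at this
  have hl0 := h.pos
  -- To the right of `x₀` the weight at `x` is the smallest on the interval and enters the integral.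
  -- To the left it may be too large for that; it is bounded by `1 / lam 0`, and the weight at `x₀`
  -- is used instead.
  rcases le_total x₀ x with hle | hle
  · have h1 := key x₀ x hx₀ hle
    rw [hsq hp.le]
    have h2 := pow_le_pow_left₀ (mul_nonneg (Real.sqrt_nonneg _) (abs_nonneg _)) h1 2
    refine h2.trans (le_mul_of_one_le_left (sq_nonneg _) ?_)
    exact (one_le_div (by positivity)).2 (hlh x₀ hx₀)
  · have h1 := key x x₀ hx hle
    have h2 := pow_le_pow_left₀ (mul_nonneg (Real.sqrt_nonneg _) (abs_nonneg _)) h1 2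
    rw [← hsq hp0.le] at h2
    have h3 : meanWait lam x₀ * (k x - k x₀) ^ 2 ≤ Δ ^ 2 := by
      have e1 : (k x - k x₀) ^ 2 = (k x₀ - k x) ^ 2 := by ring
      have e2 : Δ ^ 2 = ((∫ y in (0 : ℝ)..x₀, clamp ψ y) - ∫ y in (0 : ℝ)..x, clamp ψ y) ^ 2 := by
        simp only [Δ]; ring
      rw [e1, e2]; exact h2
    have h4 : meanWait lam x * (k x - k x₀) ^ 2 ≤ 1 / lam 0 * (k x - k x₀) ^ 2 :=
      mul_le_mul_of_nonneg_right (meanWait_le h hlam hx) (sq_nonneg _)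
    refine h4.trans ?_
    rw [one_div_mul_eq_div, one_div_mul_eq_div, div_le_div_iff₀ hl0 (by positivity)]
    nlinarith [mul_le_mul_of_nonneg_left h3 hl0.le]

/-- The Poincaré inequality for the invariant law, on functions of class `C¹` with polynomial
growth. -/
theorem Stationary.variance_le (H : Stationary lam δ μ) (hf : Cls 1 f) :
    ∫ x, f x ^ 2 ∂μ - (∫ x, f x ∂μ) ^ 2 ≤ poincareConst lam δ * ∫ x, D f x ^ 2 ∂μ := by
  have hprob := H.inv.1
  have hrate := H.rate
  have hlam := H.cls
  have hD : Cls 0 (D f) := hf.2.2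
  have hm := (cls_meanWait hrate hlam).zero
  set k := localMean lam f
  set k' : ℝ → ℝ := fun x => resolv lam (fun y => meanWait lam y * D f y) x / meanWait lam x ^ 2
  have hk : ∀ x, 0 ≤ x → HasDerivWithinAt k (k' x) (Ici 0) x := fun x hx =>
    hasDerivWithinAt_localMean hrate hlam hf hx
  have hk'c : ContinuousOn k' (Ici 0) := (cls_resolv hrate hlam (hm.mul hD)).continuousOn.div
    (hm.1.pow 2) fun x hx => pow_ne_zero 2 (meanWait_pos hrate hx).ne'
  -- Chosen so that `ψ²` is the quantity bounded in `meanWait_mul_deriv_localMean_sq_le`, and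
  -- non-negative so that its primitive is non-decreasing.
  set ψ : ℝ → ℝ := fun y => |k' y| * √(meanWait lam y)
  have hRD : Cls 0 (resolv lam fun y => D f y ^ 2) := (cls_resolv hrate hlam (hD.pow 2)).zero
  have hψsq : ∀ x, 0 ≤ x → ψ x ^ 2 ≤ resolv lam (fun y => D f y ^ 2) x := by
    intro x hx
    have := meanWait_mul_deriv_localMean_sq_le hrate hlam hf hx
    simp only [ψ]
    rw [mul_pow, sq_abs, Real.sq_sqrt (meanWait_pos hrate hx).le, mul_comm]
    exact this
  have hψ0 : ∀ x, 0 ≤ x → 0 ≤ ψ x := fun x _ => mul_nonneg (abs_nonneg _) (Real.sqrt_nonneg _)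
  have hψ : Cls 0 ψ := by
    refine ⟨hk'c.abs.mul hm.1.sqrt, (hRD.2.add (Growth.const 1)).mono fun x hx => ?_⟩
    have h1 := hψsq x hx
    rw [abs_of_nonneg (hψ0 x hx), abs_of_nonneg (by linarith [sq_nonneg (ψ x)])]
    nlinarith [sq_nonneg (ψ x - 1)]
  set Φ : ℝ → ℝ := fun x => ∫ y in (0 : ℝ)..x, clamp ψ y
  have hΦ : Cls 1 Φ := cls_integral_clamp hψ
  have hmono : MonotoneOn Φ (Ici 0) := by
    refine monotoneOn_of_hasDerivWithinAt_nonneg (convex_Ici 0) hΦ.continuousOn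
      (fun x hx => (hasDerivWithinAt_integral_clamp hψ.1 (interior_subset hx)).mono
        interior_subset) fun x hx => hψ0 x (interior_subset hx)
  obtain ⟨x₀, hx₀, hvar⟩ := H.exists_jumpMean_sq_sub_le hΦ.zero hmono
  have hpoi := H.jumpMean_variance_le hψ hψ0
  have hψR := H.jumpMean_mono (hψ.pow 2) hRD hψsq
  set c := k x₀
  have hδ2 : 0 < 1 - δ ^ 2 := by have := H.nonneg; have := H.lt_one; nlinarith
  have hl0 := hrate.pos
  have hp0 := meanWait_pos hrate hx₀.1
  set m₀ := 2 * δ / (lam 0 * (1 - δ))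
  have hm₀ : 0 ≤ m₀ := hx₀.1.trans hx₀.2
  have hpm := meanWait_pos hrate hm₀
  have hpt : ∀ x, 0 ≤ x → resolv lam (fun y => (f y - c) ^ 2) x ≤
      4 / lam 0 ^ 2 * resolv lam (fun y => D f y ^ 2) x +
        1 / (lam 0 * meanWait lam x₀) * (Φ x - Φ x₀) ^ 2 := fun x hx =>
    (resolv_sq_sub_const_le hrate hlam hf c hx).trans
      (add_le_add le_rfl (meanWait_mul_sq_sub_le hrate hlam hk hk'c hx hx₀.1))
  have hfc : Cls 0 fun y => (f y - c) ^ 2 := (hf.zero.sub (Cls.const 0 _)).pow 2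
  have hΦc : Cls 0 fun y => (Φ y - Φ x₀) ^ 2 := (hΦ.zero.sub (Cls.const 0 _)).pow 2
  have hmean := H.jumpMean_mono (cls_resolv hrate hlam hfc).zero
    (((Cls.const 0 _).mul hRD).add ((Cls.const 0 _).mul hΦc)) hpt
  rw [H.jumpMean_add ((Cls.const 0 _).mul hRD) ((Cls.const 0 _).mul hΦc),
    Stationary.jumpMean_const_mul, Stationary.jumpMean_const_mul] at hmean
  set R := jumpMean lam δ μ (resolv lam fun y => D f y ^ 2)
  have hR0 : 0 ≤ R := by
    simp only [R]
    rw [← H.jumpMean_const 0]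
    exact H.jumpMean_mono (Cls.const 0 0) hRD fun x _ => resolv_nonneg fun y _ => sq_nonneg _
  set a := 4 * δ ^ 2 / (lam 0 ^ 2 * (1 - δ ^ 2)) with ha
  have ha0 : 0 ≤ a := by positivity
  have h1 : jumpMean lam δ μ (fun x => (Φ x - Φ x₀) ^ 2) ≤ 3 * (a * R) := by
    have := mul_le_mul_of_nonneg_left hψR ha0
    linarith
  have h2 : 1 / (lam 0 * meanWait lam x₀) ≤ 1 / (lam 0 * meanWait lam m₀) :=
    one_div_le_one_div_of_le (by positivity) (mul_le_mul_of_nonneg_left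
      (meanWait_antitoneOn hrate hlam hx₀.1 hm₀ hx₀.2) hl0.le)
  -- The factor `3` is relaxed to `8`, which with the `4` inside `a` gives the `32` of the stated
  -- constant.
  have h3 : 1 / (lam 0 * meanWait lam x₀) * jumpMean lam δ μ (fun x => (Φ x - Φ x₀) ^ 2) ≤
      1 / (lam 0 * meanWait lam m₀) * (8 * (a * R)) :=
    mul_le_mul h2 (h1.trans (by linarith [mul_nonneg ha0 hR0])) (by
      rw [← H.jumpMean_const 0]
      exact H.jumpMean_mono (Cls.const 0 0) hΦc fun x _ => sq_nonneg _) (by positivity)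
  have h4 : poincareConst lam δ * R = 4 / lam 0 ^ 2 * R +
      1 / (lam 0 * meanWait lam m₀) * (8 * (a * R)) := by
    have : poincareConst lam δ = 4 / lam 0 ^ 2 + 32 * δ ^ 2 /
      (lam 0 ^ 3 * (1 - δ ^ 2) * meanWait lam m₀) := rfl
    rw [this, ha]
    field_simp
    ring
  have h5 : jumpMean lam δ μ (resolv lam fun y => (f y - c) ^ 2) ≤ poincareConst lam δ * R := by
    linarith
  -- Multiplying by the mean rate converts both post-jump means back into integrals against `μ`.
  have h6 := mul_le_mul_of_nonneg_left h5 H.integral_rate_pos.le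
  rw [← H.integral_eq_jumpMean hfc, mul_left_comm, ← H.integral_eq_jumpMean (hD.pow 2)] at h6
  refine le_trans ?_ h6
  have hfi := H.integrable hf.zero
  have hfi2 := H.integrable (hf.zero.pow 2)
  have h7 : ∫ x, (f x - c) ^ 2 ∂μ = ∫ x, f x ^ 2 ∂μ - 2 * c * ∫ x, f x ∂μ + c ^ 2 := by
    have e : ∀ x, (f x - c) ^ 2 = f x ^ 2 - 2 * c * f x + c ^ 2 := fun x => by ring
    simp_rw [e]
    have hi : Integrable (fun x => f x ^ 2 - 2 * c * f x) μ := hfi2.sub (hfi.const_mul _)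
    rw [integral_add hi (integrable_const _),
      integral_sub hfi2 (hfi.const_mul _), integral_const_mul]
    simp
  rw [h7]
  nlinarith [sq_nonneg (∫ x, f x ∂μ - c)]

end PoincareInequality

/-! ### Polynomial bounds in time and space, for domination under the integral. -/

/-- At most polynomial growth in time and space. -/
def TimeGrowth (F : ℝ → ℝ → ℝ) : Prop :=
  ∃ (C : ℝ) (k : ℕ), 0 ≤ C ∧ ∀ t x, 0 ≤ t → 0 ≤ x → |F t x| ≤ C * (1 + x + t) ^ k

section TimeGrowth

variable {F G : ℝ → ℝ → ℝ}

lemma TimeGrowth.add (hF : TimeGrowth F) (hG : TimeGrowth G) :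
    TimeGrowth fun t x => F t x + G t x := by
  obtain ⟨C, k, hC0, hC⟩ := hF
  obtain ⟨C', k', hC0', hC'⟩ := hG
  refine ⟨C + C', max k k', by positivity, fun t x ht hx => (abs_add_le _ _).trans ?_⟩
  have h1 : 1 ≤ 1 + x + t := by linarith
  rw [add_mul]
  exact add_le_add
    ((hC t x ht hx).trans (mul_le_mul_of_nonneg_left (pow_le_pow_right₀ h1 (le_max_left _ _)) hC0))
    ((hC' t x ht hx).trans
      (mul_le_mul_of_nonneg_left (pow_le_pow_right₀ h1 (le_max_right _ _)) hC0'))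

lemma TimeGrowth.mul (hF : TimeGrowth F) (hG : TimeGrowth G) :
    TimeGrowth fun t x => F t x * G t x := by
  obtain ⟨C, k, hC0, hC⟩ := hF
  obtain ⟨C', k', hC0', hC'⟩ := hG
  refine ⟨C * C', k + k', by positivity, fun t x ht hx => ?_⟩
  rw [abs_mul, pow_add]
  calc |F t x| * |G t x| ≤ (C * (1 + x + t) ^ k) * (C' * (1 + x + t) ^ k') :=
        mul_le_mul (hC t x ht hx) (hC' t x ht hx) (abs_nonneg _)
          ((abs_nonneg _).trans (hC t x ht hx))
    _ = _ := by ring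

lemma Growth.timeGrowth {f : ℝ → ℝ} (hf : Growth f) : TimeGrowth fun _ x => f x := by
  obtain ⟨C, k, hC⟩ := hf
  refine ⟨|C|, k, abs_nonneg C, fun t x ht hx => (hC x hx).trans ?_⟩
  refine (pow_growth_mono hx le_rfl).trans (mul_le_mul_of_nonneg_left ?_ (abs_nonneg C))
  exact pow_le_pow_left₀ (by linarith) (by linarith) k

lemma TimeGrowth.sub (hF : TimeGrowth F) (hG : TimeGrowth G) :
    TimeGrowth fun t x => F t x - G t x := by
  simpa [sub_eq_add_neg] using hF.add ((Growth.const (-1)).timeGrowth.mul hG)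

lemma TimeGrowth.comp_mul (hF : TimeGrowth F) {δ : ℝ} (hδ0 : 0 ≤ δ) (hδ1 : δ ≤ 1) :
    TimeGrowth fun t x => F t (δ * x) := by
  obtain ⟨C, k, hC0, hC⟩ := hF
  refine ⟨C, k, hC0, fun t x ht hx => (hC t _ ht (mul_nonneg hδ0 hx)).trans ?_⟩
  have := mul_nonneg hδ0 hx
  have := mul_le_of_le_one_left hx hδ1
  exact mul_le_mul_of_nonneg_left (pow_le_pow_left₀ (by linarith) (by linarith) k) hC0

lemma TimeGrowth.congr (hF : TimeGrowth F) (h : ∀ t x, 0 ≤ t → 0 ≤ x → G t x = F t x) :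
    TimeGrowth G := by
  obtain ⟨C, k, hC0, hC⟩ := hF
  exact ⟨C, k, hC0, fun t x ht hx => by rw [h t x ht hx]; exact hC t x ht hx⟩

end TimeGrowth

/-! ### Dissipation and exponential decay. -/

section Decay

variable {lam : ℝ → ℝ} {δ : ℝ} {μ : Measure ℝ} {f : ℝ → ℝ} {F F' : ℝ → ℝ → ℝ}

lemma Stationary.exists_bound (H : Stationary lam δ μ) (hF : TimeGrowth F) {T : ℝ} (hT : 0 ≤ T) :
    ∃ b : ℝ → ℝ, Integrable b μ ∧ ∀ᵐ x ∂μ, ∀ t ∈ Icc 0 T, ‖F t x‖ ≤ b x := by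
  obtain ⟨C, k, hC0, hC⟩ := hF
  refine ⟨fun x => C * (1 + T + x) ^ k, (H.inv.integrable_one_add_pow H.rate H.nonneg H.lt_one
    H.cls (1 + T) (by positivity) k).const_mul C, ?_⟩
  filter_upwards [H.inv.ae_nonneg] with x hx t ht
  refine (hC t x ht.1 hx).trans (mul_le_mul_of_nonneg_left
    (pow_le_pow_left₀ (by linarith [ht.1]) (by linarith [ht.2]) k) hC0)

lemma Stationary.continuousOn_integral (H : Stationary lam δ μ) (hF : TimeGrowth F)
    (hFc : ∀ t, 0 ≤ t → ContinuousOn (F t) (Ici 0))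
    (hFt : ∀ x, 0 ≤ x → ContinuousOn (fun t => F t x) (Ici 0)) :
    ContinuousOn (fun t => ∫ x, F t x ∂μ) (Ici 0) := by
  intro t ht
  have ht' : 0 ≤ t := ht
  obtain ⟨b, hb, hFb⟩ := H.exists_bound hF (T := t + 1) (by linarith)
  have hnear : ∀ᶠ s in 𝓝[Ici 0] t, s ∈ Icc 0 (t + 1) := by
    filter_upwards [self_mem_nhdsWithin, nhdsWithin_le_nhds (Iic_mem_nhds (lt_add_one t))]
      with s h1 h2 using ⟨h1, h2⟩
  refine tendsto_integral_filter_of_dominated_convergence b ?_ ?_ hb ?_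
  · filter_upwards [self_mem_nhdsWithin] with s hs using H.inv.aestronglyMeasurable (hFc s hs)
  · filter_upwards [hnear] with s hs
    filter_upwards [hFb] with x hx using hx s hs
  · filter_upwards [H.inv.ae_nonneg] with x hx using hFt x hx t ht

lemma Stationary.hasDerivAt_integral (H : Stationary lam δ μ) (hF : TimeGrowth F)
    (hF' : TimeGrowth F') (hFc : ∀ t, 0 ≤ t → ContinuousOn (F t) (Ici 0))
    (hFc' : ∀ t, 0 ≤ t → ContinuousOn (F' t) (Ici 0))
    (hd : ∀ t x, 0 ≤ t → 0 ≤ x → HasDerivWithinAt (fun t => F t x) (F' t x) (Ici 0) t)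
    {t : ℝ} (ht : 0 < t) : HasDerivAt (fun t => ∫ x, F t x ∂μ) (∫ x, F' t x ∂μ) t := by
  obtain ⟨b, hb, hFb⟩ := H.exists_bound hF (T := t + 1) (by linarith)
  obtain ⟨b', hb', hFb'⟩ := H.exists_bound hF' (T := t + 1) (by linarith)
  refine (hasDerivAt_integral_of_dominated_loc_of_deriv_le (bound := b')
    (Ioo_mem_nhds ht (lt_add_one t)) ?_ ?_ (H.inv.aestronglyMeasurable (hFc' t ht.le)) ?_ hb'
    ?_).2
  · filter_upwards [Ioi_mem_nhds ht] with s hs using H.inv.aestronglyMeasurable (hFc s (le_of_lt hs))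
  · refine hb.mono' (H.inv.aestronglyMeasurable (hFc t ht.le)) ?_
    filter_upwards [hFb] with x hx using hx t ⟨ht.le, by linarith⟩
  · filter_upwards [hFb'] with x hx s hs using hx s (Ioo_subset_Icc_self hs)
  · filter_upwards [H.inv.ae_nonneg] with x hx s hs
    exact (hd s x hs.1.le hx).hasDerivAt (Ici_mem_nhds hs.1)

/-- The logarithmic derivative is bounded by the Lipschitz constant at interior points; the origin
follows by continuity. -/
lemma abs_D_rate_le {κ : ℝ≥0} (h : GoodRate lam) (hlam : Cls 1 lam)
    (hlip : LipschitzOnWith κ (fun x => Real.log (lam x)) (Ici 0)) {x : ℝ} (hx : 0 ≤ x) :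
    |D lam x| ≤ κ * lam x := by
  have hint : ∀ y : ℝ, 0 < y → |D lam y| ≤ κ * lam y := by
    intro y hy
    have hd : HasDerivAt lam (D lam y) y :=
      (hasDerivWithinAt_D hlam.1 hy.le).hasDerivAt (Ici_mem_nhds hy)
    have h1 := (hd.log (h.pos' y).ne').le_of_lipschitzOn (Ici_mem_nhds hy) hlip
    rwa [Real.norm_eq_abs, abs_div, abs_of_pos (h.pos' y), div_le_iff₀ (h.pos' y)] at h1
  have hc1 : ContinuousOn (fun y => |D lam y|) (Ici 0) := hlam.2.2.1.abs
  have hc2 : ContinuousOn (fun y => κ * lam y) (Ici 0) := hlam.continuousOn.const_mul _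
  rcases hx.eq_or_lt with rfl | hx
  · have hle : 𝓝[>] (0 : ℝ) ≤ 𝓝[Ici 0] 0 := nhdsWithin_mono _ Ioi_subset_Ici_self
    refine le_of_tendsto_of_tendsto ((hc1 0 self_mem_Ici).mono_left hle)
      ((hc2 0 self_mem_Ici).mono_left hle) ?_
    filter_upwards [self_mem_nhdsWithin] with y hy using hint y hy
  · exact hint x hx

lemma timeGrowth_semigroup (H : Stationary lam δ μ) (hf : Cls 0 f) :
    TimeGrowth fun t x => semigroup lam δ t f x :=
  growth_semigroup H.rate H.nonneg H.lt_one.le hf.2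

lemma timeGrowth_D_semigroup (H : Stationary lam δ μ) (hf : Cls 1 f) :
    TimeGrowth fun t x => D (semigroup lam δ t f) x := by
  have h1 := timeGrowth_semigroup H hf.zero
  have h2 := timeGrowth_semigroup H (Cls.gen H.nonneg H.lt_one.le H.cls hf)
  refine (h2.sub (H.cls.2.timeGrowth.mul ((h1.comp_mul H.nonneg H.lt_one.le).sub h1))).congr
    fun t x ht hx => D_semigroup H.rate H.nonneg H.lt_one.le H.cls hf hx ht

lemma hasDerivWithinAt_D_semigroup_time (H : Stationary lam δ μ) (hlam : Cls 1 lam) (hf : Cls 2 f)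
    {x t : ℝ} (hx : 0 ≤ x) (ht : 0 ≤ t) :
    HasDerivWithinAt (fun t => D (semigroup lam δ t f) x)
      (D (semigroup lam δ t (gen lam δ f)) x) (Ici 0) t := by
  have hg : Cls 1 (gen lam δ f) := Cls.gen H.nonneg H.lt_one.le hlam hf
  have hd : ∀ {k : ℝ → ℝ} {y : ℝ}, Cls 1 k → 0 ≤ y → HasDerivWithinAt
      (fun t => semigroup lam δ t k y) (semigroup lam δ t (gen lam δ k) y) (Ici 0) t :=
    fun hk hy => hasDerivWithinAt_semigroup_time H.rate H.nonneg H.lt_one.le H.cls hk hy ht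
  rw [D_semigroup H.rate H.nonneg H.lt_one.le H.cls hg hx ht]
  exact ((hd hg hx).sub (((hd hf.one (mul_nonneg H.nonneg hx)).sub (hd hf.one hx)).const_mul
    (lam x))).congr (fun s hs => D_semigroup H.rate H.nonneg H.lt_one.le H.cls hf.one hx hs)
    (D_semigroup H.rate H.nonneg H.lt_one.le H.cls hf.one hx ht)

/-- The derivative of the generator, commuted with the jumps. -/
lemma D_gen (H : Stationary lam δ μ) (hlam : Cls 1 lam) {g : ℝ → ℝ} (hg : Cls 2 g) {x : ℝ}
    (hx : 0 ≤ x) : D (gen lam δ g) x = D (D g) x + D lam x * (g (δ * x) - g x) +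
      lam x * (δ * D g (δ * x) - D g x) := by
  refine D_eq hx (((hasDerivWithinAt_D hg.2.2.1 hx).add ((hasDerivWithinAt_D hlam.1 hx).mul
    ((hasDerivWithinAt_comp_mul H.nonneg hg.1 hx).sub (hasDerivWithinAt_D hg.1 hx)))).congr_deriv ?_)
  simp only [Pi.sub_apply]
  ring

lemma gen_sq {g : ℝ → ℝ} (hg : Cls 1 g) {x : ℝ} (hx : 0 ≤ x) :
    gen lam δ (fun y => g y ^ 2) x =
      2 * g x * D g x + lam x * (g (δ * x) ^ 2 - g x ^ 2) := by
  have h1 : D (fun y => g y ^ 2) x = 2 * g x * D g x :=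
    D_eq hx (((hasDerivWithinAt_D hg.1 hx).pow 2).congr_deriv (by simp))
  rw [gen, h1]

/-- The pointwise dissipation estimate. -/
lemma dissipation_le {l l' κ δ a u v : ℝ} (hl : 0 ≤ l) (hδ0 : 0 ≤ δ) (hδ1 : δ < 1)
    (hl' : |l'| ≤ κ * l) :
    2 * u * (l' * a + l * (δ * v - u)) - l * (v ^ 2 - u ^ 2) -
      2 * κ ^ 2 / (1 - δ ^ 2) * (l * a ^ 2) ≤ -(l * (1 - δ ^ 2) / 2) * u ^ 2 := by
  have hp : 0 < 1 - δ ^ 2 := by nlinarith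
  have h1 : 2 * u * (l' * a) ≤ l * ((1 - δ ^ 2) / 2 * u ^ 2 + 2 * κ ^ 2 / (1 - δ ^ 2) * a ^ 2) := by
    have h2 : 2 * u * (l' * a) ≤ 2 * (|u| * |a|) * (κ * l) := by
      refine (le_abs_self _).trans ?_
      rw [abs_mul, abs_mul, abs_mul, abs_two]
      nlinarith [mul_le_mul_of_nonneg_left hl' (mul_nonneg (abs_nonneg u) (abs_nonneg a))]
    have h3 : 2 * κ * (|u| * |a|) ≤
        (1 - δ ^ 2) / 2 * u ^ 2 + 2 * κ ^ 2 / (1 - δ ^ 2) * a ^ 2 := by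
      rw [← sq_abs u, ← sq_abs a]
      have h4 : 2 * κ ^ 2 / (1 - δ ^ 2) * |a| ^ 2 = 2 * (κ * |a|) ^ 2 / (1 - δ ^ 2) := by ring
      -- Young's inequality with the weight that spends exactly half of the dissipation `(1 - δ ^ 2)
      -- * u ^ 2`; this choice determines `β`.
      have h5 : 0 ≤ ((1 - δ ^ 2) * |u| - 2 * (κ * |a|)) ^ 2 / (2 * (1 - δ ^ 2)) := by positivity
      have h6 : ((1 - δ ^ 2) * |u| - 2 * (κ * |a|)) ^ 2 / (2 * (1 - δ ^ 2)) =
          (1 - δ ^ 2) / 2 * |u| ^ 2 + 2 * (κ * |a|) ^ 2 / (1 - δ ^ 2) - 2 * κ * (|u| * |a|) := by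
        field_simp; ring
      linarith
    nlinarith [mul_le_mul_of_nonneg_left h3 hl]
  -- The jump terms in `u` and `v` add up to `-l (v - δ u)² - l (1 - δ²) u²`.
  have h7 : 0 ≤ l * (δ * u - v) ^ 2 := by positivity
  nlinarith

/-- The integrals of `L (g'²)` and `L ((g - m)²)` vanish and may be subtracted. From the second
there remains `-λ (g(δ x) - g(x))²`, whose multiple by `β` pays for the commutator of `L` with the
derivative. -/
lemma integral_dissipation_le (H : Stationary lam δ μ) (hlam : Cls 1 lam) {κ : ℝ≥0}
    (hlip : LipschitzOnWith κ (fun x => Real.log (lam x)) (Ici 0)) {g : ℝ → ℝ} (hg : Cls 2 g)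
    (m : ℝ) :
    ∫ x, (2 * D g x * D (gen lam δ g) x +
      2 * (κ : ℝ) ^ 2 / (1 - δ ^ 2) * (2 * (g x - m) * gen lam δ g x)) ∂μ ≤
      -(lam 0 * (1 - δ ^ 2) / 2) * ∫ x, D g x ^ 2 ∂μ := by
  set β := 2 * (κ : ℝ) ^ 2 / (1 - δ ^ 2) with hβ
  have hLg : Cls 1 (gen lam δ g) := Cls.gen H.nonneg H.lt_one.le hlam hg
  have hLg' : Cls 0 (D (gen lam δ g)) := hLg.2.2
  have hDg : Cls 1 (D g) := hg.2.2
  have hgm : Cls 1 (fun x => g x - m) := hg.one.sub (Cls.const 1 m)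
  have hL : Cls 0 (fun x => 2 * D g x * D (gen lam δ g) x + β * (2 * (g x - m) * gen lam δ g x)) :=
    (((Cls.const 0 2).mul hDg.zero).mul hLg').add ((Cls.const 0 β).mul
      (((Cls.const 0 2).mul hgm.zero).mul hLg.zero))
  have h1 := H.inv.integral_gen H.rate H.nonneg H.lt_one H.cls (hDg.pow 2)
  have h2 := H.inv.integral_gen H.rate H.nonneg H.lt_one H.cls (hgm.pow 2)
  have hi1 := H.integrable (Cls.gen H.nonneg H.lt_one.le H.cls (hDg.pow 2))
  have hi2 := H.integrable (Cls.gen H.nonneg H.lt_one.le H.cls (hgm.pow 2))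
  have h3 : ∀ᵐ x ∂μ, 2 * D g x * D (gen lam δ g) x + β * (2 * (g x - m) * gen lam δ g x) ≤
      -(lam 0 * (1 - δ ^ 2) / 2) * D g x ^ 2 + gen lam δ (fun y => D g y ^ 2) x +
        β * gen lam δ (fun y => (g y - m) ^ 2) x := by
    filter_upwards [H.inv.ae_nonneg] with x hx
    have hDm : D (fun y => g y - m) x = D g x :=
      D_eq hx ((hasDerivWithinAt_D hg.1 hx).sub_const m)
    have hd := dissipation_le (a := g (δ * x) - g x) (u := D g x) (v := D g (δ * x))
      (H.rate.pos' x).le H.nonneg H.lt_one (abs_D_rate_le H.rate hlam hlip hx)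
    have hl : lam 0 * (1 - δ ^ 2) / 2 * D g x ^ 2 ≤ lam x * (1 - δ ^ 2) / 2 * D g x ^ 2 := by
      have := H.rate.low x
      have : 0 ≤ 1 - δ ^ 2 := by nlinarith [H.nonneg, H.lt_one]
      gcongr
    rw [gen_sq hDg hx, gen_sq hgm hx, hDm, D_gen H hlam hg hx, gen]
    rw [← hβ] at hd
    linear_combination hd + hl
  have hi3 : Integrable (fun x => -(lam 0 * (1 - δ ^ 2) / 2) * D g x ^ 2) μ :=
    (H.integrable (hDg.zero.pow 2)).const_mul _
  have hi4 : Integrable (fun x => -(lam 0 * (1 - δ ^ 2) / 2) * D g x ^ 2 +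
    gen lam δ (fun y => D g y ^ 2) x) μ := hi3.add hi1
  refine (integral_mono_ae (H.integrable hL) (hi4.add (hi2.const_mul β)) h3).trans_eq ?_
  simp only [Pi.add_apply]
  rw [integral_add hi4 (hi2.const_mul β), integral_add hi3 hi1, integral_const_mul,
    integral_const_mul, h1, h2]
  ring

lemma Stationary.integral_sub_sq (H : Stationary lam δ μ) {g : ℝ → ℝ} (hg : Cls 0 g) :
    ∫ x, (g x - ∫ y, g y ∂μ) ^ 2 ∂μ = ∫ x, g x ^ 2 ∂μ - (∫ x, g x ∂μ) ^ 2 := by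
  have := H.inv.1
  set m := ∫ y, g y ∂μ with hm
  have hexp : ∀ x : ℝ, (g x - m) ^ 2 = g x ^ 2 - 2 * m * g x + m ^ 2 := fun x => by ring
  have hi1 : Integrable (fun x => g x ^ 2) μ := H.integrable (hg.pow 2)
  have hi2 : Integrable (fun x => 2 * m * g x) μ := (H.integrable hg).const_mul _
  have hi3 : Integrable (fun x => g x ^ 2 - 2 * m * g x) μ := hi1.sub hi2
  simp only [hexp]
  rw [integral_add hi3 (integrable_const _), integral_sub hi1 hi2, integral_const_mul, ← hm]
  simp
  ring

/-- Tested on the identity, whose variance is non-negative and whose energy is `1`; it guarantees `1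
+ β * c > 0`. -/
lemma Poincare.nonneg (H : Stationary lam δ μ) {c : ℝ} (hc : Poincare μ c) : 0 ≤ c := by
  have := H.inv.1
  have h1 := hc (fun x => x) (testFun_of_cls Cls.id)
  have h2 : ∫ x, D (fun x => x) x ^ 2 ∂μ = 1 := by
    have : (fun x => D (fun x => x) x ^ 2) =ᵐ[μ] fun _ => 1 := by
      filter_upwards [H.inv.ae_nonneg] with x hx
      have h3 : D (fun x => x) x = 1 := D_eq hx (hasDerivWithinAt_id x _)
      rw [h3, one_pow]
    rw [integral_congr_ae this]
    simp
  have h3 : 0 ≤ ∫ x, (x - ∫ y, y ∂μ) ^ 2 ∂μ := integral_nonneg fun x => sq_nonneg _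
  rw [H.integral_sub_sq (Cls.id 0)] at h3
  rw [h2, mul_one] at h1
  linarith

/-- The hypothesis concerns test functions only, so it can be applied to `P_t f` because the
semigroup preserves every class `Cls n`. -/
lemma V_le_W (H : Stationary lam δ μ) (hlam : ∀ n, Cls n lam) {c : ℝ} (hc : Poincare μ c)
    (hf : TestFun f) {t : ℝ} (ht : 0 ≤ t) : V lam δ μ f t ≤ c * W lam δ μ f t := by
  have := H.inv.1
  have hP : ∀ n, Cls n (semigroup lam δ t f) := fun n =>
    cls_semigroup H.rate H.nonneg H.lt_one.le (hlam n) ht (hf.cls n)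
  have h1 := hc _ (testFun_of_cls hP)
  rwa [← H.integral_sub_sq (hP 0), H.inv.integral_semigroup H.rate ht
    (H.integrable (hf.cls 0))] at h1

/-- Exponential decay from a differential inequality on `[0, ∞)`. -/
lemma le_mul_exp_of_hasDerivAt_le {Φ Φ' : ℝ → ℝ} {γ : ℝ} (hc : ContinuousOn Φ (Ici 0))
    (hd : ∀ t, 0 < t → HasDerivAt Φ (Φ' t) t) (hle : ∀ t, 0 < t → Φ' t ≤ -γ * Φ t) {t : ℝ}
    (ht : 0 ≤ t) : Φ t ≤ Φ 0 * Real.exp (-(γ * t)) := by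
  have hE : ∀ s : ℝ, HasDerivAt (fun s => Real.exp (γ * s)) (Real.exp (γ * s) * γ) s := fun s =>
    (((hasDerivAt_id s).const_mul γ).exp).congr_deriv (by simp)
  have hanti : AntitoneOn (fun s => Real.exp (γ * s) * Φ s) (Ici 0) := by
    refine antitoneOn_of_hasDerivWithinAt_nonpos (convex_Ici 0)
      (f' := fun s => Real.exp (γ * s) * γ * Φ s + Real.exp (γ * s) * Φ' s) ?_ ?_ ?_
    · exact (Continuous.continuousOn (by fun_prop)).mul hc
    · intro s hs
      rw [interior_Ici] at hs
      exact ((hE s).mul (hd s hs)).hasDerivWithinAt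
    · intro s hs
      rw [interior_Ici] at hs
      have := mul_le_mul_of_nonneg_left (hle s hs) (Real.exp_pos (γ * s)).le
      linarith
  have h1 := hanti self_mem_Ici ht ht
  simp only [mul_zero, Real.exp_zero, one_mul] at h1
  have h2 := mul_le_mul_of_nonneg_right h1 (Real.exp_pos (-(γ * t))).le
  rwa [mul_right_comm, ← Real.exp_add, add_neg_cancel, Real.exp_zero, one_mul] at h2

/-- The functional has derivative at most `-η W`, and `W + β V ≤ (1 + β c) W` by the Poincaré
inequality, so it is dominated by a decaying exponential. -/
theorem Stationary.decay (H : Stationary lam δ μ) (hlam : ∀ n, Cls n lam) {κ : ℝ≥0}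
    (hlip : LipschitzOnWith κ (fun x => Real.log (lam x)) (Ici 0)) {c : ℝ} (hc : Poincare μ c)
    (hf : TestFun f) {η β t : ℝ} (hη : η = lam 0 * (1 - δ ^ 2) / 2)
    (hβ : β = 2 * (κ : ℝ) ^ 2 / (1 - δ ^ 2)) (ht : 0 ≤ t) :
    W lam δ μ f t + β * V lam δ μ f t ≤
      (W lam δ μ f 0 + β * V lam δ μ f 0) * Real.exp (-(η * t) / (1 + β * c)) := by
  have hp : 0 < 1 - δ ^ 2 := by nlinarith [H.nonneg, H.lt_one]
  have hη0 : 0 < η := by rw [hη]; have := H.rate.pos; positivity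
  have hβ0 : 0 ≤ β := by rw [hβ]; positivity
  have hc0 := hc.nonneg H
  set m := ∫ y, f y ∂μ
  set L := gen lam δ f
  have hL : ∀ n, Cls n L := fun n => Cls.gen H.nonneg H.lt_one.le (hlam n) (hf.cls (n + 1))
  have hP : ∀ {k : ℝ → ℝ}, (∀ n, Cls n k) → ∀ t, 0 ≤ t → ∀ n, Cls n (semigroup lam δ t k) :=
    fun hk t ht n => cls_semigroup H.rate H.nonneg H.lt_one.le (hlam n) ht (hk n)
  have hDP : ∀ {k : ℝ → ℝ}, (∀ n, Cls n k) → ∀ t, 0 ≤ t → Cls 0 (D (semigroup lam δ t k)) :=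
    fun hk t ht => (hP hk t ht 1).2.2
  set F : ℝ → ℝ → ℝ := fun t x =>
    D (semigroup lam δ t f) x ^ 2 + β * (semigroup lam δ t f x - m) ^ 2
  set F' : ℝ → ℝ → ℝ := fun t x => 2 * D (semigroup lam δ t f) x * D (semigroup lam δ t L) x +
    β * (2 * (semigroup lam δ t f x - m) * semigroup lam δ t L x)
  have hFF : ∀ t, 0 ≤ t → W lam δ μ f t + β * V lam δ μ f t = ∫ x, F t x ∂μ := by
    intro t ht
    rw [W, V, ← integral_const_mul, ← integral_add (H.integrable ((hDP hf.cls t ht).pow 2))]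
    exact (H.integrable (((hP hf.cls t ht 0).sub (Cls.const 0 m)).pow 2)).const_mul β
  have hg : TimeGrowth fun t x => semigroup lam δ t f x - m :=
    (timeGrowth_semigroup H (hf.cls 0)).sub (Growth.const m).timeGrowth
  have hu := timeGrowth_D_semigroup H (hf.cls 1)
  have hFg : TimeGrowth F := ((hu.mul hu).add ((Growth.const β).timeGrowth.mul (hg.mul hg))).congr
    fun t x _ _ => by simp only [F]; ring
  have hFg' : TimeGrowth F' := (((Growth.const 2).timeGrowth.mul hu).mul
    (timeGrowth_D_semigroup H (hL 1))).add ((Growth.const β).timeGrowth.mul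
    (((Growth.const 2).timeGrowth.mul hg).mul (timeGrowth_semigroup H (hL 0))))
  have hFc : ∀ t, 0 ≤ t → ContinuousOn (F t) (Ici 0) := fun t ht =>
    (((hDP hf.cls t ht).pow 2).add ((Cls.const 0 β).mul
      (((hP hf.cls t ht 0).sub (Cls.const 0 m)).pow 2))).1
  have hFc' : ∀ t, 0 ≤ t → ContinuousOn (F' t) (Ici 0) := fun t ht =>
    ((((Cls.const 0 2).mul (hDP hf.cls t ht)).mul (hDP hL t ht)).add ((Cls.const 0 β).mul
      (((Cls.const 0 2).mul ((hP hf.cls t ht 0).sub (Cls.const 0 m))).mul (hP hL t ht 0)))).1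
  have hd : ∀ t x, 0 ≤ t → 0 ≤ x → HasDerivWithinAt (fun t => F t x) (F' t x) (Ici 0) t := by
    intro t x ht hx
    have h1 := hasDerivWithinAt_D_semigroup_time H (hlam 1) (hf.cls 2) hx ht
    have h2 := hasDerivWithinAt_semigroup_time H.rate H.nonneg H.lt_one.le H.cls (hf.cls 1) hx ht
    refine ((h1.pow 2).add (((h2.sub_const m).pow 2).const_mul β)).congr_deriv ?_
    simp [F', L]
  have hdiss : ∀ t, 0 ≤ t → ∫ x, F' t x ∂μ ≤ -η * W lam δ μ f t := by
    intro t ht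
    have h1 := integral_dissipation_le H (hlam 1) hlip (hP hf.cls t ht 2) m
    rw [← hη, ← hβ] at h1
    refine le_of_eq_of_le (integral_congr_ae ?_) h1
    have hgen : EqOn (gen lam δ (semigroup lam δ t f)) (semigroup lam δ t L) (Ici 0) :=
      fun y hy => gen_semigroup H.rate H.nonneg H.lt_one.le H.cls (hf.cls 1) hy ht
    filter_upwards [H.inv.ae_nonneg] with x hx
    rw [hgen hx, D_congr hgen hx]
  have hb : 0 < 1 + β * c := by positivity
  have hkey := le_mul_exp_of_hasDerivAt_le (γ := η / (1 + β * c))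
    (H.continuousOn_integral hFg hFc fun x hx t ht => (hd t x ht hx).continuousWithinAt)
    (fun t ht => H.hasDerivAt_integral hFg hFg' hFc hFc' hd ht) (fun t ht => ?_) ht
  · rw [hFF t ht, hFF 0 le_rfl, neg_div, mul_div_right_comm]
    exact hkey
  · refine (hdiss t ht.le).trans ?_
    rw [← hFF t ht.le, neg_mul, neg_mul, neg_le_neg_iff, div_mul_eq_mul_div, div_le_iff₀ hb,
      mul_assoc]
    refine mul_le_mul_of_nonneg_left ?_ hη0.le
    nlinarith [mul_le_mul_of_nonneg_left (V_le_W H hlam hc hf ht.le) hβ0]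

lemma Stationary.memLp_two (H : Stationary lam δ μ) (hf : Cls 0 f) : MemLp f 2 μ :=
  (memLp_two_iff_integrable_sq (H.inv.aestronglyMeasurable hf.1)).2 (H.integrable (hf.pow 2))

end Decay

/-! ### Independence from the values of the rate on the negative half-line. -/

section Transfer

variable {lam lam' : ℝ → ℝ} {δ : ℝ} {μ : Measure ℝ} {f : ℝ → ℝ}

/-- Extending the rate by its value at the origin makes it continuous and monotone on the whole
line, which spares side conditions in the analysis. -/
lemma goodRate_clamp (hc : ContinuousOn lam (Ici 0)) (hm : MonotoneOn lam (Ici 0))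
    (hpos : 0 < lam 0) : GoodRate (clamp lam) where
  cont := continuous_clamp hc
  mono x y hxy := hm (mem_Ici.2 (le_max_right _ _)) (mem_Ici.2 (le_max_right _ _))
    (max_le_max_right 0 hxy)
  pos := by simpa [clamp] using hpos
  low x := by
    simpa [clamp] using hm self_mem_Ici (mem_Ici.2 (le_max_right x 0)) (le_max_right x 0)

lemma cumRate_congr (h : EqOn lam lam' (Ici 0)) {x s : ℝ} (hx : 0 ≤ x) (hs : 0 ≤ s) :
    cumRate lam x s = cumRate lam' x s := by
  refine intervalIntegral.integral_congr fun u hu => h ?_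
  rw [uIcc_of_le hs] at hu
  exact add_nonneg hx hu.1

lemma waitingTime_congr (h : EqOn lam lam' (Ici 0)) {x : ℝ} (hx : 0 ≤ x) (r : ℝ) :
    waitingTime lam x r = waitingTime lam' x r := by
  rw [waitingTime, waitingTime]
  congr 1
  ext s
  exact and_congr_right fun hs => by rw [cumRate_congr h hx hs]

lemma meanWait_congr (h : EqOn lam lam' (Ici 0)) {x : ℝ} (hx : 0 ≤ x) :
    meanWait lam x = meanWait lam' x :=
  setIntegral_congr_fun measurableSet_Ioi fun s hs => by
    simp only [cumRate_congr h hx (le_of_lt hs)]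

lemma poincareConst_congr (h : EqOn lam lam' (Ici 0)) (hpos : 0 < lam 0) (hδ0 : 0 ≤ δ)
    (hδ1 : δ < 1) : poincareConst lam δ = poincareConst lam' δ := by
  have h0 : lam 0 = lam' 0 := h self_mem_Ici
  have h1 : 0 ≤ 2 * δ / (lam 0 * (1 - δ)) :=
    div_nonneg (by positivity) (mul_nonneg hpos.le (sub_nonneg.2 hδ1.le))
  rw [poincareConst, poincareConst, meanWait_congr h h1, h0]

/-- Started in `[0, ∞)`, the process never leaves it and so never consults the rate elsewhere. -/
lemma skeleton_congr (h : EqOn lam lam' (Ici 0)) (h' : GoodRate lam') (hδ0 : 0 ≤ δ) (hδ1 : δ ≤ 1)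
    {x : ℝ} (hx : 0 ≤ x) (e : ℕ → ℝ) (n : ℕ) :
    skeleton lam δ x e n = skeleton lam' δ x e n := by
  induction n with
  | zero => rfl
  | succ n ih =>
    simp only [skeleton, ih]
    rw [waitingTime_congr h (skeleton_snd_mem h' hδ0 hδ1 hx e n).1]

lemma process_congr (h : EqOn lam lam' (Ici 0)) (h' : GoodRate lam') (hδ0 : 0 ≤ δ) (hδ1 : δ ≤ 1)
    {x : ℝ} (hx : 0 ≤ x) (e : ℕ → ℝ) (t : ℝ) :
    process lam δ x e t = process lam' δ x e t := by
  simp only [process, numJumps, skeleton_congr h h' hδ0 hδ1 hx]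

lemma semigroup_rate_congr (h : EqOn lam lam' (Ici 0)) (h' : GoodRate lam') (hδ0 : 0 ≤ δ)
    (hδ1 : δ ≤ 1) (t : ℝ) : EqOn (semigroup lam δ t f) (semigroup lam' δ t f) (Ici 0) :=
  fun _ hx => by simp only [semigroup, process_congr h h' hδ0 hδ1 hx]

lemma IsInvariantLaw.rate_congr (h : EqOn lam lam' (Ici 0)) (h' : GoodRate lam') (hδ0 : 0 ≤ δ)
    (hδ1 : δ ≤ 1) (hμ : IsInvariantLaw lam δ μ) : IsInvariantLaw lam' δ μ := by
  refine ⟨hμ.1, hμ.2.1, fun t ht B hB => ?_⟩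
  rw [← hμ.2.2 t ht B hB]
  refine lintegral_congr_ae ?_
  filter_upwards [hμ.ae_nonneg] with x hx
  simp only [process_congr h h' hδ0 hδ1 hx]

lemma W_congr (h : EqOn lam lam' (Ici 0)) (h' : GoodRate lam') (hδ0 : 0 ≤ δ) (hδ1 : δ ≤ 1)
    (hμ : ∀ᵐ x ∂μ, 0 ≤ x) (t : ℝ) : W lam δ μ f t = W lam' δ μ f t := by
  refine integral_congr_ae ?_
  filter_upwards [hμ] with x hx
  rw [D_congr (semigroup_rate_congr h h' hδ0 hδ1 t) hx]

lemma V_congr (h : EqOn lam lam' (Ici 0)) (h' : GoodRate lam') (hδ0 : 0 ≤ δ) (hδ1 : δ ≤ 1)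
    (hμ : ∀ᵐ x ∂μ, 0 ≤ x) (t : ℝ) : V lam δ μ f t = V lam' δ μ f t := by
  refine integral_congr_ae ?_
  filter_upwards [hμ] with x hx
  rw [semigroup_rate_congr h h' hδ0 hδ1 t hx]

end Transfer

end TCP

end

theorem corollary4p6 (lam : ℝ → ℝ) (δ : ℝ) (κ : ℝ≥0)
    (hδ0 : 0 ≤ δ) (hδ1 : δ < 1)
    (hlam : TCP.TestFun lam)
    (hmono : MonotoneOn lam (Ici 0))
    (hpos : 0 < lam 0)
    (hlip : LipschitzOnWith κ (fun x => Real.log (lam x)) (Ici 0))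
    (μ : Measure ℝ) (hμ : TCP.IsInvariantLaw lam δ μ)
    (η β : ℝ) (hη : η = lam 0 * (1 - δ ^ 2) / 2) (hβ : β = 2 * (κ : ℝ) ^ 2 / (1 - δ ^ 2)) :
    TCP.Poincare μ (TCP.poincareConst lam δ) ∧
    ∀ c : ℝ, TCP.Poincare μ c →
      ∀ f : ℝ → ℝ, TCP.TestFun f → ∀ t : ℝ, 0 ≤ t →
        DifferentiableOn ℝ (TCP.semigroup lam δ t f) (Ici 0) ∧
        MemLp (TCP.semigroup lam δ t f) 2 μ ∧
        MemLp (TCP.D (TCP.semigroup lam δ t f)) 2 μ ∧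
        TCP.W lam δ μ f t + β * TCP.V lam δ μ f t ≤
          (TCP.W lam δ μ f 0 + β * TCP.V lam δ μ f 0) * Real.exp (-(η * t) / (1 + β * c)) := by
  -- The given rate is arbitrary on the negative half-line; everything is proved for its clamped
  -- version and carried back.
  have h : EqOn lam (TCP.clamp lam) (Ici 0) := fun x hx => (TCP.clamp_of_nonneg lam hx).symm
  have h' : TCP.GoodRate (TCP.clamp lam) := TCP.goodRate_clamp hlam.1.continuousOn hmono hpos
  have hcls : ∀ n, TCP.Cls n (TCP.clamp lam) := fun n => (hlam.cls n).congr h.symm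
  have H : TCP.Stationary (TCP.clamp lam) δ μ :=
    ⟨h', hδ0, hδ1, hcls 0, hμ.rate_congr h h' hδ0 hδ1.le⟩
  have hlip' : LipschitzOnWith κ (fun x => Real.log (TCP.clamp lam x)) (Ici 0) :=
    fun x hx y hy => by
      simp only [← h hx, ← h hy]
      exact hlip hx hy
  refine ⟨fun f hf => ?_, fun c hc f hf t ht => ?_⟩
  · rw [TCP.poincareConst_congr h hpos hδ0 hδ1]
    exact H.variance_le (hf.cls 1)
  · have hP : TCP.Cls 1 (TCP.semigroup lam δ t f) :=
      (TCP.cls_semigroup h' hδ0 hδ1.le (hcls 1) ht (hf.cls 1)).congr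
        (TCP.semigroup_rate_congr h h' hδ0 hδ1.le t)
    refine ⟨hP.1, H.memLp_two hP.zero, H.memLp_two hP.2.2, ?_⟩
    rw [h self_mem_Ici] at hη
    simp only [TCP.W_congr h h' hδ0 hδ1.le hμ.ae_nonneg, TCP.V_congr h h' hδ0 hδ1.le hμ.ae_nonneg]
    exact H.decay hcls hlip' hc hf hη hβ ht
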